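/- **Theorem (NPG convergence for unichain CMDPs).** *Setting.* Let $(\mathcal S,\mathcal A,r,c,P,\rho)$ be a finite average-reward CMDP with $r\in[0,1]$, $c\in[-1,1]$, and let $\{\pi_\theta\}_{\theta\in\Theta}$, $\Theta\subseteq\mathbb R^d$ open, be policies with $\pi_\theta(a|s)>0$ and $\theta\mapsto\log\pi_\theta(a|s)$ differentiable, such that for every $\theta\in\Theta$ the chain $P^{\pi_\theta}$ has a single recurrent class $\mathcal S_R^\theta$. For $g\in\{r,c\}$ let $d^{\pi_\theta}$, $J_g(\theta)$ and $V_g^{\pi_\theta}$ (normalized by $\sum_s d^{\pi_\theta}(s)V_g^{\pi_\theta}(s)=0$) be the stationary distribution, average reward and value function, $F(\theta)=\mathbb E_{s\sim d^{\pi_\theta},a\sim\pi_\theta}[\nabla\log\pi_\theta(a|s)\otimes\nabla\log\pi_\theta(a|s)]$, and $\omega^*_{g,\theta}=F(\theta)^{-1}\nabla_\theta J_g(\theta)$. For $\theta\in\Theta$ assume $\|\nabla_\theta\log\pi_\theta(a|s)\|\le G_1$ and $F(\theta)\succeq\mu I$, $\mu>0$. With hitting times $T_X=\inf\{t\ge 0:s_t\in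 X\}$ put $C_{\rm hit}=\sup_{\theta\in\Theta}\max_s\mathbb E^\theta_s[T_{\mathcal S_R^\theta}]$, $C_{\rm tar}=\sup_{\theta\in\Theta}\sum_{s'}d^{\pi_\theta}(s')\mathbb E^\theta_s[T_{s'}]$ (any $s\in\mathcal S^\theta_R$), $C=C_{\rm hit}+C_{\rm tar}$; assume $C<\infty$ and $C_{\rm tar}>0$. Let $\phi_g:\mathcal S\to\mathbb R^{m_g}$ satisfy $\|\phi_g(s)\|\le 1$, let $M^g_\theta=\mathbb E[\phi_g(s)(\phi_g(s)-\phi_g(s'))^\top]$ with $s\sim d^{\pi_\theta}$, $s'\sim P^{\pi_\theta}(s,\cdot)$, and assume $x^\top M_\theta^g x\ge\lambda_g\|x\|^2$ for all $\theta\in\Theta$ and $x\in\ker(M_\theta^g)^\perp$, where $\lambda_g>0$ and $\lambda=\min\{\lambda_r,\lambda_c\}\le 1$. Let $\epsilon_{\rm app}=\max_{g}\sup_{\theta\in\Theta}\inf_\zeta\tfrac12\mathbb E_{s\sim d^{\pi_\theta}}[(V_g^{\pi_\theta}(s)-\zeta^\top\phi_g(s))^2]$. *Algorithm.* Inputs: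 $\theta_0$, $\lambda_0=0$, $\alpha,\beta\in\mathbb R$, $\delta>0$, $\gamma_\xi,\gamma_\omega$, $c_\gamma$, $K$, $H$, $B$, $T_{\max}$; $s_0\sim\rho$. Each epoch $k=0,\dots,K-1$ continues the trajectory from the current state, always with actions from $\pi_{\theta_k}$. First run $B$ burn-in steps. Then run $H$ critic iterations, followed by $H$ NPG iterations. Each iteration draws a fresh $Q$ with $\Pr(Q=j)=2^{-j}$, $j\ge 1$, and generates $(2^{Q}-1)\mathbb 1\{2^Q\le T_{\max}\}+1$ transitions $z_0,z_1,\dots$ with $z_t=(s_t,a_t,s_{t+1})$. For a function $f$ of a transition $z=(s,a,s')$ its MLMC estimate is $f^0+\mathbb 1\{2^Q\le T_{\max}\}2^Q(f^Q-f^{Q-1})$, where $f^j=2^{-j}\sum_{t<2^j}f(z_t)$. The critic iterations start at $\xi_g=(\eta_g,\zeta_g)=0$ and subtract $\gamma_\xi$ times the MLMC estimate of $z\mapsto\big(c_\gamma(\eta_g-g(s,a)),\ \phi_g(s)[\eta_g-g(s,a)+(\phi_g(s)-\phi_g(s'))^\top\zeta_g]\big)$; the result is $\xi_g^k=(\eta_g^k,\zeta_g^k)$.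 The NPG iterations start at $\omega_g=0$ and subtract $\gamma_\omega$ times the MLMC estimate of $z\mapsto\nabla\log\pi_{\theta_k}(a|s)\big[\nabla\log\pi_{\theta_k}(a|s)^\top\omega_g-g(s,a)+\eta_g^k-(\zeta_g^k)^\top(\phi_g(s')-\phi_g(s))\big]$; the result is $\omega_g^k$. Within an iteration the same samples serve both $g=r$ and $g=c$. Finally $\theta_{k+1}=\theta_k+\alpha(\omega_r^k+\lambda_k\omega_c^k)$, and $\lambda_{k+1}$ is the projection of $\lambda_k-\beta\eta_c^k$ onto $[0,2/\delta]$. Assume $\theta_k\in\Theta$ almost surely for all $k<K$. Let $\mathcal E_B$ be the event that in each epoch $k<K$ the burn-in under $\pi_{\theta_k}$ visits $\mathcal S_R^{\theta_k}$ within $B$ steps, and let $\mathbb E_k$ be the conditional expectation given $\mathcal E_B$ and the history before epoch $k$. Write $\omega^*_{g,k}=\omega^*_{g,\theta_k}$. *Claim.* There are universal constants $c_0,c_1>0$ and $q\in\mathbb N$ such that the following holds. Let $T\ge 2$, $H\ge 1$, $K\le T$, $B\ge 4C_{\rm hit}\log_2T$, $c_\gamma\ge\lambda+\sqrt{\lambda^{-2}-1}$,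 $$\gamma_\xi=\frac{8\log T}{\lambda H},\qquad \gamma_\omega=\frac{8\log T}{\mu H},\qquad T_{\max}\ge c_0\max\Big\{\frac{c_\gamma^2C_{\rm tar}^2}{\lambda},\frac{G_1^4C_{\rm tar}^2}{\mu^2}\Big\},$$ $$c_0\,c_\gamma^2C_{\rm tar}^2\,\gamma_\xi\log T_{\max}\le\lambda,\qquad c_0\,G_1^4C_{\rm tar}^2\,\gamma_\omega\log T_{\max}\le\mu .$$ Then for every $k<K$ and $g\in\{r,c\}$, on every history of positive probability jointly with $\mathcal E_B$, $\omega_g^k$ is square integrable and $$\mathbb E_k\big[\|\omega_g^k-\omega_{g,k}^*\|^2\big]\le c_1\Big(\frac{G_1^2C^2c_\gamma^2}{\mu^2T^2\lambda^2}+\frac{G_1^6C_{\rm tar}^2c_\gamma^4C^2}{\mu^4\lambda^4}+\frac{G_1^2\epsilon_{\rm app}}{\mu^2}\Big),$$ $$\big\|\mathbb E_k[\omega_g^k]-\omega_{g,k}^*\big\|^2\le c_1(1+\log T)^q\Big(\frac{G_1^2c_\gamma^2C_{\rm tar}^4}{\mu^2\lambda^2T^2}+\frac{G_1^{10}C_{\rm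 tar}^4c_\gamma^2C^2}{\mu^6T_{\max}\lambda^4}+\frac{G_1^2\epsilon_{\rm app}}{\mu^2}\Big).$$ -/

import Mathlib

open scoped ENNReal
open Filter Topology MeasureTheory ProbabilityTheory

noncomputable section

namespace UnichainCMDP

/-! ### The constrained Markov decision process -/

/-- The index `g` of the two signals: the reward `r` and the constraint cost `c`. -/
inductive Signal
  | reward
  | cost

/-- A finite average-reward constrained MDP `(S, A, r, c, P, ρ)`. -/
structure CMDP (S A : Type) where
  r : S → A → ℝ
  c : S → A → ℝ
  P : S → A → PMF S
  ρ : PMF S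
  r_mem : ∀ s a, r s a ∈ Set.Icc (0 : ℝ) 1
  c_mem : ∀ s a, c s a ∈ Set.Icc (-1 : ℝ) 1

/-- A stationary randomized policy. -/
abbrev Policy (S A : Type) := S → PMF A

/-- A transition `z = (s, a, s')`. -/
abbrev Transition (S A : Type) := S × A × S

/-- `ℝⁿ` with the Euclidean norm. -/
abbrev Vec (n : ℕ) := EuclideanSpace ℝ (Fin n)

variable {S A : Type}

/-- The signal `g : S × A → ℝ`, for `g ∈ {r, c}`. -/
def CMDP.signal (M : CMDP S A) : Signal → S → A → ℝ
  | .reward => M.r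
  | .cost => M.c

/-- The probability `π(a | s)` as a real number. -/
def prob (pol : Policy S A) (s : S) (a : A) : ℝ := (pol s a).toReal

/-- One step of the Markov chain induced by the policy: `P^π(s, ·)`. -/
def CMDP.step (M : CMDP S A) (pol : Policy S A) (s : S) : PMF S :=
  (pol s).bind fun a => M.P s a

/-- The law of `s_t` under the policy when `s_0 ∼ ρ`. -/
def CMDP.stateLaw (M : CMDP S A) (pol : Policy S A) : ℕ → PMF S
  | 0 => M.ρ
  | t + 1 => (M.stateLaw pol t).bind (M.step pol)

/-- The law of the `n` transitions generated by the policy from the state `s`. -/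
def CMDP.rollout (M : CMDP S A) (pol : Policy S A) : ℕ → S → PMF (List (Transition S A))
  | 0, _ => PMF.pure []
  | n + 1, s =>
      (pol s).bind fun a => (M.P s a).bind fun s' =>
        (M.rollout pol n s').bind fun τ => PMF.pure ((s, a, s') :: τ)

/-- The last state of a trajectory that started in `s`. -/
def endState (s : S) (τ : List (Transition S A)) : S :=
  τ.foldl (fun _ z => z.2.2) s

/-- The trajectory `τ` started in `s` visits the set `X` (its initial and last state included). -/
def Visits (X : Set S) (s : S) (τ : List (Transition S A)) : Prop :=
  s ∈ X ∨ ∃ z ∈ τ, z.2.2 ∈ X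

/-! ### Recurrence, stationary distribution, hitting times -/

/-- `s'` is accessible from `s` in the chain induced by the policy. -/
def CMDP.Reach (M : CMDP S A) (pol : Policy S A) : S → S → Prop :=
  Relation.ReflTransGen fun x y => M.step pol x y ≠ 0

/-- The set `S_R` of recurrent states of the (finite) chain induced by the policy. -/
def CMDP.recurrent (M : CMDP S A) (pol : Policy S A) : Set S :=
  {s | ∀ s', M.Reach pol s s' → M.Reach pol s' s}

/-- The induced chain has a single recurrent class. -/
def CMDP.Unichain (M : CMDP S A) (pol : Policy S A) : Prop :=
  ∀ s ∈ M.recurrent pol, ∀ s' ∈ M.recurrent pol, M.Reach pol s s'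

/-- The stationary distribution
`d^π(s) = lim_{T → ∞} (1/T) ∑_{t < T} Pr(s_t = s | s_0 ∼ ρ, π)`. -/
def CMDP.statDist (M : CMDP S A) (pol : Policy S A) (s : S) : ℝ :=
  limUnder atTop fun T : ℕ =>
    (T : ℝ)⁻¹ * ∑ t ∈ Finset.range T, (M.stateLaw pol t s).toReal

/-- `E_s[T_X] = ∑_{t ≥ 0} Pr_s(T_X > t)`, where `T_X = inf {t ≥ 0 : s_t ∈ X}`. -/
def CMDP.meanHit (M : CMDP S A) (pol : Policy S A) (X : Set S) (s : S) : ℝ≥0∞ :=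
  ∑' t : ℕ, (M.rollout pol t s).toOuterMeasure {τ | ¬ Visits X s τ}

/-- `C_hit^θ`: the worst-case expected time to enter the recurrent class. -/
def CMDP.hitTime (M : CMDP S A) (pol : Policy S A) : ℝ≥0∞ :=
  ⨆ s : S, M.meanHit pol (M.recurrent pol) s

variable [Fintype S] [Fintype A]

/-- `C_tar^θ = ∑_{s'} d^π(s') E_s[T_{s'}]` for `s ∈ S_R`. The sum is the same for all recurrent
`s`, so the supremum over recurrent `s` is its common value. -/
def CMDP.targetTime (M : CMDP S A) (pol : Policy S A) : ℝ≥0∞ :=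
  ⨆ s ∈ M.recurrent pol, ∑ s' : S, ENNReal.ofReal (M.statDist pol s') * M.meanHit pol {s'} s

/-- `J_g^π = lim_{T → ∞} (1/T) E^π[∑_{t < T} g(s_t, a_t) | s_0 ∼ ρ]`. -/
def CMDP.avgReward (M : CMDP S A) (pol : Policy S A) (g : Signal) : ℝ :=
  limUnder atTop fun T : ℕ =>
    (T : ℝ)⁻¹ * ∑ t ∈ Finset.range T, ∑ s, ∑ a,
      (M.stateLaw pol t s).toReal * prob pol s a * M.signal g s a

/-- The state value associated with an action-value function: `V(s) = E_{a ∼ π(·|s)} Q(s, a)`. -/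
def stateValue (pol : Policy S A) (Q : S → A → ℝ) (s : S) : ℝ :=
  ∑ a, prob pol s a * Q s a

/-- `Q` solves the average-reward Bellman equation and is normalized by `∑_s d^π(s) V(s) = 0`. -/
def CMDP.IsActionValue (M : CMDP S A) (pol : Policy S A) (g : Signal) (Q : S → A → ℝ) : Prop :=
  (∀ s a, Q s a = M.signal g s a - M.avgReward pol g
      + ∑ s', (M.P s a s').toReal * stateValue pol Q s') ∧
    ∑ s, M.statDist pol s * stateValue pol Q s = 0

/-- The value function `V_g^π`. -/
def CMDP.value (M : CMDP S A) (pol : Policy S A) (g : Signal) : S → ℝ :=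
  stateValue pol (Classical.epsilon (M.IsActionValue pol g))

/-! ### Policy class, Fisher matrix, natural gradient, critic features -/

variable {d : ℕ} {m : Signal → ℕ}

/-- The score `∇_θ log π_θ(a | s)`. -/
def score (π : Vec d → Policy S A) (θ : Vec d) (s : S) (a : A) : Vec d :=
  gradient (fun θ' => Real.log (prob (π θ') s a)) θ

/-- The Fisher matrix `F(θ) = E_{(s,a) ∼ ν^{π_θ}}[∇ log π_θ(a|s) ⊗ ∇ log π_θ(a|s)]`, with
`ν^π(s, a) = d^π(s) π(a|s)`. -/
def CMDP.fisher (M : CMDP S A) (π : Vec d → Policy S A) (θ : Vec d) : Vec d →L[ℝ] Vec d :=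
  ∑ s, ∑ a, (M.statDist (π θ) s * prob (π θ) s a) •
    InnerProductSpace.rankOne ℝ (score π θ s a) (score π θ s a)

/-- The natural policy gradient direction `ω*_{g,θ} = F(θ)⁻¹ ∇_θ J_g(θ)`. -/
def CMDP.npgDirection (M : CMDP S A) (π : Vec d → Policy S A) (g : Signal) (θ : Vec d) : Vec d :=
  (M.fisher π θ).inverse (gradient (fun θ' => M.avgReward (π θ') g) θ)

/-- The critic feature matrix
`M_θ^g = E[φ_g(s) (φ_g(s) - φ_g(s'))ᵀ]`, `s ∼ d^{π_θ}`, `s' ∼ P^{π_θ}(s, ·)`. -/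
def CMDP.criticMatrix (M : CMDP S A) (pol : Policy S A) {n : ℕ} (φ : S → Vec n) :
    Vec n →L[ℝ] Vec n :=
  ∑ s, ∑ s', (M.statDist pol s * (M.step pol s s').toReal) •
    InnerProductSpace.rankOne ℝ (φ s) (φ s - φ s')

/-- `ε_app^g = sup_{θ ∈ Θ} inf_ζ (1/2) E_{s ∼ d^{π_θ}}[(V_g^{π_θ}(s) - ⟨ζ, φ_g(s)⟩)²]`. -/
def CMDP.criticError (M : CMDP S A) (π : Vec d → Policy S A) (Θ : Set (Vec d)) (g : Signal)
    {n : ℕ} (φ : S → Vec n) : ℝ :=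
  ⨆ θ : Θ, ⨅ ζ : Vec n,
    (1 / 2) * ∑ s, M.statDist (π θ) s * (M.value (π θ) g s - inner ℝ ζ (φ s)) ^ 2

/-- `ε_app = max {ε_app^r, ε_app^c}`. -/
def CMDP.epsApp (M : CMDP S A) (π : Vec d → Policy S A) (Θ : Set (Vec d))
    (φ : (g : Signal) → S → Vec (m g)) : ℝ :=
  max (M.criticError π Θ .reward (φ .reward)) (M.criticError π Θ .cost (φ .cost))

/-- `C_hit = sup_θ C_hit^θ`. -/
def CMDP.Chit (M : CMDP S A) (π : Vec d → Policy S A) (Θ : Set (Vec d)) : ℝ≥0∞ :=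
  ⨆ θ ∈ Θ, M.hitTime (π θ)

/-- `C_tar = sup_θ C_tar^θ`. -/
def CMDP.Ctar (M : CMDP S A) (π : Vec d → Policy S A) (Θ : Set (Vec d)) : ℝ≥0∞ :=
  ⨆ θ ∈ Θ, M.targetTime (π θ)

/-! ### Multi-level Monte Carlo -/

/-- The geometric law with parameter `1/2` on `{1, 2, …}`: `Pr(Q = j) = 2^{-j}`. -/
def geomHalf : PMF ℕ :=
  ⟨fun n => if n = 0 then 0 else (2 : ℝ≥0∞)⁻¹ ^ n, by
    have h : ∑' n : ℕ, (if n = 0 then 0 else (2 : ℝ≥0∞)⁻¹ ^ n) = 1 := by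
      rw [tsum_eq_zero_add' ENNReal.summable]
      simp only [↓reduceIte, Nat.add_eq_zero_iff, one_ne_zero, and_false, zero_add]
      simp_rw [pow_succ, ENNReal.tsum_mul_right, ENNReal.tsum_geometric]
      rw [ENNReal.one_sub_inv_two, inv_inv]
      exact ENNReal.mul_inv_cancel (by simp) (by simp)
    exact h ▸ ENNReal.summable.hasSum⟩

/-- The trajectory length `(2^Q - 1) 𝟙{2^Q ≤ T_max} + 1`. -/
def mlmcLength (Tmax Q : ℕ) : ℕ := (if 2 ^ Q ≤ Tmax then 2 ^ Q - 1 else 0) + 1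

/-- The level-`j` average of `f` over the first `2^j` transitions of the trajectory. -/
def levelAvg {E : Type} [AddCommGroup E] [Module ℝ E] (f : Transition S A → E)
    (τ : List (Transition S A)) (j : ℕ) : E :=
  ((2 : ℝ) ^ j)⁻¹ • ((τ.take (2 ^ j)).map f).sum

/-- The multi-level Monte Carlo estimate built from a trajectory and the level `Q ≥ 1`. -/
def mlmc {E : Type} [AddCommGroup E] [Module ℝ E] (Tmax : ℕ) (f : Transition S A → E)
    (Q : ℕ) (τ : List (Transition S A)) : E :=
  levelAvg f τ 0 +
    if 2 ^ Q ≤ Tmax then (2 : ℝ) ^ Q • (levelAvg f τ Q - levelAvg f τ (Q - 1)) else 0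

/-! ### The primal-dual natural actor-critic algorithm with burn-in -/

/-- The inputs of the algorithm (apart from the CMDP, the policy class and the features). -/
structure Params (d : ℕ) where
  θ₀ : Vec d
  α : ℝ
  β : ℝ
  γξ : ℝ
  γω : ℝ
  cγ : ℝ
  δ : ℝ
  K : ℕ
  H : ℕ
  B : ℕ
  Tmax : ℕ

/-- All samples of one epoch: the burn-in trajectory, and for each of the `H` critic and the `H`
NPG iterations the level and the trajectory. -/
structure EpochSample (S A : Type) where
  burnIn : List (Transition S A)
  critic : List (ℕ × List (Transition S A))
  npg : List (ℕ × List (Transition S A))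

/-- The last state after a list of iterations that started in `s`. -/
def blocksEnd (s : S) (bs : List (ℕ × List (Transition S A))) : S :=
  bs.foldl (fun s b => endState s b.2) s

/-- The samples of `H` consecutive inner iterations from the state `s`. -/
def CMDP.blocksLaw (M : CMDP S A) (pol : Policy S A) (Tmax : ℕ) :
    ℕ → S → PMF (List (ℕ × List (Transition S A)))
  | 0, _ => PMF.pure []
  | h + 1, s =>
      geomHalf.bind fun Q => (M.rollout pol (mlmcLength Tmax Q) s).bind fun τ =>
        (M.blocksLaw pol Tmax h (endState s τ)).bind fun bs => PMF.pure ((Q, τ) :: bs)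

/-- The law of the samples of one epoch that starts in the state `s`. -/
def CMDP.epochLaw (M : CMDP S A) (p : Params d) (pol : Policy S A) (s : S) :
    PMF (EpochSample S A) :=
  (M.rollout pol p.B s).bind fun b =>
    (M.blocksLaw pol p.Tmax p.H (endState s b)).bind fun cs =>
      (M.blocksLaw pol p.Tmax p.H (blocksEnd (endState s b) cs)).bind fun ns =>
        PMF.pure ⟨b, cs, ns⟩

/-- The single-sample critic direction `A_g(z) ξ - b_g(z)`, with `ξ = (η, ζ)`. -/
def CMDP.criticDir (M : CMDP S A) (cγ : ℝ) (g : Signal) {n : ℕ} (φ : S → Vec n)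
    (ξ : ℝ × Vec n) (z : Transition S A) : ℝ × Vec n :=
  (cγ * ξ.1 - cγ * M.signal g z.1 z.2.1,
    ξ.1 • φ z.1 + inner ℝ (φ z.1 - φ z.2.2) ξ.2 • φ z.1 - M.signal g z.1 z.2.1 • φ z.1)

/-- The critic estimate `ξ_g^k = (η_g^k, ζ_g^k)` after all critic iterations, from `ξ = 0`. -/
def CMDP.criticEst (M : CMDP S A) (p : Params d) (g : Signal) {n : ℕ} (φ : S → Vec n)
    (e : EpochSample S A) : ℝ × Vec n :=
  e.critic.foldl
    (fun ξ b => ξ - p.γξ • mlmc p.Tmax (M.criticDir p.cγ g φ ξ) b.1 b.2) 0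

/-- The single-sample NPG direction `F̂(θ; z) ω - Â_g(ξ; z) ∇ log π_θ(a|s)`, where
`Â_g(ξ; z) = g(s, a) - η + ⟨ζ, φ_g(s') - φ_g(s)⟩`. -/
def CMDP.npgDir (M : CMDP S A) (π : Vec d → Policy S A) (θ : Vec d) (g : Signal) {n : ℕ}
    (φ : S → Vec n) (ξ : ℝ × Vec n) (ω : Vec d) (z : Transition S A) : Vec d :=
  inner ℝ (score π θ z.1 z.2.1) ω • score π θ z.1 z.2.1
    - (M.signal g z.1 z.2.1 - ξ.1 + inner ℝ ξ.2 (φ z.2.2 - φ z.1)) • score π θ z.1 z.2.1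

/-- The NPG estimate `ω_g^k` after all NPG iterations of an epoch with parameter `θ`,
from `ω = 0`. -/
def CMDP.npgEst (M : CMDP S A) (p : Params d) (π : Vec d → Policy S A) (θ : Vec d) (g : Signal)
    {n : ℕ} (φ : S → Vec n) (e : EpochSample S A) : Vec d :=
  e.npg.foldl
    (fun ω b => ω - p.γω • mlmc p.Tmax (M.npgDir π θ g φ (M.criticEst p g φ e) ω) b.1 b.2) 0

/-- The state of the algorithm at the beginning of an epoch. -/
structure AlgState (S : Type) (d : ℕ) where
  θ : Vec d
  lam : ℝ
  s : S

/-- The state of the algorithm before the first epoch. -/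
def Params.start (p : Params d) (s₀ : S) : AlgState S d := ⟨p.θ₀, 0, s₀⟩

/-- The update of the policy parameter, of the dual variable and of the current state at the end
of an epoch with samples `e`. -/
def CMDP.update (M : CMDP S A) (p : Params d) (π : Vec d → Policy S A)
    (φ : (g : Signal) → S → Vec (m g)) (x : AlgState S d) (e : EpochSample S A) :
    AlgState S d where
  θ := x.θ + p.α • (M.npgEst p π x.θ .reward (φ .reward) e
    + x.lam • M.npgEst p π x.θ .cost (φ .cost) e)
  lam := max 0 (min (2 / p.δ) (x.lam - p.β * (M.criticEst p .cost (φ .cost) e).1))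
  s := blocksEnd (blocksEnd (endState x.s e.burnIn) e.critic) e.npg

/-- The samples of `n` consecutive epochs from the state `x` of the algorithm. -/
def CMDP.epochsLaw (M : CMDP S A) (p : Params d) (π : Vec d → Policy S A)
    (φ : (g : Signal) → S → Vec (m g)) : ℕ → AlgState S d → PMF (List (EpochSample S A))
  | 0, _ => PMF.pure []
  | n + 1, x =>
      (M.epochLaw p (π x.θ) x.s).bind fun e =>
        (M.epochsLaw p π φ n (M.update p π φ x e)).bind fun es => PMF.pure (e :: es)

/-- A run of the algorithm, or its history up to some epoch: the initial state and the samples of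
the epochs so far. -/
structure Run (S A : Type) where
  init : S
  epochs : List (EpochSample S A)

/-- All sets of runs are measurable (the law of a run is discrete). -/
instance : MeasurableSpace (Run S A) := ⊤

/-- The law of a complete run of `K` epochs. -/
def CMDP.runLaw (M : CMDP S A) (p : Params d) (π : Vec d → Policy S A)
    (φ : (g : Signal) → S → Vec (m g)) : PMF (Run S A) :=
  M.ρ.bind fun s₀ => (M.epochsLaw p π φ p.K (p.start s₀)).bind fun es => PMF.pure ⟨s₀, es⟩

/-- The history of a run up to the beginning of epoch `k`. -/
def Run.before (ω : Run S A) (k : ℕ) : Run S A := ⟨ω.init, ω.epochs.take k⟩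

/-- The samples of epoch `k` of a run. -/
def Run.epoch (ω : Run S A) (k : ℕ) : EpochSample S A := ω.epochs.getD k ⟨[], [], []⟩

/-- The state of the algorithm after the epochs recorded in a history. -/
def CMDP.stateAfter (M : CMDP S A) (p : Params d) (π : Vec d → Policy S A)
    (φ : (g : Signal) → S → Vec (m g)) (h : Run S A) : AlgState S d :=
  h.epochs.foldl (M.update p π φ) (p.start h.init)

/-- The event `E_B`: in every epoch `k < K` the burn-in of length `B` under `π_{θ_k}` reaches the
recurrent class of `π_{θ_k}`. -/
def CMDP.burnInEvent (M : CMDP S A) (p : Params d) (π : Vec d → Policy S A)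
    (φ : (g : Signal) → S → Vec (m g)) : Set (Run S A) :=
  {ω | ∀ k < p.K, Visits (M.recurrent (π (M.stateAfter p π φ (ω.before k)).θ))
    (M.stateAfter p π φ (ω.before k)).s (ω.epoch k).burnIn}

/-- The law of the run given `E_B` and given that its history up to epoch `k` is `h`: the
expectation `E_k[· | E_B]`, on the history `h`, is the integral against this measure. -/
def CMDP.condLaw (M : CMDP S A) (p : Params d) (π : Vec d → Policy S A)
    (φ : (g : Signal) → S → Vec (m g)) (k : ℕ) (h : Run S A) : Measure (Run S A) :=
  cond (M.runLaw p π φ).toMeasure (M.burnInEvent p π φ ∩ {ω | ω.before k = h})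

end UnichainCMDP

end

/-!
**The chain after burn-in.** Once the burn-in has visited the recurrent class, the rest of the
epoch stays in it, and the policy is fixed. The epoch is then stochastic approximation for two
linear problems, driven by multi-level estimates along a recurrent trajectory, with the critic's
output entering the second problem as data.

**Ergodic averages.** No mixing rate is assumed, so averages are controlled through the Poisson
equation. Its centred solution is bounded on the recurrent class by the target time, by comparison
with expected hitting times (`CMDP.norm_le_of_poisson`). Telescoping it along the trajectory bounds
the bias of an average over `n` steps by `O(C_tar / n)` and, through the orthogonality of the
martingale increments, the mean square of its error by `O(C_tar² / n)`. The coarse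
and fine averages of a multi-level estimate are combined so that only the finest level counts for
the mean: the bias is `O(C_tar / T_max)` (`norm_pexp_mlmc_sub_le`), whereas the second moment is
`O(C_tar² log T_max)` (`pexp_mlmc_sq_le`).

**Stochastic approximation.** `LinearOracle` collects what is used of a linear problem: an affine
update, a root `x*` of the stationary mean, and coercivity with constant `κ` on the subspace in
which all iterates move. Under the step size condition `StepCond` the mean square error never
exceeds the square of the radius `r` that bounds the initial error and the noise at the root
(`LinearOracle.pexp_sgd_sq`). The error of the mean contracts
by the factor `1 - κγ / 2` in each iteration, up to the multi-level bias
(`LinearOracle.norm_pexp_sgd_le`). With `γ` of order `log T / (κ H)` the contribution of the initial error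
becomes `O(1 / T²)`.

**The critic.** The critic matrix `M_θ` may be singular. Feature differences along recurrent
transitions are orthogonal to its kernel (`CMDP.feature_sub_mem`), so only the component of the
weights in `(ker M_θ)ᗮ` influences the NPG iteration. On that subspace, paired with the average
reward, the mean field is coercive because `c_γ` is large (`CMDP.critLin_coercive`). The Dirichlet
form bounds how far the temporal differences of the root are from those of the value function: the
error is a multiple of `ε_app` that does not involve `λ` (`CMDP.pexp_critRoot_sq_le`), which is why
the last term of the bounds is `G₁² ε_app / μ²`.

**The natural gradient.** For a fixed critic estimate the inner problem has the Fisher matrix as its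
linear part, and its root is affine in the estimate (`CMDP.npgRoot_critAdv_sub`). By the policy
gradient theorem (`CMDP.gradient_avgReward`), which follows from the performance difference identity
and the continuity of the stationary distribution, the root belonging to the exact value function is `ω*`; the root belonging to the limit of the critic
is at distance `O(G₁ √ε_app / μ)` from it (`CMDP.norm_npgRoot_critRoot_sub_le`). Since the root is
affine in the estimate, its mean only sees the bias of the critic. Together these give
`CMDP.EpochCond.npg_sq` and `CMDP.EpochCond.npg_bias`, for an epoch started in a recurrent state.

**Conditioning on all burn-ins.** The event `ℰ_B` also involves the burn-ins after epoch `k`, and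
these depend on what happens in epoch `k`. The conditional expectation is an average over the law
of that one epoch, with the indicator of a successful burn-in times the probability of later
successes as its weight (`CMDP.integral_condLaw`). A burn-in fails with probability at most `2 / T²`
by Markov's inequality over blocks of length `2 C_hit` (`CMDP.noVisit_burnIn`). There are at most
`T - 1` later ones, so the weight is within `O(1 / T)` of the indicator. By `weighted_moments` it
costs a constant factor in the mean square, and in the mean a term of order `1 / T` times the root
mean square, which the `1 / T²` term of the squared bias absorbs.
-/

set_option linter.unusedSectionVars false

noncomputable section

namespace UnichainCMDP

/-! ### Expectations under probability mass functions -/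

section Expectation

variable {α β E E' : Type*} [NormedAddCommGroup E] [NormedSpace ℝ E]
  [NormedAddCommGroup E'] [NormedSpace ℝ E']

/-- The expectation of `f` under the discrete law `p`. It is meaningful when `f` is bounded on the
support of `p`; the value is `0` if the series does not converge. -/
def pexp (p : PMF α) (f : α → E) : E := ∑' a, (p a).toReal • f a

/-- `f` is bounded on the support of `p`. -/
def PBdd (p : PMF α) (f : α → E) : Prop := ∃ C : ℝ, ∀ a ∈ p.support, ‖f a‖ ≤ C

theorem summable_toReal_pmf (p : PMF α) : Summable fun a => (p a).toReal :=
  ENNReal.summable_toReal (by rw [p.tsum_coe]; exact ENNReal.one_ne_top)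

theorem tsum_toReal_pmf (p : PMF α) : ∑' a, (p a).toReal = 1 := by
  rw [← ENNReal.tsum_toReal_eq (fun a => p.apply_ne_top a), p.tsum_coe, ENNReal.toReal_one]

theorem PBdd.exists_nonneg {p : PMF α} {f : α → E} (h : PBdd p f) :
    ∃ C : ℝ, 0 ≤ C ∧ ∀ a ∈ p.support, ‖f a‖ ≤ C := by
  obtain ⟨C, hC⟩ := h
  exact ⟨max C 0, le_max_right _ _, fun a ha => (hC a ha).trans (le_max_left _ _)⟩

theorem PBdd.of_finite [Finite α] (p : PMF α) (f : α → E) : PBdd p f := by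
  obtain ⟨C, hC⟩ := (Set.finite_range fun a => ‖f a‖).bddAbove
  exact ⟨C, fun a _ => hC ⟨a, rfl⟩⟩

theorem PBdd.of_finite_support {p : PMF α} (hp : p.support.Finite) (f : α → E) : PBdd p f := by
  obtain ⟨C, hC⟩ := (hp.image fun a => ‖f a‖).bddAbove
  exact ⟨C, fun a ha => hC ⟨a, ha, rfl⟩⟩

theorem PBdd.const (p : PMF α) (c : E) : PBdd p fun _ => c := ⟨‖c‖, fun _ _ => le_rfl⟩

theorem PBdd.norm {p : PMF α} {f : α → E} (h : PBdd p f) : PBdd p fun a => ‖f a‖ := by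
  obtain ⟨C, hC⟩ := h
  exact ⟨C, fun a ha => by simpa using hC a ha⟩

theorem PBdd.add {p : PMF α} {f g : α → E} (hf : PBdd p f) (hg : PBdd p g) :
    PBdd p fun a => f a + g a := by
  obtain ⟨C, hC⟩ := hf
  obtain ⟨D, hD⟩ := hg
  exact ⟨C + D, fun a ha => (norm_add_le _ _).trans (add_le_add (hC a ha) (hD a ha))⟩

theorem PBdd.sub {p : PMF α} {f g : α → E} (hf : PBdd p f) (hg : PBdd p g) :
    PBdd p fun a => f a - g a := by
  obtain ⟨C, hC⟩ := hf
  obtain ⟨D, hD⟩ := hg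
  exact ⟨C + D, fun a ha => (norm_sub_le _ _).trans (add_le_add (hC a ha) (hD a ha))⟩

theorem PBdd.smul {p : PMF α} {f : α → E} {k : α → ℝ} (hk : PBdd p k) (hf : PBdd p f) :
    PBdd p fun a => k a • f a := by
  obtain ⟨C, hC0, hC⟩ := hk.exists_nonneg
  obtain ⟨D, hD⟩ := hf
  exact ⟨C * D, fun a ha => by
    rw [norm_smul]; exact mul_le_mul (hC a ha) (hD a ha) (norm_nonneg _) hC0⟩

theorem PBdd.mul {p : PMF α} {f g : α → ℝ} (hf : PBdd p f) (hg : PBdd p g) :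
    PBdd p fun a => f a * g a := hf.smul hg

theorem PBdd.const_smul {p : PMF α} {f : α → E} (c : ℝ) (hf : PBdd p f) :
    PBdd p fun a => c • f a := (PBdd.const p c).smul hf

theorem PBdd.const_mul {p : PMF α} {f : α → ℝ} (c : ℝ) (hf : PBdd p f) :
    PBdd p fun a => c * f a := (PBdd.const p c).smul hf

theorem PBdd.normSq {p : PMF α} {f : α → E} (hf : PBdd p f) : PBdd p fun a => ‖f a‖ ^ 2 := by
  simpa [sq] using hf.norm.mul hf.norm

theorem PBdd.clm {p : PMF α} {f : α → E} (hf : PBdd p f) (L : E →L[ℝ] E') :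
    PBdd p fun a => L (f a) := by
  obtain ⟨C, hC⟩ := hf
  exact ⟨‖L‖ * C, fun a ha =>
    (L.le_opNorm _).trans (mul_le_mul_of_nonneg_left (hC a ha) (norm_nonneg _))⟩

theorem PBdd.mono {p : PMF α} {f : α → E} {g : α → E'} (hf : PBdd p f)
    (h : ∀ a ∈ p.support, ‖g a‖ ≤ ‖f a‖) : PBdd p g := by
  obtain ⟨C, hC⟩ := hf
  exact ⟨C, fun a ha => (h a ha).trans (hC a ha)⟩

theorem PBdd.bind_right {p : PMF α} {q : α → PMF β} {f : β → E} (h : PBdd (p.bind q) f) {a : α}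
    (ha : a ∈ p.support) : PBdd (q a) f := by
  obtain ⟨C, hC⟩ := h
  exact ⟨C, fun b hb => hC b ((PMF.mem_support_bind_iff _ _ _).2 ⟨a, ha, hb⟩)⟩

theorem pexp_summable [CompleteSpace E] {p : PMF α} {f : α → E} (h : PBdd p f) :
    Summable fun a => (p a).toReal • f a := by
  obtain ⟨C, hC⟩ := h
  refine Summable.of_norm_bounded (g := fun a => (p a).toReal * C)
    ((summable_toReal_pmf p).mul_right C) fun a => ?_
  rw [norm_smul, Real.norm_of_nonneg ENNReal.toReal_nonneg]
  by_cases ha : p a = 0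
  · simp [ha]
  · exact mul_le_mul_of_nonneg_left (hC a ((PMF.mem_support_iff _ _).2 ha)) ENNReal.toReal_nonneg

theorem pexp_congr {p : PMF α} {f g : α → E} (h : ∀ a ∈ p.support, f a = g a) :
    pexp p f = pexp p g := by
  refine tsum_congr fun a => ?_
  by_cases ha : p a = 0
  · simp [ha]
  · rw [h a ((PMF.mem_support_iff _ _).2 ha)]

theorem pexp_const (p : PMF α) (c : E) : pexp p (fun _ => c) = c := by
  unfold pexp
  rw [(summable_toReal_pmf p).tsum_smul_const, tsum_toReal_pmf, one_smul]

theorem pexp_fintype [Fintype α] (p : PMF α) (f : α → E) :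
    pexp p f = ∑ a, (p a).toReal • f a := tsum_fintype _

theorem pexp_pure (a : α) (f : α → E) : pexp (PMF.pure a) f = f a := by
  have : pexp (PMF.pure a) f = pexp (PMF.pure a) fun _ => f a :=
    pexp_congr fun b hb => by rw [(PMF.mem_support_pure_iff _ _).1 hb]
  rw [this, pexp_const]

theorem pexp_smul (p : PMF α) (c : ℝ) (f : α → E) :
    pexp p (fun a => c • f a) = c • pexp p f := by
  unfold pexp
  rw [← tsum_const_smul'']
  exact tsum_congr fun a => smul_comm _ _ _

theorem pexp_mul_left (p : PMF α) (c : ℝ) (f : α → ℝ) :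
    pexp p (fun a => c * f a) = c * pexp p f := pexp_smul p c f

variable [CompleteSpace E] [CompleteSpace E']

theorem pexp_add {p : PMF α} {f g : α → E} (hf : PBdd p f) (hg : PBdd p g) :
    pexp p (fun a => f a + g a) = pexp p f + pexp p g := by
  unfold pexp
  rw [← (pexp_summable hf).tsum_add (pexp_summable hg)]
  exact tsum_congr fun a => smul_add _ _ _

theorem pexp_sub {p : PMF α} {f g : α → E} (hf : PBdd p f) (hg : PBdd p g) :
    pexp p (fun a => f a - g a) = pexp p f - pexp p g := by
  unfold pexp
  rw [← (pexp_summable hf).tsum_sub (pexp_summable hg)]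
  exact tsum_congr fun a => smul_sub _ _ _

theorem pexp_clm {p : PMF α} {f : α → E} (hf : PBdd p f) (L : E →L[ℝ] E') :
    pexp p (fun a => L (f a)) = L (pexp p f) := by
  unfold pexp
  rw [L.map_tsum (pexp_summable hf)]
  exact tsum_congr fun a => (L.map_smul _ _).symm

theorem pexp_mono {p : PMF α} {f g : α → ℝ} (hf : PBdd p f) (hg : PBdd p g)
    (h : ∀ a ∈ p.support, f a ≤ g a) : pexp p f ≤ pexp p g := by
  refine (pexp_summable hf).tsum_le_tsum (fun a => ?_) (pexp_summable hg)
  by_cases ha : p a = 0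
  · simp [ha]
  · exact mul_le_mul_of_nonneg_left (h a ((PMF.mem_support_iff _ _).2 ha)) ENNReal.toReal_nonneg

theorem pexp_le {p : PMF α} {f : α → ℝ} {c : ℝ} (hf : PBdd p f) (h : ∀ a ∈ p.support, f a ≤ c) :
    pexp p f ≤ c := by
  simpa [pexp_const] using pexp_mono hf (PBdd.const p c) h

theorem pexp_nonneg {p : PMF α} {f : α → ℝ} (h : ∀ a ∈ p.support, 0 ≤ f a) : 0 ≤ pexp p f := by
  refine tsum_nonneg fun a => ?_
  by_cases ha : p a = 0
  · simp [ha]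
  · exact mul_nonneg ENNReal.toReal_nonneg (h a ((PMF.mem_support_iff _ _).2 ha))

theorem norm_pexp_le {p : PMF α} {f : α → E} (hf : PBdd p f) :
    ‖pexp p f‖ ≤ pexp p fun a => ‖f a‖ := by
  have h := pexp_summable hf.norm
  have e : ∀ a, ‖(p a).toReal • f a‖ = (p a).toReal • ‖f a‖ := fun a => by
    rw [norm_smul, Real.norm_of_nonneg ENNReal.toReal_nonneg, smul_eq_mul]
  refine (norm_tsum_le_tsum_norm ?_).trans_eq (tsum_congr e)
  simpa only [e] using h

theorem norm_pexp_le_of_le {p : PMF α} {f : α → E} {c : ℝ} (h : ∀ a ∈ p.support, ‖f a‖ ≤ c) :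
    ‖pexp p f‖ ≤ c :=
  (norm_pexp_le ⟨c, h⟩).trans (pexp_le (PBdd.norm ⟨c, h⟩) h)

theorem norm_pexp_le_pexp {p : PMF α} {f : α → E} {g : α → ℝ} (hg : PBdd p g)
    (h : ∀ a ∈ p.support, ‖f a‖ ≤ g a) : ‖pexp p f‖ ≤ pexp p g := by
  have hf : PBdd p f := hg.mono fun a ha => (h a ha).trans (le_abs_self _)
  exact (norm_pexp_le hf).trans (pexp_mono hf.norm hg h)

/-- The Cauchy–Schwarz inequality. -/
theorem pexp_mul_sq_le {p : PMF α} {f g : α → ℝ} (hf : PBdd p f) (hg : PBdd p g) :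
    pexp p (fun a => f a * g a) ^ 2 ≤ pexp p (fun a => f a ^ 2) * pexp p fun a => g a ^ 2 := by
  have h2 : ∀ {f : α → ℝ}, PBdd p f → PBdd p fun a => f a ^ 2 := fun h => by
    simpa [sq] using h.mul h
  -- the quadratic `t ↦ E (t f + g)²` is nonnegative, so its discriminant is not positive
  have key : ∀ t : ℝ, 0 ≤ pexp p (fun a => f a ^ 2) * (t * t)
      + (2 * pexp p fun a => f a * g a) * t + pexp p fun a => g a ^ 2 := fun t => by
    have h : 0 ≤ pexp p fun a => (t * f a + g a) ^ 2 := pexp_nonneg fun a _ => sq_nonneg _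
    have e : (fun a => (t * f a + g a) ^ 2)
        = fun a => (t * t) * f a ^ 2 + (2 * t) * (f a * g a) + g a ^ 2 := by
      funext a; ring
    rw [e, pexp_add (((h2 hf).const_mul _).add ((hf.mul hg).const_mul _)) (h2 hg),
      pexp_add ((h2 hf).const_mul _) ((hf.mul hg).const_mul _), pexp_mul_left, pexp_mul_left] at h
    linarith
  have := discrim_le_zero key
  unfold discrim at this
  nlinarith

theorem pexp_sq_le {p : PMF α} {f : α → ℝ} (hf : PBdd p f) :
    pexp p f ^ 2 ≤ pexp p fun a => f a ^ 2 := by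
  simpa [pexp_const] using pexp_mul_sq_le hf (PBdd.const p (1 : ℝ))

theorem pexp_bind {p : PMF α} {q : α → PMF β} {f : β → E} (hf : PBdd (p.bind q) f) :
    pexp (p.bind q) f = pexp p fun a => pexp (q a) f := by
  obtain ⟨C, hC0, hC⟩ := hf.exists_nonneg
  have hs : Summable (Function.uncurry fun a b => (p a * q a b).toReal • f b) := by
    have h1 : Summable fun x : α × β => (p x.1 * q x.1 x.2).toReal := by
      refine ENNReal.summable_toReal ?_
      rw [ENNReal.tsum_prod (f := fun a b => p a * q a b)]
      simp_rw [ENNReal.tsum_mul_left, PMF.tsum_coe, mul_one, PMF.tsum_coe]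
      exact ENNReal.one_ne_top
    refine Summable.of_norm_bounded (h1.mul_right C) fun x => ?_
    rw [Function.uncurry, norm_smul, Real.norm_of_nonneg ENNReal.toReal_nonneg]
    by_cases hx : p x.1 * q x.1 x.2 = 0
    · simp [hx]
    · refine mul_le_mul_of_nonneg_left (hC _ ?_) ENNReal.toReal_nonneg
      exact (PMF.mem_support_bind_iff _ _ _).2
        ⟨x.1, left_ne_zero_of_mul hx, right_ne_zero_of_mul hx⟩
  calc pexp (p.bind q) f = ∑' b, ∑' a, (p a * q a b).toReal • f b := by
        refine tsum_congr fun b => ?_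
        rw [PMF.bind_apply, ENNReal.tsum_toReal_eq
          (fun a => ENNReal.mul_ne_top (p.apply_ne_top a) ((q a).apply_ne_top b))]
        refine (Summable.tsum_smul_const ?_ _).symm
        refine ENNReal.summable_toReal ?_
        rw [← PMF.bind_apply]
        exact PMF.apply_ne_top _ _
    _ = ∑' a, ∑' b, (p a * q a b).toReal • f b := hs.tsum_comm
    _ = pexp p fun a => pexp (q a) f := by
        refine tsum_congr fun a => ?_
        unfold pexp
        rw [← tsum_const_smul'']
        refine tsum_congr fun b => ?_
        rw [ENNReal.toReal_mul, mul_smul]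

theorem pexp_bind_pure (p : PMF α) (φ : α → β) {f : β → E} (hf : PBdd p fun a => f (φ a)) :
    pexp (p.bind fun a => PMF.pure (φ a)) f = pexp p fun a => f (φ a) := by
  rw [pexp_bind]
  · simp_rw [pexp_pure]
  · obtain ⟨C, hC⟩ := hf
    refine ⟨C, fun b hb => ?_⟩
    obtain ⟨a, ha, hb⟩ := (PMF.mem_support_bind_iff _ _ _).1 hb
    rw [(PMF.mem_support_pure_iff _ _).1 hb]
    exact hC a ha

end Expectation

/-! ### The induced Markov chain -/

section Chain

variable {S A : Type}

/-- The law of the transition `z = (s, a, s')` generated from the state `s`. -/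
def CMDP.transLaw (M : CMDP S A) (pol : Policy S A) (s : S) : PMF (Transition S A) :=
  (pol s).bind fun a => (M.P s a).bind fun s' => PMF.pure (s, a, s')

theorem CMDP.rollout_succ (M : CMDP S A) (pol : Policy S A) (n : ℕ) (s : S) :
    M.rollout pol (n + 1) s = (M.transLaw pol s).bind fun z =>
      (M.rollout pol n z.2.2).bind fun τ => PMF.pure (z :: τ) := by
  simp [CMDP.rollout, CMDP.transLaw, PMF.bind_bind, PMF.pure_bind]

theorem CMDP.step_eq_transLaw (M : CMDP S A) (pol : Policy S A) (s : S) :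
    M.step pol s = (M.transLaw pol s).bind fun z => PMF.pure z.2.2 := by
  simp [CMDP.step, CMDP.transLaw, PMF.bind_bind, PMF.pure_bind, PMF.bind_pure]

theorem CMDP.fst_of_mem_transLaw {M : CMDP S A} {pol : Policy S A} {s : S} {z : Transition S A}
    (hz : z ∈ (M.transLaw pol s).support) : z.1 = s := by
  simp only [CMDP.transLaw, PMF.mem_support_bind_iff, PMF.mem_support_pure_iff] at hz
  obtain ⟨a, _, s', _, rfl⟩ := hz
  rfl

theorem CMDP.step_of_mem_transLaw {M : CMDP S A} {pol : Policy S A} {s : S} {z : Transition S A}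
    (hz : z ∈ (M.transLaw pol s).support) : M.step pol s z.2.2 ≠ 0 := by
  rw [CMDP.step_eq_transLaw, ← PMF.mem_support_iff, PMF.mem_support_bind_iff]
  exact ⟨z, hz, by simp⟩

theorem CMDP.recurrent_of_reach {M : CMDP S A} {pol : Policy S A} {s s' : S}
    (hs : s ∈ M.recurrent pol) (h : M.Reach pol s s') : s' ∈ M.recurrent pol :=
  fun _ ht => (hs _ (h.trans ht)).trans h

theorem CMDP.recurrent_step {M : CMDP S A} {pol : Policy S A} {s s' : S}
    (hs : s ∈ M.recurrent pol) (h : M.step pol s s' ≠ 0) : s' ∈ M.recurrent pol :=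
  CMDP.recurrent_of_reach hs (Relation.ReflTransGen.single h)

variable [Fintype S] [Fintype A]

theorem CMDP.exists_recurrent_reach (M : CMDP S A) (pol : Policy S A) (s : S) :
    ∃ t ∈ M.recurrent pol, M.Reach pol s t := by
  -- a state reachable from `s` whose set of reachable states is smallest
  obtain ⟨t, hst, hmin⟩ := Set.exists_min_image {t | M.Reach pol s t}
    (fun t => {u | M.Reach pol t u}.ncard) (Set.toFinite _) ⟨s, Relation.ReflTransGen.refl⟩
  refine ⟨t, fun u hu => ?_, hst⟩
  have hsub : {w | M.Reach pol u w} ⊆ {w | M.Reach pol t w} := fun w hw => hu.trans hw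
  have heq := Set.eq_of_subset_of_ncard_le hsub (hmin u (hst.trans hu)) (Set.toFinite _)
  have : t ∈ {w | M.Reach pol t w} := Relation.ReflTransGen.refl
  rw [← heq] at this
  exact this

/-- The transition probability `P^π(s, s')` as a real number. -/
def CMDP.stepR (M : CMDP S A) (pol : Policy S A) (s s' : S) : ℝ := (M.step pol s s').toReal

theorem CMDP.stepR_nonneg (M : CMDP S A) (pol : Policy S A) (s s' : S) :
    0 ≤ M.stepR pol s s' := ENNReal.toReal_nonneg

theorem sum_toReal_pmf (p : PMF S) : ∑ s, (p s).toReal = 1 := by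
  have h := tsum_toReal_pmf p
  rwa [tsum_fintype] at h

theorem CMDP.sum_stepR (M : CMDP S A) (pol : Policy S A) (s : S) :
    ∑ s', M.stepR pol s s' = 1 := sum_toReal_pmf _

theorem CMDP.stepR_ne_zero {M : CMDP S A} {pol : Policy S A} {s s' : S} :
    M.stepR pol s s' ≠ 0 ↔ M.step pol s s' ≠ 0 := by
  unfold CMDP.stepR
  rw [Ne, ENNReal.toReal_eq_zero_iff]
  simp [PMF.apply_ne_top]

theorem CMDP.pexp_transLaw_snd {E : Type*} [NormedAddCommGroup E] [NormedSpace ℝ E]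
    [CompleteSpace E] (M : CMDP S A) (pol : Policy S A) (s : S) (h : S → E) :
    pexp (M.transLaw pol s) (fun z => h z.2.2) = ∑ s', M.stepR pol s s' • h s' := by
  rw [← pexp_bind_pure _ (fun z : Transition S A => z.2.2) (PBdd.of_finite _ _),
    ← CMDP.step_eq_transLaw, pexp_fintype]
  rfl

theorem CMDP.pexp_transLaw {E : Type*} [NormedAddCommGroup E] [NormedSpace ℝ E]
    [CompleteSpace E] (M : CMDP S A) (pol : Policy S A) (s : S) (f : Transition S A → E) :
    pexp (M.transLaw pol s) f
      = ∑ a, prob pol s a • ∑ s', (M.P s a s').toReal • f (s, a, s') := by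
  unfold CMDP.transLaw
  rw [pexp_bind (PBdd.of_finite _ _), pexp_fintype]
  refine Finset.sum_congr rfl fun a _ => ?_
  rw [pexp_bind_pure _ _ (PBdd.of_finite _ _), pexp_fintype]
  rfl

/-- A function that is harmonic for a unichain policy is constant. -/
theorem CMDP.harmonic_const {M : CMDP S A} {pol : Policy S A} (hU : M.Unichain pol) {f : S → ℝ}
    (hf : ∀ s, ∑ s', M.stepR pol s s' * f s' = f s) (s t : S) : f s = f t := by
  -- the set of maximizers of a harmonic function is closed under transitions
  have key : ∀ f : S → ℝ, (∀ s, ∑ s', M.stepR pol s s' * f s' = f s) →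
      ∀ s t, (∀ u, f u ≤ f s) → M.Reach pol s t → f t = f s := by
    intro f hf s t hmax hst
    induction hst with
    | refl => rfl
    | @tail b c _ hbc ih =>
      by_contra hne
      have hlt : f c < f s := lt_of_le_of_ne (hmax c) hne
      have h1 : ∑ s', M.stepR pol b s' * f s' < ∑ s', M.stepR pol b s' * f s :=
        Finset.sum_lt_sum
          (fun u _ => mul_le_mul_of_nonneg_left (hmax u) (M.stepR_nonneg pol b u))
          ⟨c, Finset.mem_univ _, mul_lt_mul_of_pos_left hlt
            (lt_of_le_of_ne (M.stepR_nonneg pol b c) (CMDP.stepR_ne_zero.2 hbc).symm)⟩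
      rw [hf b, ← Finset.sum_mul, M.sum_stepR, one_mul, ih] at h1
      exact lt_irrefl _ h1
  have : Nonempty S := ⟨s⟩
  obtain ⟨x, hx⟩ := Finite.exists_max f
  obtain ⟨y, hy⟩ := Finite.exists_min f
  obtain ⟨x', hx'R, hx'⟩ := M.exists_recurrent_reach pol x
  obtain ⟨y', hy'R, hy'⟩ := M.exists_recurrent_reach pol y
  have h1 : f x' = f x := key f hf x x' hx hx'
  have h2 : f y' = f y := by
    have := key (fun s => - f s) (fun s => by simp [hf s]) y y'
      (fun u => neg_le_neg (hy u)) hy'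
    simpa using this
  have h3 : f y' = f x' := key f hf x' y' (fun u => h1 ▸ hx u) (hU _ hx'R _ hy'R)
  have e : f x = f y := by rw [← h1, ← h3, h2]
  have a1 := hx s; have a2 := hy s; have a3 := hx t; have a4 := hy t
  linarith

/-- `v` is a stationary probability vector of the induced chain. -/
structure CMDP.IsStationary (M : CMDP S A) (pol : Policy S A) (v : S → ℝ) : Prop where
  nonneg : ∀ s, 0 ≤ v s
  sum_eq : ∑ s, v s = 1
  eq : ∀ s', ∑ s, v s * M.stepR pol s s' = v s'

theorem CMDP.exists_stationary (M : CMDP S A) (pol : Policy S A) :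
    ∃ v, M.IsStationary pol v := by
  classical
  obtain ⟨s₀, _⟩ := M.ρ.support_nonempty
  let Pm : Matrix S S ℝ := Matrix.of (M.stepR pol)
  have hdet : (1 - Pm).det = 0 := by
    rw [← Matrix.exists_mulVec_eq_zero_iff]
    refine ⟨fun _ => 1, fun h => one_ne_zero (congrFun h s₀), ?_⟩
    ext s
    rw [Matrix.sub_mulVec, Matrix.one_mulVec]
    simp [Matrix.mulVec, dotProduct, Pm, M.sum_stepR]
  obtain ⟨v, hv0, hv⟩ := Matrix.exists_vecMul_eq_zero_iff.2 hdet
  have hv' : ∀ s', ∑ s, v s * M.stepR pol s s' = v s' := fun s' => by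
    have := congrFun hv s'
    simp only [Matrix.vecMul_sub, Matrix.vecMul_one, Pi.sub_apply, Pi.zero_apply] at this
    have h2 : Matrix.vecMul v Pm s' = ∑ s, v s * M.stepR pol s s' := rfl
    rw [← h2]; linarith
  -- the total variation of an invariant signed measure is invariant
  have hle : ∀ s', |v s'| ≤ ∑ s, |v s| * M.stepR pol s s' := fun s' => by
    conv_lhs => rw [← hv' s']
    refine (Finset.abs_sum_le_sum_abs _ _).trans_eq (Finset.sum_congr rfl fun s _ => ?_)
    rw [abs_mul, abs_of_nonneg (M.stepR_nonneg pol s s')]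
  have hsum : ∑ s', |v s'| = ∑ s', ∑ s, |v s| * M.stepR pol s s' := by
    rw [Finset.sum_comm]
    refine Finset.sum_congr rfl fun s _ => ?_
    rw [← Finset.mul_sum, M.sum_stepR, mul_one]
  have heq := (Finset.sum_eq_sum_iff_of_le fun s' _ => hle s').1 hsum
  have hpos : 0 < ∑ s, |v s| := by
    obtain ⟨s, hs⟩ := Function.ne_iff.1 hv0
    exact Finset.sum_pos' (fun s _ => abs_nonneg _) ⟨s, Finset.mem_univ _, abs_pos.2 hs⟩
  refine ⟨fun s => |v s| / ∑ s, |v s|, fun s => div_nonneg (abs_nonneg _) hpos.le, ?_, ?_⟩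
  · rw [← Finset.sum_div, div_self hpos.ne']
  · intro s'
    rw [heq s' (Finset.mem_univ _), Finset.sum_div]
    exact Finset.sum_congr rfl fun s _ => by ring

open Classical in
/-- The fundamental matrix of a unichain policy. It measures how far an approximately invariant
vector is from the stationary one, and it solves the Poisson equation. -/
theorem CMDP.exists_fundamental {M : CMDP S A} {pol : Policy S A} (hU : M.Unichain pol)
    {v : S → ℝ} (hv : M.IsStationary pol v) :
    ∃ G : Matrix S S ℝ,
      (∀ a : S → ℝ, ∑ s, a s = 1 → ∀ t,
        a t - v t = ∑ s', (a s' - ∑ s, a s * M.stepR pol s s') * G s' t) ∧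
      (∀ t, ∑ s, v s * G s t = v t) ∧
      (∀ s t, G s t - ∑ s', M.stepR pol s s' * G s' t = (if s = t then 1 else 0) - v t) := by
  classical
  let Pm : Matrix S S ℝ := Matrix.of (M.stepR pol)
  let N : Matrix S S ℝ := 1 - Pm + Matrix.of fun _ s => v s
  have hvN : Matrix.vecMul v N = v := by
    ext t
    have h1 : Matrix.vecMul v Pm t = v t := hv.eq t
    have h2 : Matrix.vecMul v (Matrix.of fun _ s => v s) t = v t := by
      simp [Matrix.vecMul, dotProduct, ← Finset.sum_mul, hv.sum_eq]
    simp [N, Matrix.vecMul_add, Matrix.vecMul_sub, h1, h2]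
  have hdet : N.det ≠ 0 := by
    intro h0
    obtain ⟨f, hf0, hf⟩ := Matrix.exists_mulVec_eq_zero_iff.2 h0
    have e0 : ∑ s, v s * f s = 0 := by
      have : v ⬝ᵥ (N.mulVec f) = 0 := by rw [hf]; simp
      rw [Matrix.dotProduct_mulVec, hvN] at this
      exact this
    have e1 : ∀ s, ∑ s', M.stepR pol s s' * f s' = f s := fun s => by
      have := congrFun hf s
      have h2 : (Matrix.of fun (_ : S) s => v s).mulVec f s = 0 := by
        simpa [Matrix.mulVec, dotProduct] using e0
      have h3 : Pm.mulVec f s = ∑ s', M.stepR pol s s' * f s' := rfl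
      simp only [N, Matrix.add_mulVec, Matrix.sub_mulVec, Matrix.one_mulVec, Pi.add_apply,
        Pi.sub_apply, Pi.zero_apply, h2, h3] at this
      linarith
    apply hf0
    ext s
    have : ∑ t, v t * f t = f s := by
      rw [Finset.sum_congr rfl fun t _ => by rw [CMDP.harmonic_const hU e1 t s],
        ← Finset.sum_mul, hv.sum_eq, one_mul]
    rw [← this, e0]; rfl
  have hunit : IsUnit N.det := isUnit_iff_ne_zero.2 hdet
  have hvG : Matrix.vecMul v N⁻¹ = v := by
    conv_lhs => rw [← hvN]
    rw [Matrix.vecMul_vecMul, Matrix.mul_nonsing_inv _ hunit, Matrix.vecMul_one]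
  let G : Matrix S S ℝ := N⁻¹
  refine ⟨G, fun a ha t => ?_, fun t => congrFun hvG t, fun s t => ?_⟩
  · have haN : Matrix.vecMul a N = (fun s' => a s' - ∑ s, a s * M.stepR pol s s') + v := by
      ext t
      have h1 : Matrix.vecMul a Pm t = ∑ s, a s * M.stepR pol s t := rfl
      have h2 : Matrix.vecMul a (Matrix.of fun _ s => v s) t = v t := by
        simp [Matrix.vecMul, dotProduct, ← Finset.sum_mul, ha]
      simp [N, Matrix.vecMul_add, Matrix.vecMul_sub, h1, h2]
    have h : a = Matrix.vecMul (fun s' => a s' - ∑ s, a s * M.stepR pol s s') N⁻¹ + v := by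
      conv_rhs => rw [← hvG]
      rw [← Matrix.add_vecMul, ← haN, Matrix.vecMul_vecMul, Matrix.mul_nonsing_inv _ hunit,
        Matrix.vecMul_one]
    have := congrFun h t
    simp only [Pi.add_apply] at this
    rw [this, add_sub_cancel_right]
    rfl
  · change N⁻¹ s t - ∑ s', M.stepR pol s s' * N⁻¹ s' t = _
    have h := congrFun (congrFun (Matrix.mul_nonsing_inv _ hunit) s) t
    have h1 : (Pm * N⁻¹) s t = ∑ s', M.stepR pol s s' * N⁻¹ s' t := by
      simp [Matrix.mul_apply, Pm]
    have h2 : ((Matrix.of fun (_ : S) s => v s) * N⁻¹) s t = v t := by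
      rw [Matrix.mul_apply]; exact congrFun hvG t
    have h3 : (N * N⁻¹) s t = N⁻¹ s t - (Pm * N⁻¹) s t
        + ((Matrix.of fun (_ : S) s => v s) * N⁻¹) s t := by
      conv_lhs => unfold N
      rw [Matrix.add_mul, Matrix.sub_mul, Matrix.one_mul, Matrix.add_apply, Matrix.sub_apply]
    rw [h3, h1, h2, Matrix.one_apply] at h
    linarith

theorem CMDP.stateLaw_succ_toReal (M : CMDP S A) (pol : Policy S A) (t : ℕ) (s' : S) :
    (M.stateLaw pol (t + 1) s').toReal
      = ∑ s, (M.stateLaw pol t s).toReal * M.stepR pol s s' := by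
  rw [CMDP.stateLaw, PMF.bind_apply, tsum_fintype, ENNReal.toReal_sum
    (fun s _ => ENNReal.mul_ne_top (PMF.apply_ne_top _ _) (PMF.apply_ne_top _ _))]
  exact Finset.sum_congr rfl fun s _ => ENNReal.toReal_mul

/-- The time averages of the state law converge to the stationary vector, also for a periodic
chain. -/
theorem CMDP.tendsto_cesaro {M : CMDP S A} {pol : Policy S A} (hU : M.Unichain pol)
    {v : S → ℝ} (hv : M.IsStationary pol v) (s : S) :
    Tendsto (fun T : ℕ => (T : ℝ)⁻¹ * ∑ t ∈ Finset.range T, (M.stateLaw pol t s).toReal)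
      atTop (𝓝 (v s)) := by
  obtain ⟨G, hG, -, -⟩ := CMDP.exists_fundamental hU hv
  set a : ℕ → S → ℝ := fun T s =>
    (T : ℝ)⁻¹ * ∑ t ∈ Finset.range T, (M.stateLaw pol t s).toReal with ha
  have hsum : ∀ T : ℕ, 0 < T → ∑ s, a T s = 1 := fun T hT => by
    simp only [ha]
    rw [← Finset.mul_sum, Finset.sum_comm]
    simp only [sum_toReal_pmf]
    have : (T : ℝ) ≠ 0 := by positivity
    simp [this]
  -- the defect of invariance telescopes
  have hdef : ∀ (T : ℕ) s', a T s' - ∑ s, a T s * M.stepR pol s s'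
      = (T : ℝ)⁻¹ * ((M.stateLaw pol 0 s').toReal - (M.stateLaw pol T s').toReal) := by
    intro T s'
    have e : ∑ s, a T s * M.stepR pol s s'
        = (T : ℝ)⁻¹ * ∑ t ∈ Finset.range T, (M.stateLaw pol (t + 1) s').toReal := by
      simp only [ha, CMDP.stateLaw_succ_toReal, mul_assoc, Finset.sum_mul, Finset.mul_sum]
      rw [Finset.sum_comm]
    rw [e, ← mul_sub, ← Finset.sum_sub_distrib, Finset.sum_range_sub']
  have hlim : ∀ s', Tendsto (fun T : ℕ => a T s' - ∑ s, a T s * M.stepR pol s s') atTop (𝓝 0) := by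
    intro s'
    refine squeeze_zero_norm (a := fun T : ℕ => (T : ℝ)⁻¹) (fun T => ?_)
      tendsto_inv_atTop_nhds_zero_nat
    rw [hdef, norm_mul, norm_inv, Real.norm_natCast]
    refine mul_le_of_le_one_right (by positivity) ?_
    have b : ∀ p : PMF S, (p s').toReal ≤ 1 := fun p =>
      ENNReal.toReal_le_of_le_ofReal zero_le_one (by simpa using p.coe_le_one s')
    have b0 : ∀ p : PMF S, 0 ≤ (p s').toReal := fun p => ENNReal.toReal_nonneg
    rw [Real.norm_eq_abs, abs_le]
    constructor <;>
      linarith [b (M.stateLaw pol 0), b (M.stateLaw pol T), b0 (M.stateLaw pol 0),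
        b0 (M.stateLaw pol T)]
  have h2 : Tendsto (fun T : ℕ => v s + ∑ s', (a T s' - ∑ s, a T s * M.stepR pol s s') * G s' s)
      atTop (𝓝 (v s + ∑ s', 0 * G s' s)) :=
    tendsto_const_nhds.add (tendsto_finsetSum _ fun s' _ => (hlim s').mul_const _)
  simp only [zero_mul, Finset.sum_const_zero, add_zero] at h2
  refine h2.congr' ?_
  filter_upwards [eventually_gt_atTop 0] with T hT
  rw [← hG (a T) (hsum T hT) s]
  ring

theorem CMDP.statDist_eq {M : CMDP S A} {pol : Policy S A} (hU : M.Unichain pol)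
    {v : S → ℝ} (hv : M.IsStationary pol v) : M.statDist pol = v :=
  funext fun s => (CMDP.tendsto_cesaro hU hv s).limUnder_eq

theorem CMDP.isStationary_statDist {M : CMDP S A} {pol : Policy S A} (hU : M.Unichain pol) :
    M.IsStationary pol (M.statDist pol) := by
  obtain ⟨v, hv⟩ := M.exists_stationary pol
  rwa [CMDP.statDist_eq hU hv]

theorem CMDP.avgReward_eq {M : CMDP S A} {pol : Policy S A} (hU : M.Unichain pol) (g : Signal) :
    M.avgReward pol g = ∑ s, M.statDist pol s * ∑ a, prob pol s a * M.signal g s a := by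
  have h := CMDP.tendsto_cesaro hU (CMDP.isStationary_statDist hU)
  refine Tendsto.limUnder_eq ?_
  have h2 := tendsto_finsetSum Finset.univ
    (fun s _ => (h s).mul_const (∑ a, prob pol s a * M.signal g s a))
  refine h2.congr fun T => ?_
  simp only [mul_assoc, ← Finset.mul_sum]
  rw [Finset.sum_comm (s := Finset.range T)]
  simp only [← Finset.sum_mul]

/-- The stationary distribution is carried by the recurrent states. -/
theorem CMDP.recurrent_of_statDist_ne_zero {M : CMDP S A} {pol : Policy S A}
    (hU : M.Unichain pol) {s : S} (hs : M.statDist pol s ≠ 0) : s ∈ M.recurrent pol := by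
  classical
  have hd := CMDP.isStationary_statDist hU
  intro u hu
  by_contra hnot
  -- no stationary mass flows into the set of states reachable from `u`
  let c : S → ℝ := fun x => if M.Reach pol u x then 1 else 0
  have hcP : ∀ x, M.Reach pol u x → ∑ y, M.stepR pol x y * c y = 1 := fun x hx => by
    rw [← M.sum_stepR pol x]
    refine Finset.sum_congr rfl fun y _ => ?_
    by_cases hy : M.stepR pol x y = 0
    · simp [hy]
    · have : M.Reach pol u y := hx.tail (CMDP.stepR_ne_zero.1 hy)
      simp [c, this]
  have hge : ∀ x, c x ≤ ∑ y, M.stepR pol x y * c y := fun x => by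
    by_cases hx : M.Reach pol u x
    · rw [hcP x hx]; simp [c, hx]
    · simp only [c, hx, if_false]
      exact Finset.sum_nonneg fun y _ =>
        mul_nonneg (M.stepR_nonneg _ _ _) (by split_ifs <;> norm_num)
  have hsum : ∑ x, M.statDist pol x * c x
      = ∑ x, M.statDist pol x * ∑ y, M.stepR pol x y * c y := by
    simp only [Finset.mul_sum]
    rw [Finset.sum_comm]
    refine Finset.sum_congr rfl fun y _ => ?_
    conv_lhs => rw [← hd.eq y]
    rw [Finset.sum_mul]
    exact Finset.sum_congr rfl fun x _ => by ring
  have heq := (Finset.sum_eq_sum_iff_of_le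
    fun x _ => mul_le_mul_of_nonneg_left (hge x) (hd.nonneg x)).1 hsum
  have key : ∀ x, M.Reach pol s x → M.statDist pol x ≠ 0 ∧ ¬ M.Reach pol u x := by
    intro x hx
    induction hx with
    | refl => exact ⟨hs, hnot⟩
    | @tail b y _ hby ih =>
      have hb : 0 < M.statDist pol b := lt_of_le_of_ne (hd.nonneg b) ih.1.symm
      have hP : 0 < M.stepR pol b y :=
        lt_of_le_of_ne (M.stepR_nonneg _ _ _) (CMDP.stepR_ne_zero.2 hby).symm
      constructor
      · rw [← hd.eq y]
        exact (Finset.sum_pos' (fun x _ => mul_nonneg (hd.nonneg x) (M.stepR_nonneg _ x _))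
          ⟨b, Finset.mem_univ _, mul_pos hb hP⟩).ne'
      · intro huy
        have h0 := mul_left_cancel₀ ih.1 (heq b (Finset.mem_univ _))
        have hcb : c b = 0 := by simp [c, ih.2]
        have hcy : c y = 1 := by simp [c, huy]
        have : 0 < ∑ y, M.stepR pol b y * c y :=
          Finset.sum_pos' (fun x _ => mul_nonneg (M.stepR_nonneg _ _ _)
            (by simp only [c]; split_ifs <;> norm_num))
            ⟨y, Finset.mem_univ _, by rw [hcy, mul_one]; exact hP⟩
        rw [← h0, hcb] at this
        exact lt_irrefl _ this
  exact (key u hu).2 Relation.ReflTransGen.refl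

theorem CMDP.statDist_pos {M : CMDP S A} {pol : Policy S A}
    (hU : M.Unichain pol) {s : S} (hs : s ∈ M.recurrent pol) : 0 < M.statDist pol s := by
  have hd := CMDP.isStationary_statDist hU
  obtain ⟨x, hx⟩ : ∃ x, M.statDist pol x ≠ 0 := by
    by_contra! h
    have := hd.sum_eq
    simp [h] at this
  have hreach := hU x (CMDP.recurrent_of_statDist_ne_zero hU hx) s hs
  induction hreach with
  | refl => exact lt_of_le_of_ne (hd.nonneg x) hx.symm
  | @tail b y hb hby ih =>
    have hbR : b ∈ M.recurrent pol := CMDP.recurrent_of_reach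
      (CMDP.recurrent_of_statDist_ne_zero hU hx) hb
    rw [← hd.eq y]
    exact Finset.sum_pos' (fun x _ => mul_nonneg (hd.nonneg x) (M.stepR_nonneg _ _ _))
      ⟨b, Finset.mem_univ _, mul_pos (ih hbR)
        (lt_of_le_of_ne (M.stepR_nonneg _ _ _) (CMDP.stepR_ne_zero.2 hby).symm)⟩

/-- The Poisson equation for a vector-valued function. -/
theorem CMDP.exists_poisson {E : Type*} [NormedAddCommGroup E] [NormedSpace ℝ E]
    {M : CMDP S A} {pol : Policy S A} (hU : M.Unichain pol) (F : S → E) :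
    ∃ h : S → E, (∀ s, h s - ∑ s', M.stepR pol s s' • h s'
        = F s - ∑ t, M.statDist pol t • F t) ∧ ∑ s, M.statDist pol s • h s = 0 := by
  classical
  have hd := CMDP.isStationary_statDist hU
  obtain ⟨G, -, hG1, hG2⟩ := CMDP.exists_fundamental hU hd
  set Fb := ∑ t, M.statDist pol t • F t with hFb
  have h0 : ∑ t, M.statDist pol t • (F t - Fb) = 0 := by
    simp only [smul_sub, Finset.sum_sub_distrib]
    rw [← Finset.sum_smul, hd.sum_eq, one_smul, ← hFb, sub_self]
  refine ⟨fun s => ∑ t, G s t • (F t - Fb), fun s => ?_, ?_⟩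
  · have e : ∑ s', M.stepR pol s s' • ∑ t, G s' t • (F t - Fb)
        = ∑ t, (∑ s', M.stepR pol s s' * G s' t) • (F t - Fb) := by
      simp only [Finset.smul_sum, smul_smul, Finset.sum_smul]
      rw [Finset.sum_comm]
    rw [e, ← Finset.sum_sub_distrib]
    simp only [← sub_smul, hG2]
    rw [Finset.sum_congr rfl fun t _ => sub_smul _ _ (F t - Fb), Finset.sum_sub_distrib]
    simp only [ite_smul, one_smul, zero_smul, Finset.sum_ite_eq, Finset.mem_univ, if_true]
    rw [h0, sub_zero]
  · simp only [Finset.smul_sum, smul_smul]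
    rw [Finset.sum_comm]
    simp only [← Finset.sum_smul, hG1]
    exact h0

end Chain

/-! ### Hitting times -/

section Hitting

variable {S A : Type}

/-- The probability that the chain started in `s` avoids `X` up to and including time `n`. -/
def CMDP.noVisit (M : CMDP S A) (pol : Policy S A) (X : Set S) (n : ℕ) (s : S) : ℝ≥0∞ :=
  (M.rollout pol n s).toOuterMeasure {τ | ¬ Visits X s τ}

theorem toOuterMeasure_le_one {α : Type*} (p : PMF α) (X : Set α) : p.toOuterMeasure X ≤ 1 := by
  have h : p.toOuterMeasure Set.univ = 1 :=
    (PMF.toOuterMeasure_apply_eq_one_iff _ _).2 (Set.subset_univ _)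
  exact h ▸ p.toOuterMeasure.mono (Set.subset_univ X)

theorem CMDP.noVisit_le_one (M : CMDP S A) (pol : Policy S A) (X : Set S) (n : ℕ) (s : S) :
    M.noVisit pol X n s ≤ 1 := toOuterMeasure_le_one _ _

theorem CMDP.noVisit_ne_top (M : CMDP S A) (pol : Policy S A) (X : Set S) (n : ℕ) (s : S) :
    M.noVisit pol X n s ≠ ⊤ := ne_top_of_le_ne_top ENNReal.one_ne_top (M.noVisit_le_one pol X n s)

theorem CMDP.noVisit_of_mem (M : CMDP S A) (pol : Policy S A) {X : Set S} (n : ℕ) {s : S}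
    (hs : s ∈ X) : M.noVisit pol X n s = 0 := by
  have : {τ : List (Transition S A) | ¬ Visits X s τ} = ∅ := by
    ext τ; simp [Visits, hs]
  rw [CMDP.noVisit, this, measure_empty]

theorem CMDP.noVisit_zero (M : CMDP S A) (pol : Policy S A) {X : Set S} {s : S}
    (hs : s ∉ X) : M.noVisit pol X 0 s = 1 := by
  classical
  unfold CMDP.noVisit CMDP.rollout
  rw [PMF.toOuterMeasure_pure_apply, if_pos]
  simp [Visits, hs]

theorem CMDP.noVisit_succ (M : CMDP S A) (pol : Policy S A) {X : Set S} (n : ℕ) {s : S}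
    (hs : s ∉ X) :
    M.noVisit pol X (n + 1) s = ∑' s', M.step pol s s' * M.noVisit pol X n s' := by
  classical
  have e : ∀ z : Transition S A, ((M.rollout pol n z.2.2).bind fun τ =>
      PMF.pure (z :: τ)).toOuterMeasure {τ | ¬ Visits X s τ} = M.noVisit pol X n z.2.2 := by
    intro z
    rw [PMF.toOuterMeasure_bind_apply, CMDP.noVisit, PMF.toOuterMeasure_apply]
    refine tsum_congr fun τ => ?_
    rw [PMF.toOuterMeasure_pure_apply, Set.indicator_apply]
    have : (z :: τ ∈ {τ | ¬ Visits X s τ}) ↔ τ ∈ {τ | ¬ Visits X z.2.2 τ} := by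
      simp only [Visits, Set.mem_ofPred_eq, hs, false_or, List.mem_cons, exists_eq_or_imp]
    simp only [this]
    split_ifs <;> simp
  rw [CMDP.noVisit, CMDP.rollout_succ, PMF.toOuterMeasure_bind_apply, CMDP.step_eq_transLaw]
  simp only [e, PMF.bind_apply, ← ENNReal.tsum_mul_right]
  rw [ENNReal.tsum_comm]
  refine tsum_congr fun z => ?_
  rw [tsum_eq_single z.2.2]
  · simp
  · intro s' hs'
    simp [PMF.pure_apply, hs']

theorem CMDP.noVisit_antitone (M : CMDP S A) (pol : Policy S A) (X : Set S) (s : S) :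
    Antitone fun n => M.noVisit pol X n s := by
  refine antitone_nat_of_succ_le fun n => ?_
  induction n generalizing s with
  | zero =>
    by_cases hs : s ∈ X
    · simp [M.noVisit_of_mem pol _ hs]
    · rw [M.noVisit_zero pol hs]; exact M.noVisit_le_one pol X _ s
  | succ n ih =>
    by_cases hs : s ∈ X
    · simp [M.noVisit_of_mem pol _ hs]
    · rw [M.noVisit_succ pol _ hs, M.noVisit_succ pol _ hs]
      gcongr with s'
      exact ih s'

theorem CMDP.noVisit_add_le (M : CMDP S A) (pol : Policy S A) {X : Set S} {n : ℕ} {c : ℝ≥0∞}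
    (hc : ∀ s, M.noVisit pol X n s ≤ c) (k : ℕ) (s : S) :
    M.noVisit pol X (k + n) s ≤ M.noVisit pol X k s * c := by
  induction k generalizing s with
  | zero =>
    by_cases hs : s ∈ X
    · simp [M.noVisit_of_mem pol _ hs]
    · rw [M.noVisit_zero pol hs, one_mul, zero_add]; exact hc s
  | succ k ih =>
    by_cases hs : s ∈ X
    · simp [M.noVisit_of_mem pol _ hs]
    · rw [show k + 1 + n = (k + n) + 1 by ring, M.noVisit_succ pol _ hs, M.noVisit_succ pol _ hs,
        ← ENNReal.tsum_mul_right]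
      refine ENNReal.tsum_le_tsum fun s' => ?_
      rw [mul_assoc]
      gcongr
      exact ih s'

theorem CMDP.noVisit_mul_le (M : CMDP S A) (pol : Policy S A) {X : Set S} {n : ℕ} {c : ℝ≥0∞}
    (hc : ∀ s, M.noVisit pol X n s ≤ c) (j : ℕ) (s : S) :
    M.noVisit pol X (n * j) s ≤ c ^ j := by
  induction j with
  | zero => simpa using M.noVisit_le_one pol X _ s
  | succ j ih =>
    rw [Nat.mul_succ, pow_succ]
    exact (M.noVisit_add_le pol hc _ s).trans (by gcongr)

theorem CMDP.meanHit_eq (M : CMDP S A) (pol : Policy S A) (X : Set S) (s : S) :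
    M.meanHit pol X s = ∑' t, M.noVisit pol X t s := rfl

theorem CMDP.mul_noVisit_le_meanHit (M : CMDP S A) (pol : Policy S A) (X : Set S) (n : ℕ) (s : S) :
    ((n : ℝ≥0∞) + 1) * M.noVisit pol X n s ≤ M.meanHit pol X s := by
  rw [CMDP.meanHit_eq]
  calc ((n : ℝ≥0∞) + 1) * M.noVisit pol X n s = ∑ _t ∈ Finset.range (n + 1), M.noVisit pol X n s := by
        simp
    _ ≤ ∑ t ∈ Finset.range (n + 1), M.noVisit pol X t s :=
        Finset.sum_le_sum fun t ht =>
          M.noVisit_antitone pol X s (Nat.lt_succ_iff.1 (Finset.mem_range.1 ht))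
    _ ≤ _ := ENNReal.sum_le_tsum _

/-- The burn-in misses the recurrent class with probability at most `2 / T²`: by Markov's
inequality each block of `⌊2 C_hit⌋` steps misses it with probability at most `1 / 2`. -/
theorem CMDP.noVisit_burnIn (M : CMDP S A) (pol : Policy S A) {X : Set S} {Chit : ℝ}
    (h0 : 0 ≤ Chit) (h : ∀ s, M.meanHit pol X s ≤ ENNReal.ofReal Chit) {T B : ℕ} (hT : 2 ≤ T)
    (hB : 4 * Chit * Real.logb 2 T ≤ B) (s : S) :
    M.noVisit pol X B s ≤ ENNReal.ofReal (2 / T ^ 2) := by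
  set n := ⌊2 * Chit⌋₊
  set j := ⌊2 * Real.logb 2 T⌋₊
  have hT' : (2 : ℝ) ≤ T := by exact_mod_cast hT
  have hlog : 0 ≤ Real.logb 2 T := Real.logb_nonneg (by norm_num) (by linarith)
  have hn : 2 * Chit < n + 1 := Nat.lt_floor_add_one _
  have hhalf : ∀ s, M.noVisit pol X n s ≤ ENNReal.ofReal (1 / 2) := by
    intro s
    have h1 := (M.mul_noVisit_le_meanHit pol X n s).trans (h s)
    have h2 : ((n : ℝ) + 1) * (M.noVisit pol X n s).toReal ≤ Chit := by
      have := ENNReal.toReal_mono ENNReal.ofReal_ne_top h1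
      rw [ENNReal.toReal_mul, ENNReal.toReal_ofReal h0, ENNReal.toReal_add (by simp) (by simp)]
        at this
      simpa using this
    rw [← ENNReal.ofReal_toReal (M.noVisit_ne_top pol X n s)]
    refine ENNReal.ofReal_le_ofReal ?_
    have : (0 : ℝ) ≤ n := Nat.cast_nonneg _
    by_contra! hlt
    nlinarith
  have hnj : n * j ≤ B := by
    have a1 : (n : ℝ) ≤ 2 * Chit := Nat.floor_le (by linarith)
    have a2 : (j : ℝ) ≤ 2 * Real.logb 2 T := Nat.floor_le (by linarith)
    have : (n : ℝ) * j ≤ B := by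
      calc (n : ℝ) * j ≤ 2 * Chit * (2 * Real.logb 2 T) := by gcongr
        _ = 4 * Chit * Real.logb 2 T := by ring
        _ ≤ B := hB
    exact_mod_cast this
  refine (M.noVisit_antitone pol X s hnj).trans ((M.noVisit_mul_le pol hhalf j s).trans ?_)
  rw [← ENNReal.ofReal_pow (by norm_num)]
  refine ENNReal.ofReal_le_ofReal ?_
  have hj : 2 * Real.logb 2 T < j + 1 := Nat.lt_floor_add_one _
  have hTpos : (0 : ℝ) < T := by linarith
  have h1 : (T : ℝ) ^ 2 ≤ 2 ^ (j + 1) := by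
    have e : (T : ℝ) ^ 2 = (2 : ℝ) ^ (2 * Real.logb 2 T) := by
      rw [mul_comm, Real.rpow_mul (by norm_num), Real.rpow_logb (by norm_num) (by norm_num) hTpos]
      norm_num
    rw [e, ← Real.rpow_natCast]
    refine Real.rpow_le_rpow_of_exponent_le (by norm_num) ?_
    push_cast
    exact hj.le
  rw [one_div, inv_pow, inv_eq_one_div, div_le_div_iff₀ (by positivity) (by positivity)]
  rw [pow_succ (2 : ℝ)] at h1
  linarith

variable [Fintype S] [Fintype A]

theorem CMDP.noVisit_succ_toReal (M : CMDP S A) (pol : Policy S A) {X : Set S} (n : ℕ) {s : S}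
    (hs : s ∉ X) : (M.noVisit pol X (n + 1) s).toReal
      = ∑ s', M.stepR pol s s' * (M.noVisit pol X n s').toReal := by
  rw [M.noVisit_succ pol n hs, tsum_fintype, ENNReal.toReal_sum fun s' _ =>
    ENNReal.mul_ne_top (PMF.apply_ne_top _ _) (M.noVisit_ne_top pol X n s')]
  exact Finset.sum_congr rfl fun s' _ => ENNReal.toReal_mul

/-- A function vanishing at `y` that decreases by at most `G` per expected step is bounded by `G`
times the mean hitting time of `y`. -/
theorem CMDP.le_mul_meanHit {M : CMDP S A} {pol : Policy S A} {y : S} {u : S → ℝ} {G : ℝ}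
    (huy : u y = 0)
    (hu : ∀ s ∈ M.recurrent pol, u s ≤ G + ∑ s', M.stepR pol s s' * u s') {s : S}
    (hs : s ∈ M.recurrent pol) (hfin : M.meanHit pol {y} s ≠ ⊤) :
    u s ≤ G * (M.meanHit pol {y} s).toReal := by
  set p : ℕ → S → ℝ := fun n s => (M.noVisit pol {y} n s).toReal with hp
  have hsumm : Summable fun n => p n s := ENNReal.summable_toReal hfin
  have htau : (M.meanHit pol {y} s).toReal = ∑' n, p n s := by
    rw [CMDP.meanHit_eq, ENNReal.tsum_toReal_eq fun n => M.noVisit_ne_top pol _ n s]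
  obtain ⟨m, hm⟩ : ∃ m, ∀ s, |u s| ≤ m := by
    obtain ⟨C, hC⟩ := (Set.finite_range fun a => |u a|).bddAbove
    exact ⟨C, fun a => hC ⟨a, rfl⟩⟩
  have key : ∀ N, ∀ s ∈ M.recurrent pol, u s ≤ G * ∑ t ∈ Finset.range N, p t s + m * p N s := by
    intro N
    induction N with
    | zero =>
      intro s hs
      by_cases hsy : s = y
      · subst hsy
        simp [hp, huy, M.noVisit_of_mem pol (X := {s}) _ rfl]
      · simp only [Finset.range_zero, Finset.sum_empty, mul_zero, zero_add, hp,
          M.noVisit_zero pol (X := {y}) hsy, ENNReal.toReal_one, mul_one]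
        exact (le_abs_self _).trans (hm s)
    | succ N ih =>
      intro s hs
      by_cases hsy : s = y
      · subst hsy
        simp [hp, huy, M.noVisit_of_mem pol (X := {s}) _ rfl]
      · have hrec : ∀ n, p (n + 1) s = ∑ s', M.stepR pol s s' * p n s' := fun n =>
          M.noVisit_succ_toReal pol n (X := {y}) hsy
        have h0 : p 0 s = 1 := by simp [hp, M.noVisit_zero pol (X := {y}) hsy]
        calc u s ≤ G + ∑ s', M.stepR pol s s' * u s' := hu s hs
          _ ≤ G + ∑ s', M.stepR pol s s' * (G * ∑ t ∈ Finset.range N, p t s' + m * p N s') := by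
            refine add_le_add_right (Finset.sum_le_sum fun s' _ => ?_) _
            by_cases h : M.stepR pol s s' = 0
            · simp [h]
            · exact mul_le_mul_of_nonneg_left
                (ih s' (CMDP.recurrent_step hs (CMDP.stepR_ne_zero.1 h))) (M.stepR_nonneg _ _ _)
          _ = G * ∑ t ∈ Finset.range (N + 1), p t s + m * p (N + 1) s := by
            rw [Finset.sum_range_succ', h0, hrec]
            simp only [hrec, mul_add, Finset.sum_add_distrib, Finset.mul_sum]
            rw [Finset.sum_comm (s := Finset.range N)]
            rw [mul_one, add_comm G, add_right_comm]
            congr 1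
            · congr 1
              exact Finset.sum_congr rfl fun _ _ => Finset.sum_congr rfl fun _ _ => by ring
            · exact Finset.sum_congr rfl fun _ _ => by ring
  have hlim : Tendsto (fun N => G * ∑ t ∈ Finset.range N, p t s + m * p N s) atTop
      (𝓝 (G * ∑' n, p n s + m * 0)) :=
    (hsumm.hasSum.tendsto_sum_nat.const_mul G).add (hsumm.tendsto_atTop_zero.const_mul m)
  rw [htau]
  have := ge_of_tendsto' hlim fun N => key N s hs
  simpa using this

/-- A solution of the Poisson equation is bounded, on the recurrent class, by the target time. -/
theorem CMDP.norm_le_of_poisson {E : Type*} [NormedAddCommGroup E] [NormedSpace ℝ E]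
    {M : CMDP S A} {pol : Policy S A} (hU : M.Unichain pol) {h : S → E} {G C : ℝ}
    (hP : ∀ s ∈ M.recurrent pol, ‖h s - ∑ s', M.stepR pol s s' • h s'‖ ≤ G)
    (h0 : ∑ s, M.statDist pol s • h s = 0) (hC0 : 0 ≤ C)
    (hC : M.targetTime pol ≤ ENNReal.ofReal C) {s : S} (hs : s ∈ M.recurrent pol) :
    ‖h s‖ ≤ G * C := by
  have hd := CMDP.isStationary_statDist hU
  have hG : 0 ≤ G := (norm_nonneg _).trans (hP s hs)
  have hsum : ∑ y, ENNReal.ofReal (M.statDist pol y) * M.meanHit pol {y} s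
      ≤ ENNReal.ofReal C :=
    (le_iSup₂ (f := fun s (_ : s ∈ M.recurrent pol) =>
      ∑ y, ENNReal.ofReal (M.statDist pol y) * M.meanHit pol {y} s) s hs).trans hC
  have hterm : ∀ y, ENNReal.ofReal (M.statDist pol y) * M.meanHit pol {y} s ≠ ⊤ := fun y =>
    ne_top_of_le_ne_top ENNReal.ofReal_ne_top
      ((Finset.single_le_sum (f := fun y =>
        ENNReal.ofReal (M.statDist pol y) * M.meanHit pol {y} s)
        (fun _ _ => zero_le) (Finset.mem_univ y)).trans hsum)
  have hreal : ∑ y, M.statDist pol y * (M.meanHit pol {y} s).toReal ≤ C := by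
    have := ENNReal.toReal_mono ENNReal.ofReal_ne_top hsum
    rw [ENNReal.toReal_ofReal hC0, ENNReal.toReal_sum fun y _ => hterm y] at this
    refine le_of_eq_of_le (Finset.sum_congr rfl fun y _ => ?_) this
    rw [ENNReal.toReal_mul, ENNReal.toReal_ofReal (hd.nonneg y)]
  have hbound : ∀ y, M.statDist pol y * ‖h s - h y‖
      ≤ G * (M.statDist pol y * (M.meanHit pol {y} s).toReal) := by
    intro y
    rcases eq_or_ne (M.statDist pol y) 0 with hy | hy
    · simp [hy]
    have hypos : 0 < M.statDist pol y := lt_of_le_of_ne (hd.nonneg y) hy.symm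
    have hfin : M.meanHit pol {y} s ≠ ⊤ := by
      intro htop
      apply hterm y
      rw [htop, ENNReal.mul_top]
      simpa using hypos
    have := CMDP.le_mul_meanHit (G := G) (u := fun t => ‖h t - h y‖) (by simp) (fun t ht => ?_) hs hfin
    · calc _ ≤ M.statDist pol y * (G * (M.meanHit pol {y} s).toReal) := by gcongr
        _ = _ := by ring
    · have e : h t - h y = (h t - ∑ s', M.stepR pol t s' • h s')
          + ∑ s', M.stepR pol t s' • (h s' - h y) := by
        simp only [smul_sub, Finset.sum_sub_distrib]
        rw [← Finset.sum_smul, M.sum_stepR, one_smul]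
        abel
      change ‖h t - h y‖ ≤ _
      conv_lhs => rw [e]
      refine (norm_add_le _ _).trans (add_le_add (hP t ht) ?_)
      refine (norm_sum_le _ _).trans_eq (Finset.sum_congr rfl fun s' _ => ?_)
      rw [norm_smul, Real.norm_of_nonneg (M.stepR_nonneg _ _ _)]
  have e : h s = ∑ y, M.statDist pol y • (h s - h y) := by
    simp only [smul_sub, Finset.sum_sub_distrib]
    rw [h0, ← Finset.sum_smul, hd.sum_eq, one_smul, sub_zero]
  calc ‖h s‖ = ‖∑ y, M.statDist pol y • (h s - h y)‖ := by rw [← e]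
    _ ≤ ∑ y, M.statDist pol y * ‖h s - h y‖ := by
      refine (norm_sum_le _ _).trans_eq (Finset.sum_congr rfl fun y _ => ?_)
      rw [norm_smul, Real.norm_of_nonneg (hd.nonneg y)]
    _ ≤ ∑ y, G * (M.statDist pol y * (M.meanHit pol {y} s).toReal) :=
      Finset.sum_le_sum fun y _ => hbound y
    _ ≤ G * C := by rw [← Finset.mul_sum]; gcongr

/-- A recurrent class with two states has target time at least `1 / 2`. -/
theorem CMDP.half_le_of_targetTime {M : CMDP S A} {pol : Policy S A} (hU : M.Unichain pol)
    (h : M.targetTime pol ≠ 0) : ENNReal.ofReal (1 / 2) ≤ M.targetTime pol := by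
  classical
  have hd := CMDP.isStationary_statDist hU
  have hle : ∀ s ∈ M.recurrent pol, ENNReal.ofReal (1 - M.statDist pol s) ≤ M.targetTime pol := by
    intro s hs
    refine le_trans ?_ (le_iSup₂ (f := fun s (_ : s ∈ M.recurrent pol) =>
      ∑ y, ENNReal.ofReal (M.statDist pol y) * M.meanHit pol {y} s) s hs)
    have e : 1 - M.statDist pol s = ∑ y ∈ Finset.univ.erase s, M.statDist pol y := by
      rw [← hd.sum_eq, ← Finset.add_sum_erase _ _ (Finset.mem_univ s)]; ring
    rw [e, ENNReal.ofReal_sum_of_nonneg fun y _ => hd.nonneg y]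
    refine le_trans (Finset.sum_le_sum fun y hy => ?_)
      (Finset.sum_le_sum_of_subset (Finset.subset_univ (Finset.univ.erase s)))
    have hne : s ∉ ({y} : Set S) := fun h => (Finset.ne_of_mem_erase hy) h.symm
    have : 1 ≤ M.meanHit pol {y} s := by
      have := M.mul_noVisit_le_meanHit pol {y} 0 s
      rw [M.noVisit_zero pol hne] at this
      simpa using this
    exact le_mul_of_one_le_right (zero_le) this
  obtain ⟨s, hs, y, hys, hy⟩ : ∃ s ∈ M.recurrent pol, ∃ y, y ≠ s ∧ M.statDist pol y ≠ 0 := by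
    by_contra! hcon
    apply h
    unfold CMDP.targetTime
    simp only [ENNReal.iSup_eq_zero]
    intro s hs
    refine Finset.sum_eq_zero fun y _ => ?_
    by_cases hys : y = s
    · rw [hys, CMDP.meanHit_eq]
      simp [M.noVisit_of_mem pol (X := {s}) _ rfl]
    · simp [hcon s hs y hys]
  have hyR := CMDP.recurrent_of_statDist_ne_zero hU hy
  have hadd : M.statDist pol s + M.statDist pol y ≤ 1 := by
    rw [← hd.sum_eq, ← Finset.add_sum_erase _ _ (Finset.mem_univ s)]
    have := Finset.single_le_sum (f := M.statDist pol) (fun i _ => hd.nonneg i)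
      (Finset.mem_erase.2 ⟨hys, Finset.mem_univ y⟩)
    linarith
  rcases le_total (M.statDist pol s) (1 / 2) with h1 | h1
  · exact (ENNReal.ofReal_le_ofReal (by linarith)).trans (hle s hs)
  · exact (ENNReal.ofReal_le_ofReal (by linarith)).trans (hle y hyR)

end Hitting

/-! ### Trajectories inside the recurrent class -/

section Trajectories

variable {S A : Type}

/-- The transitions between two recurrent states. -/
def CMDP.recTrans (M : CMDP S A) (pol : Policy S A) : Set (Transition S A) :=
  {z | z.1 ∈ M.recurrent pol ∧ z.2.2 ∈ M.recurrent pol}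

theorem CMDP.recTrans_of_mem {M : CMDP S A} {pol : Policy S A} {s : S} {z : Transition S A}
    (hs : s ∈ M.recurrent pol) (hz : z ∈ (M.transLaw pol s).support) : z ∈ M.recTrans pol :=
  ⟨CMDP.fst_of_mem_transLaw hz ▸ hs, CMDP.recurrent_step hs (CMDP.step_of_mem_transLaw hz)⟩

theorem CMDP.mem_rollout_succ {M : CMDP S A} {pol : Policy S A} {n : ℕ} {s : S}
    {τ : List (Transition S A)} (h : τ ∈ (M.rollout pol (n + 1) s).support) :
    ∃ z ∈ (M.transLaw pol s).support, ∃ τ' ∈ (M.rollout pol n z.2.2).support, τ = z :: τ' := by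
  rw [CMDP.rollout_succ, PMF.mem_support_bind_iff] at h
  obtain ⟨z, hz, h⟩ := h
  obtain ⟨τ', hτ', h⟩ := (PMF.mem_support_bind_iff _ _ _).1 h
  exact ⟨z, hz, τ', hτ', (PMF.mem_support_pure_iff _ _).1 h⟩

theorem CMDP.length_of_mem_rollout {M : CMDP S A} {pol : Policy S A} {n : ℕ} {s : S}
    {τ : List (Transition S A)} (h : τ ∈ (M.rollout pol n s).support) : τ.length = n := by
  induction n generalizing s τ with
  | zero => rw [(PMF.mem_support_pure_iff _ _).1 h]; rfl
  | succ n ih =>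
    obtain ⟨z, _, τ', hτ', rfl⟩ := CMDP.mem_rollout_succ h
    rw [List.length_cons, ih hτ']

theorem CMDP.recTrans_of_mem_rollout {M : CMDP S A} {pol : Policy S A} {n : ℕ} {s : S}
    {τ : List (Transition S A)} (hs : s ∈ M.recurrent pol)
    (h : τ ∈ (M.rollout pol n s).support) :
    (∀ z ∈ τ, z ∈ M.recTrans pol) ∧ endState s τ ∈ M.recurrent pol := by
  induction n generalizing s τ with
  | zero => rw [(PMF.mem_support_pure_iff _ _).1 h]; exact ⟨by simp, hs⟩
  | succ n ih =>
    obtain ⟨z, hz, τ', hτ', rfl⟩ := CMDP.mem_rollout_succ h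
    have hzR := CMDP.recTrans_of_mem hs hz
    obtain ⟨h1, h2⟩ := ih hzR.2 hτ'
    refine ⟨fun w hw => ?_, h2⟩
    rcases List.mem_cons.1 hw with rfl | hw
    · exact hzR
    · exact h1 w hw

theorem CMDP.endState_of_visits {M : CMDP S A} {pol : Policy S A} {n : ℕ} {s : S}
    {τ : List (Transition S A)} (h : τ ∈ (M.rollout pol n s).support)
    (hv : Visits (M.recurrent pol) s τ) : endState s τ ∈ M.recurrent pol := by
  induction n generalizing s τ with
  | zero =>
    rw [(PMF.mem_support_pure_iff _ _).1 h] at hv ⊢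
    simpa [Visits, endState] using hv
  | succ n ih =>
    by_cases hs : s ∈ M.recurrent pol
    · exact (CMDP.recTrans_of_mem_rollout hs h).2
    obtain ⟨z, hz, τ', hτ', rfl⟩ := CMDP.mem_rollout_succ h
    refine ih (s := z.2.2) hτ' ?_
    simpa only [Visits, hs, false_or, List.mem_cons, exists_eq_or_imp] using hv

variable [Fintype S] [Fintype A]

theorem CMDP.finite_support_rollout (M : CMDP S A) (pol : Policy S A) (n : ℕ) (s : S) :
    (M.rollout pol n s).support.Finite := by
  induction n generalizing s with
  | zero => simp [CMDP.rollout]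
  | succ n ih =>
    rw [CMDP.rollout_succ, PMF.support_bind]
    refine Set.Finite.biUnion (Set.toFinite _) fun z _ => ?_
    rw [PMF.support_bind]
    exact (ih _).biUnion fun τ _ => by simp

variable {E : Type*} [NormedAddCommGroup E] [NormedSpace ℝ E] [CompleteSpace E]

theorem CMDP.pbdd_rollout (M : CMDP S A) (pol : Policy S A) (n : ℕ) (s : S)
    (F : List (Transition S A) → E) : PBdd (M.rollout pol n s) F :=
  PBdd.of_finite_support (M.finite_support_rollout pol n s) F

theorem CMDP.pexp_rollout_succ (M : CMDP S A) (pol : Policy S A) (n : ℕ) (s : S)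
    (F : List (Transition S A) → E) :
    pexp (M.rollout pol (n + 1) s) F = pexp (M.transLaw pol s) fun z =>
      pexp (M.rollout pol n z.2.2) fun τ => F (z :: τ) := by
  have hb := M.pbdd_rollout pol (n + 1) s F
  rw [CMDP.rollout_succ] at hb ⊢
  rw [pexp_bind hb]
  refine pexp_congr fun z _ => ?_
  rw [pexp_bind_pure _ _ (M.pbdd_rollout pol n _ _)]

theorem CMDP.pexp_rollout_take (M : CMDP S A) (pol : Policy S A) {n N : ℕ} (h : n ≤ N) (s : S)
    (F : List (Transition S A) → E) :
    pexp (M.rollout pol N s) (fun τ => F (τ.take n)) = pexp (M.rollout pol n s) F := by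
  induction n generalizing N s F with
  | zero => simp [CMDP.rollout, pexp_pure, pexp_const]
  | succ n ih =>
    obtain ⟨N, rfl⟩ : ∃ N', N = N' + 1 := ⟨N - 1, by omega⟩
    rw [CMDP.pexp_rollout_succ, CMDP.pexp_rollout_succ]
    refine pexp_congr fun z _ => ?_
    simp only [List.take_succ_cons]
    exact ih (by omega) z.2.2 fun τ => F (z :: τ)

/-- The stationary distribution of a unichain policy as a probability mass function. -/
def CMDP.statLaw (M : CMDP S A) (pol : Policy S A) (hU : M.Unichain pol) : PMF S :=
  PMF.ofFintype (fun s => ENNReal.ofReal (M.statDist pol s)) (by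
    have hd := CMDP.isStationary_statDist hU
    rw [← ENNReal.ofReal_sum_of_nonneg fun s _ => hd.nonneg s, hd.sum_eq, ENNReal.ofReal_one])

/-- The law of a transition of the stationary chain. -/
def CMDP.statTrans (M : CMDP S A) (pol : Policy S A) (hU : M.Unichain pol) :
    PMF (Transition S A) := (M.statLaw pol hU).bind (M.transLaw pol)

variable {M : CMDP S A} {pol : Policy S A} (hU : M.Unichain pol)

theorem CMDP.statLaw_toReal (s : S) : (M.statLaw pol hU s).toReal = M.statDist pol s := by
  rw [CMDP.statLaw, PMF.ofFintype_apply,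
    ENNReal.toReal_ofReal ((CMDP.isStationary_statDist hU).nonneg s)]

theorem CMDP.pexp_statTrans (f : Transition S A → E) :
    pexp (M.statTrans pol hU) f = ∑ s, M.statDist pol s • pexp (M.transLaw pol s) f := by
  rw [CMDP.statTrans, pexp_bind (PBdd.of_finite _ _), pexp_fintype]
  simp only [CMDP.statLaw_toReal]

theorem CMDP.pexp_statTrans_fst (h : S → E) :
    pexp (M.statTrans pol hU) (fun z => h z.1) = ∑ s, M.statDist pol s • h s := by
  rw [CMDP.pexp_statTrans]
  refine Finset.sum_congr rfl fun s _ => ?_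
  rw [pexp_congr (g := fun _ => h s) fun z hz => by rw [CMDP.fst_of_mem_transLaw hz], pexp_const]

theorem CMDP.pexp_statTrans_snd (h : S → E) :
    pexp (M.statTrans pol hU) (fun z => h z.2.2) = ∑ s, M.statDist pol s • h s := by
  rw [CMDP.pexp_statTrans]
  simp only [CMDP.pexp_transLaw_snd, Finset.smul_sum, smul_smul]
  rw [Finset.sum_comm]
  simp only [← Finset.sum_smul, (CMDP.isStationary_statDist hU).eq]

theorem CMDP.recTrans_of_mem_statTrans {z : Transition S A}
    (hz : z ∈ (M.statTrans pol hU).support) : z ∈ M.recTrans pol := by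
  obtain ⟨s, hs, hz⟩ := (PMF.mem_support_bind_iff _ _ _).1 hz
  refine CMDP.recTrans_of_mem (CMDP.recurrent_of_statDist_ne_zero hU fun h0 => ?_) hz
  rw [PMF.mem_support_iff, ← ENNReal.toReal_ne_zero.trans (and_iff_left
    ((M.statLaw pol hU).apply_ne_top s)), CMDP.statLaw_toReal] at hs
  exact hs h0

end Trajectories

/-! ### Ergodic averages along a trajectory -/

section Averages

variable {S A : Type} [Fintype S] [Fintype A] {M : CMDP S A} {pol : Policy S A}
  {E : Type} [NormedAddCommGroup E] [InnerProductSpace ℝ E] [CompleteSpace E]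

/-- The sum of the centered values of `f` along the trajectory, corrected by the solution `h` of
the Poisson equation so as to be a martingale. -/
def poissonMart (f : Transition S A → E) (fb : E) (h : S → E) (s : S)
    (τ : List (Transition S A)) : E :=
  (τ.map fun z => f z - fb).sum + (h (endState s τ) - h s)

/-- The martingale increment over one transition. -/
def poissonIncr (f : Transition S A → E) (fb : E) (h : S → E) (z : Transition S A) : E :=
  f z - fb + (h z.2.2 - h z.1)

theorem poissonMart_cons (f : Transition S A → E) (fb : E) (h : S → E) (z : Transition S A)
    (τ : List (Transition S A)) :
    poissonMart f fb h z.1 (z :: τ) = poissonIncr f fb h z + poissonMart f fb h z.2.2 τ := by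
  have : endState z.1 (z :: τ) = endState z.2.2 τ := rfl
  simp only [poissonMart, poissonIncr, List.map_cons, List.sum_cons, this]
  abel

theorem pexp_poissonIncr {f : Transition S A → E} {fb : E} {h : S → E}
    (hP : ∀ s, h s - ∑ s', M.stepR pol s s' • h s' = pexp (M.transLaw pol s) f - fb) (s : S) :
    pexp (M.transLaw pol s) (poissonIncr f fb h) = 0 := by
  have e : pexp (M.transLaw pol s) (poissonIncr f fb h)
      = pexp (M.transLaw pol s) fun z => (f z - fb) + (h z.2.2 - h s) :=
    pexp_congr fun z hz => by rw [poissonIncr, CMDP.fst_of_mem_transLaw hz]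
  rw [e, pexp_add (PBdd.of_finite _ _) (PBdd.of_finite _ _), pexp_sub (PBdd.of_finite _ _)
    (PBdd.of_finite _ _), pexp_sub (PBdd.of_finite _ _) (PBdd.of_finite _ _), pexp_const,
    pexp_const, CMDP.pexp_transLaw_snd, ← hP s]
  abel

theorem pexp_poissonMart {f : Transition S A → E} {fb : E} {h : S → E}
    (hP : ∀ s, h s - ∑ s', M.stepR pol s s' • h s' = pexp (M.transLaw pol s) f - fb)
    (n : ℕ) (s : S) : pexp (M.rollout pol n s) (poissonMart f fb h s) = 0 := by
  induction n generalizing s with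
  | zero => simp [CMDP.rollout, pexp_pure, poissonMart, endState]
  | succ n ih =>
    rw [CMDP.pexp_rollout_succ]
    have e : (pexp (M.transLaw pol s) fun z =>
        pexp (M.rollout pol n z.2.2) fun τ => poissonMart f fb h s (z :: τ))
        = pexp (M.transLaw pol s) (poissonIncr f fb h) := by
      refine pexp_congr fun z hz => ?_
      rw [← CMDP.fst_of_mem_transLaw hz]
      simp only [poissonMart_cons]
      rw [pexp_add (PBdd.const _ _) (M.pbdd_rollout pol n _ _), pexp_const, ih, add_zero]
    rw [e, pexp_poissonIncr hP]

/-- The increments of the martingale are orthogonal, so its second moment grows linearly. -/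
theorem pexp_poissonMart_sq {f : Transition S A → E} {fb : E} {h : S → E} {K : ℝ}
    (hP : ∀ s, h s - ∑ s', M.stepR pol s s' • h s' = pexp (M.transLaw pol s) f - fb)
    (hK : ∀ z ∈ M.recTrans pol, ‖poissonIncr f fb h z‖ ≤ K) (n : ℕ) {s : S}
    (hs : s ∈ M.recurrent pol) :
    pexp (M.rollout pol n s) (fun τ => ‖poissonMart f fb h s τ‖ ^ 2) ≤ n * K ^ 2 := by
  induction n generalizing s with
  | zero => simp [CMDP.rollout, pexp_pure, poissonMart, endState]
  | succ n ih =>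
    rw [CMDP.pexp_rollout_succ]
    refine pexp_le (PBdd.of_finite _ _) fun z hz => ?_
    have hzR := CMDP.recTrans_of_mem hs hz
    rw [← CMDP.fst_of_mem_transLaw hz]
    simp only [poissonMart_cons, norm_add_sq_real]
    have hin : pexp (M.rollout pol n z.2.2) (fun τ =>
        2 * inner ℝ (poissonIncr f fb h z) (poissonMart f fb h z.2.2 τ)) = 0 := by
      rw [pexp_mul_left]
      have := pexp_clm (M.pbdd_rollout pol n z.2.2 (poissonMart f fb h z.2.2))
        (innerSL ℝ (poissonIncr f fb h z))
      simp only [innerSL_apply_apply] at this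
      rw [this, pexp_poissonMart hP, inner_zero_right, mul_zero]
    rw [pexp_add (M.pbdd_rollout pol n _ _) (M.pbdd_rollout pol n _ _),
      pexp_add (M.pbdd_rollout pol n _ _) (M.pbdd_rollout pol n _ _), hin, pexp_const]
    have h1 := ih hzR.2
    have h2 : ‖poissonIncr f fb h z‖ ^ 2 ≤ K ^ 2 := by
      gcongr; exact hK z hzR
    push_cast
    linarith

theorem sum_map_sub_const (f : Transition S A → E) (c : E) (τ : List (Transition S A)) :
    (τ.map fun z => f z - c).sum = (τ.map f).sum - (τ.length : ℝ) • c := by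
  induction τ with
  | nil => simp
  | cons z τ ih =>
    simp only [List.map_cons, List.sum_cons, ih, List.length_cons]
    push_cast
    rw [add_smul, one_smul]
    abel

variable {C Cf : ℝ} {f : Transition S A → E}

theorem exists_poisson_bound (hU : M.Unichain pol) (hC0 : 0 ≤ C)
    (hC : M.targetTime pol ≤ ENNReal.ofReal C) (hf : ∀ z ∈ M.recTrans pol, ‖f z‖ ≤ Cf) :
    ∃ h : S → E, (∀ s, h s - ∑ s', M.stepR pol s s' • h s'
        = pexp (M.transLaw pol s) f - pexp (M.statTrans pol hU) f) ∧
      ∀ s ∈ M.recurrent pol, ‖h s‖ ≤ 2 * Cf * C := by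
  obtain ⟨h, hP, h0⟩ := CMDP.exists_poisson hU fun s => pexp (M.transLaw pol s) f
  rw [← CMDP.pexp_statTrans hU] at hP
  refine ⟨h, hP, fun s hs => CMDP.norm_le_of_poisson hU (fun t ht => ?_) h0 hC0 hC hs⟩
  rw [hP]
  have h1 : ‖pexp (M.transLaw pol t) f‖ ≤ Cf :=
    norm_pexp_le_of_le fun z hz => hf z (CMDP.recTrans_of_mem ht hz)
  have h2 : ‖pexp (M.statTrans pol hU) f‖ ≤ Cf :=
    norm_pexp_le_of_le fun z hz => hf z (CMDP.recTrans_of_mem_statTrans hU hz)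
  linarith [norm_sub_le (pexp (M.transLaw pol t) f) (pexp (M.statTrans pol hU) f)]

theorem norm_pexp_sum_sub_le (hU : M.Unichain pol) (hC0 : 0 ≤ C)
    (hC : M.targetTime pol ≤ ENNReal.ofReal C) (hf : ∀ z ∈ M.recTrans pol, ‖f z‖ ≤ Cf)
    (n : ℕ) {s : S} (hs : s ∈ M.recurrent pol) :
    ‖pexp (M.rollout pol n s) (fun τ => (τ.map f).sum) - (n : ℝ) • pexp (M.statTrans pol hU) f‖
      ≤ 4 * Cf * C := by
  obtain ⟨h, hP, hb⟩ := exists_poisson_bound hU hC0 hC hf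
  set fb := pexp (M.statTrans pol hU) f
  have e : pexp (M.rollout pol n s) (fun τ => (τ.map f).sum) - (n : ℝ) • fb
      = pexp (M.rollout pol n s) fun τ => h s - h (endState s τ) := by
    rw [← sub_eq_zero]
    have h1 : pexp (M.rollout pol n s) (poissonMart f fb h s)
        = pexp (M.rollout pol n s) fun τ => ((τ.map f).sum - (n : ℝ) • fb)
          - (h s - h (endState s τ)) := by
      refine pexp_congr fun τ hτ => ?_
      rw [poissonMart, sum_map_sub_const, CMDP.length_of_mem_rollout hτ]
      abel
    rw [pexp_sub (M.pbdd_rollout pol n _ _) (M.pbdd_rollout pol n _ _),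
      pexp_sub (M.pbdd_rollout pol n _ _) (M.pbdd_rollout pol n _ _), pexp_const,
      pexp_poissonMart hP] at h1
    exact h1.symm
  rw [e]
  refine norm_pexp_le_of_le fun τ hτ => ?_
  have h1 := hb _ (CMDP.recTrans_of_mem_rollout hs hτ).2
  have h2 := hb s hs
  linarith [norm_sub_le (h s) (h (endState s τ))]

theorem pexp_sum_sub_sq_le (hU : M.Unichain pol) (hC0 : 1 / 2 ≤ C)
    (hC : M.targetTime pol ≤ ENNReal.ofReal C) (hf : ∀ z ∈ M.recTrans pol, ‖f z‖ ≤ Cf)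
    {n : ℕ} (hn : 1 ≤ n) {s : S} (hs : s ∈ M.recurrent pol) :
    pexp (M.rollout pol n s)
        (fun τ => ‖(τ.map f).sum - (n : ℝ) • pexp (M.statTrans pol hU) f‖ ^ 2)
      ≤ 160 * n * (Cf * C) ^ 2 := by
  obtain ⟨h, hP, hb⟩ := exists_poisson_bound hU (by linarith) hC hf
  set fb := pexp (M.statTrans pol hU) f with hfb
  have hfbn : ‖fb‖ ≤ Cf :=
    norm_pexp_le_of_le fun z hz => hf z (CMDP.recTrans_of_mem_statTrans hU hz)
  have hCf : 0 ≤ Cf := (norm_nonneg _).trans hfbn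
  have hinc : ∀ z ∈ M.recTrans pol, ‖poissonIncr f fb h z‖ ≤ 8 * (Cf * C) := by
    intro z hz
    have h1 := hb _ hz.1
    have h2 := hb _ hz.2
    have h3 := hf z hz
    have h4 : ‖poissonIncr f fb h z‖ ≤ (‖f z‖ + ‖fb‖) + (‖h z.2.2‖ + ‖h z.1‖) :=
      (norm_add_le _ _).trans (add_le_add (norm_sub_le _ _) (norm_sub_le _ _))
    nlinarith
  have hM := pexp_poissonMart_sq hP hinc n hs
  have hpt : ∀ τ ∈ (M.rollout pol n s).support, ‖(τ.map f).sum - (n : ℝ) • fb‖ ^ 2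
      ≤ 2 * ‖poissonMart f fb h s τ‖ ^ 2 + 32 * (Cf * C) ^ 2 := by
    intro τ hτ
    have h1 := hb _ (CMDP.recTrans_of_mem_rollout hs hτ).2
    have h2 := hb s hs
    have e : (τ.map f).sum - (n : ℝ) • fb
        = poissonMart f fb h s τ + (h s - h (endState s τ)) := by
      rw [poissonMart, sum_map_sub_const, CMDP.length_of_mem_rollout hτ]
      abel
    have h3 : ‖(τ.map f).sum - (n : ℝ) • fb‖ ≤ ‖poissonMart f fb h s τ‖ + 4 * (Cf * C) := by
      rw [e]
      refine (norm_add_le _ _).trans (add_le_add le_rfl ?_)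
      linarith [norm_sub_le (h s) (h (endState s τ))]
    calc _ ≤ (‖poissonMart f fb h s τ‖ + 4 * (Cf * C)) ^ 2 := by gcongr
      _ ≤ _ := by nlinarith [sq_nonneg (‖poissonMart f fb h s τ‖ - 4 * (Cf * C))]
  refine (pexp_mono (M.pbdd_rollout pol n _ _) (M.pbdd_rollout pol n _ _) hpt).trans ?_
  rw [pexp_add (M.pbdd_rollout pol n _ _) (M.pbdd_rollout pol n _ _), pexp_mul_left, pexp_const]
  have : (1 : ℝ) ≤ n := by exact_mod_cast hn
  nlinarith [sq_nonneg (Cf * C)]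

theorem pexp_levelAvg (M : CMDP S A) (pol : Policy S A) (f : Transition S A → E) {j N : ℕ}
    (h : 2 ^ j ≤ N) (s : S) :
    pexp (M.rollout pol N s) (fun τ => levelAvg f τ j)
      = ((2 : ℝ) ^ j)⁻¹ • pexp (M.rollout pol (2 ^ j) s) fun τ => (τ.map f).sum := by
  rw [← pexp_smul]
  exact M.pexp_rollout_take pol h s fun τ => ((2 : ℝ) ^ j)⁻¹ • (τ.map f).sum

theorem norm_pexp_levelAvg_sub_le (hU : M.Unichain pol) (hC0 : 0 ≤ C)
    (hC : M.targetTime pol ≤ ENNReal.ofReal C) (hf : ∀ z ∈ M.recTrans pol, ‖f z‖ ≤ Cf)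
    {j N : ℕ} (hj : 2 ^ j ≤ N) {s : S} (hs : s ∈ M.recurrent pol) :
    ‖pexp (M.rollout pol N s) (fun τ => levelAvg f τ j) - pexp (M.statTrans pol hU) f‖
      ≤ 4 * Cf * C / 2 ^ j := by
  have h := norm_pexp_sum_sub_le hU hC0 hC hf (2 ^ j) hs
  rw [pexp_levelAvg M pol f hj]
  set fb := pexp (M.statTrans pol hU) f
  have e : ∀ x : E, ((2 : ℝ) ^ j)⁻¹ • x - fb = ((2 : ℝ) ^ j)⁻¹ • (x - ((2 ^ j : ℕ) : ℝ) • fb) := by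
    intro x
    push_cast
    rw [smul_sub, smul_smul, inv_mul_cancel₀ (by positivity), one_smul]
  rw [e, norm_smul, norm_inv, norm_pow, Real.norm_ofNat, inv_mul_eq_div]
  gcongr

theorem pexp_levelAvg_sub_sq_le (hU : M.Unichain pol) (hC0 : 1 / 2 ≤ C)
    (hC : M.targetTime pol ≤ ENNReal.ofReal C) (hf : ∀ z ∈ M.recTrans pol, ‖f z‖ ≤ Cf)
    {j N : ℕ} (hj : 2 ^ j ≤ N) {s : S} (hs : s ∈ M.recurrent pol) :
    pexp (M.rollout pol N s) (fun τ => ‖levelAvg f τ j - pexp (M.statTrans pol hU) f‖ ^ 2)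
      ≤ 160 * (Cf * C) ^ 2 / 2 ^ j := by
  have h := pexp_sum_sub_sq_le hU hC0 hC hf (Nat.one_le_two_pow (n := j)) hs
  set fb := pexp (M.statTrans pol hU) f
  change pexp (M.rollout pol N s)
    (fun τ => ‖((2 : ℝ) ^ j)⁻¹ • ((τ.take (2 ^ j)).map f).sum - fb‖ ^ 2) ≤ _
  rw [M.pexp_rollout_take pol hj s fun τ => ‖((2 : ℝ) ^ j)⁻¹ • (τ.map f).sum - fb‖ ^ 2]
  have e : ∀ x : E, ‖((2 : ℝ) ^ j)⁻¹ • x - fb‖ ^ 2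
      = (((2 : ℝ) ^ j)⁻¹) ^ 2 * ‖x - ((2 ^ j : ℕ) : ℝ) • fb‖ ^ 2 := by
    intro x
    have : ((2 : ℝ) ^ j)⁻¹ • x - fb = ((2 : ℝ) ^ j)⁻¹ • (x - ((2 ^ j : ℕ) : ℝ) • fb) := by
      push_cast
      rw [smul_sub, smul_smul, inv_mul_cancel₀ (by positivity), one_smul]
    rw [this, norm_smul, norm_inv, norm_pow, Real.norm_ofNat, mul_pow]
  simp only [e]
  rw [pexp_mul_left]
  push_cast at h ⊢
  calc _ ≤ (((2 : ℝ) ^ j)⁻¹) ^ 2 * (160 * 2 ^ j * (Cf * C) ^ 2) := by gcongr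
    _ = _ := by field_simp

end Averages

/-! ### The multi-level Monte Carlo estimate -/

section MLMC

variable {S A : Type} [Fintype S] [Fintype A] {M : CMDP S A} {pol : Policy S A}
  {E : Type} [NormedAddCommGroup E] [InnerProductSpace ℝ E] [CompleteSpace E]

/-- The samples of one inner iteration from the state `s`. -/
def CMDP.iterLaw (M : CMDP S A) (pol : Policy S A) (Tmax : ℕ) (s : S) :
    PMF (ℕ × List (Transition S A)) :=
  geomHalf.bind fun Q => (M.rollout pol (mlmcLength Tmax Q) s).bind fun τ => PMF.pure (Q, τ)

theorem CMDP.mem_iterLaw {Tmax : ℕ} {s : S} {b : ℕ × List (Transition S A)}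
    (h : b ∈ (M.iterLaw pol Tmax s).support) :
    b.2 ∈ (M.rollout pol (mlmcLength Tmax b.1) s).support := by
  obtain ⟨Q, _, h⟩ := (PMF.mem_support_bind_iff _ _ _).1 h
  obtain ⟨τ, hτ, h⟩ := (PMF.mem_support_bind_iff _ _ _).1 h
  rw [(PMF.mem_support_pure_iff _ _).1 h]
  exact hτ

theorem CMDP.pexp_iterLaw {F' : Type*} [NormedAddCommGroup F'] [NormedSpace ℝ F']
    [CompleteSpace F'] {Tmax : ℕ} {s : S} {F : ℕ × List (Transition S A) → F'}
    (hF : PBdd (M.iterLaw pol Tmax s) F) :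
    pexp (M.iterLaw pol Tmax s) F
      = pexp geomHalf fun Q => pexp (M.rollout pol (mlmcLength Tmax Q) s) fun τ => F (Q, τ) := by
  rw [CMDP.iterLaw, pexp_bind hF]
  refine pexp_congr fun Q _ => ?_
  rw [pexp_bind_pure _ _ (M.pbdd_rollout pol _ _ _)]

theorem geomHalf_toReal (n : ℕ) : (geomHalf (n + 1)).toReal = (1 / 2) ^ (n + 1) := by
  change ENNReal.toReal (if n + 1 = 0 then 0 else (2 : ℝ≥0∞)⁻¹ ^ (n + 1)) = _
  simp

theorem geomHalf_zero : geomHalf 0 = 0 := by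
  change (if 0 = 0 then 0 else (2 : ℝ≥0∞)⁻¹ ^ 0) = 0
  simp

theorem pexp_geomHalf_ite {F' : Type*} [NormedAddCommGroup F'] [NormedSpace ℝ F'] {Tmax : ℕ}
    (hT : Tmax ≠ 0) (F : ℕ → F') :
    pexp geomHalf (fun Q => if 2 ^ Q ≤ Tmax then F Q else 0)
      = ∑ i ∈ Finset.range (Nat.log 2 Tmax), ((1 : ℝ) / 2) ^ (i + 1) • F (i + 1) := by
  unfold pexp
  rw [tsum_eq_sum (s := Finset.range (Nat.log 2 Tmax + 1)), Finset.sum_range_succ']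
  · simp only [geomHalf_zero, ENNReal.toReal_zero, zero_smul, add_zero]
    refine Finset.sum_congr rfl fun i hi => ?_
    rw [geomHalf_toReal, if_pos]
    exact (Nat.le_log_iff_pow_le (by norm_num) hT).1 (Finset.mem_range.1 hi)
  · intro Q hQ
    dsimp only
    rw [if_neg, smul_zero]
    rw [← Nat.le_log_iff_pow_le (by norm_num) hT]
    simpa [Nat.lt_succ_iff] using hQ

variable {C Cf : ℝ} {f : Transition S A → E}

theorem norm_levelAvg_le {E : Type} [NormedAddCommGroup E] [NormedSpace ℝ E]
    {f : Transition S A → E} {X : Set (Transition S A)} (hCf : 0 ≤ Cf) (hf : ∀ z ∈ X, ‖f z‖ ≤ Cf)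
    {τ : List (Transition S A)} (hτ : ∀ z ∈ τ, z ∈ X) (j : ℕ) : ‖levelAvg f τ j‖ ≤ Cf := by
  have h1 : ∀ τ : List (Transition S A), (∀ z ∈ τ, z ∈ X) →
      ‖(τ.map f).sum‖ ≤ τ.length * Cf := by
    intro τ hτ
    induction τ with
    | nil => simp
    | cons z τ ih =>
      simp only [List.map_cons, List.sum_cons, List.length_cons]
      have a := ih fun w hw => hτ w (List.mem_cons_of_mem _ hw)
      have b := hf z (hτ z List.mem_cons_self)
      push_cast
      linarith [norm_add_le (f z) (τ.map f).sum]
  have h2 := h1 (τ.take (2 ^ j)) fun z hz => hτ z (List.mem_of_mem_take hz)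
  have h3 : ((τ.take (2 ^ j)).length : ℝ) ≤ 2 ^ j := by
    exact_mod_cast List.length_take_le _ _
  rw [levelAvg, norm_smul, norm_inv, norm_pow, Real.norm_ofNat, inv_mul_le_iff₀ (by positivity)]
  exact h2.trans (by gcongr)

theorem norm_mlmc_le {E : Type} [NormedAddCommGroup E] [NormedSpace ℝ E]
    {f : Transition S A → E} {X : Set (Transition S A)} (hCf : 0 ≤ Cf) (hf : ∀ z ∈ X, ‖f z‖ ≤ Cf)
    {τ : List (Transition S A)} (hτ : ∀ z ∈ τ, z ∈ X) (Tmax Q : ℕ) :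
    ‖mlmc Tmax f Q τ‖ ≤ (1 + 2 * Tmax) * Cf := by
  have h0 := norm_levelAvg_le hCf hf hτ 0
  unfold mlmc
  split_ifs with h
  · have h1 := norm_levelAvg_le hCf hf hτ Q
    have h2 := norm_levelAvg_le hCf hf hτ (Q - 1)
    have hT : (2 : ℝ) ^ Q ≤ Tmax := by exact_mod_cast h
    refine (norm_add_le _ _).trans ?_
    rw [norm_smul, norm_pow, Real.norm_ofNat]
    have h3 : ‖levelAvg f τ Q - levelAvg f τ (Q - 1)‖ ≤ 2 * Cf := by
      linarith [norm_sub_le (levelAvg f τ Q) (levelAvg f τ (Q - 1))]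
    have h4 : (2 : ℝ) ^ Q * ‖levelAvg f τ Q - levelAvg f τ (Q - 1)‖ ≤ Tmax * (2 * Cf) := by gcongr
    linarith
  · rw [add_zero]
    nlinarith [Nat.cast_nonneg (α := ℝ) Tmax]

theorem pbdd_mlmc (hf : ∀ z ∈ M.recTrans pol, ‖f z‖ ≤ Cf) (hCf : 0 ≤ Cf) (Tmax : ℕ) {s : S}
    (hs : s ∈ M.recurrent pol) :
    PBdd (M.iterLaw pol Tmax s) fun b => mlmc Tmax f b.1 b.2 :=
  ⟨(1 + 2 * Tmax) * Cf, fun _ hb =>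
    norm_mlmc_le hCf hf (CMDP.recTrans_of_mem_rollout hs (CMDP.mem_iterLaw hb)).1 _ _⟩

theorem mlmcLength_of_le {Tmax Q : ℕ} (h : 2 ^ Q ≤ Tmax) : mlmcLength Tmax Q = 2 ^ Q := by
  rw [mlmcLength, if_pos h, Nat.sub_add_cancel Nat.one_le_two_pow]

theorem one_le_mlmcLength (Tmax Q : ℕ) : 1 ≤ mlmcLength Tmax Q := by
  rw [mlmcLength]; omega

/-- The estimate has the mean of the average at the highest admissible level: the expectation of
the correction at a random level telescopes. -/
theorem pexp_mlmc {Tmax : ℕ} (hT : Tmax ≠ 0) (hCf : 0 ≤ Cf)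
    (hf : ∀ z ∈ M.recTrans pol, ‖f z‖ ≤ Cf) {s : S} (hs : s ∈ M.recurrent pol) :
    pexp (M.iterLaw pol Tmax s) (fun b => mlmc Tmax f b.1 b.2)
      = pexp (M.rollout pol (2 ^ Nat.log 2 Tmax) s) fun τ => levelAvg f τ (Nat.log 2 Tmax) := by
  set a : ℕ → E := fun j => pexp (M.rollout pol (2 ^ j) s) fun τ => levelAvg f τ j with ha
  have hlev : ∀ {j N : ℕ}, 2 ^ j ≤ N → pexp (M.rollout pol N s) (fun τ => levelAvg f τ j) = a j :=
    fun h => by rw [ha, pexp_levelAvg M pol f h]; exact (pexp_levelAvg M pol f le_rfl s).symm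
  have e : ∀ Q, pexp (M.rollout pol (mlmcLength Tmax Q) s) (fun τ => mlmc Tmax f Q τ)
      = a 0 + if 2 ^ Q ≤ Tmax then (2 : ℝ) ^ Q • (a Q - a (Q - 1)) else 0 := by
    intro Q
    unfold mlmc
    rw [pexp_add (M.pbdd_rollout pol _ _ _) (M.pbdd_rollout pol _ _ _),
      hlev (one_le_mlmcLength Tmax Q)]
    congr 1
    split_ifs with h
    · rw [pexp_smul, pexp_sub (M.pbdd_rollout pol _ _ _) (M.pbdd_rollout pol _ _ _),
        mlmcLength_of_le h, hlev le_rfl, hlev (Nat.pow_le_pow_right (by norm_num) (Nat.sub_le _ _))]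
    · exact pexp_const _ _
  have hbd : PBdd geomHalf fun Q => if 2 ^ Q ≤ Tmax then (2 : ℝ) ^ Q • (a Q - a (Q - 1)) else 0 := by
    obtain ⟨D, hD⟩ := ((Finset.range (Nat.log 2 Tmax + 1)).finite_toSet.image
      fun Q => ‖(2 : ℝ) ^ Q • (a Q - a (Q - 1))‖).bddAbove
    refine ⟨max D 0, fun Q _ => ?_⟩
    dsimp only
    split_ifs with h
    · refine le_max_of_le_left (hD ⟨Q, ?_, rfl⟩)
      have := (Nat.le_log_iff_pow_le (by norm_num) hT).2 h
      simpa [Nat.lt_succ_iff] using this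
    · simp
  rw [CMDP.pexp_iterLaw (pbdd_mlmc hf hCf Tmax hs)]
  simp only [e]
  rw [pexp_add (PBdd.const _ _) hbd, pexp_const, pexp_geomHalf_ite hT]
  have e2 : ∀ i : ℕ, ((1 : ℝ) / 2) ^ (i + 1) • ((2 : ℝ) ^ (i + 1) • (a (i + 1) - a (i + 1 - 1)))
      = a (i + 1) - a i := fun i => by
    rw [smul_smul, ← mul_pow]; norm_num
  simp only [e2, Finset.sum_range_sub]
  rw [add_sub_cancel]

/-- The bias of the multi-level estimate. -/
theorem norm_pexp_mlmc_sub_le (hU : M.Unichain pol) (hC0 : 0 ≤ C)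
    (hC : M.targetTime pol ≤ ENNReal.ofReal C) {Tmax : ℕ} (hT : Tmax ≠ 0) (hCf : 0 ≤ Cf)
    (hf : ∀ z ∈ M.recTrans pol, ‖f z‖ ≤ Cf) {s : S} (hs : s ∈ M.recurrent pol) :
    ‖pexp (M.iterLaw pol Tmax s) (fun b => mlmc Tmax f b.1 b.2) - pexp (M.statTrans pol hU) f‖
      ≤ 8 * C / Tmax * Cf := by
  rw [pexp_mlmc hT hCf hf hs]
  refine (norm_pexp_levelAvg_sub_le hU hC0 hC hf le_rfl hs).trans ?_
  have h1 : (Tmax : ℝ) < 2 ^ Nat.log 2 Tmax * 2 := by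
    have := Nat.lt_pow_succ_log_self (b := 2) (by norm_num) Tmax
    rw [pow_succ] at this
    exact_mod_cast this
  have h2 : (0 : ℝ) < Tmax := by exact_mod_cast Nat.pos_of_ne_zero hT
  rw [div_mul_eq_mul_div, div_le_div_iff₀ (by positivity) h2]
  have : 0 ≤ Cf * C := mul_nonneg hCf hC0
  nlinarith

/-- The second moment of the multi-level estimate grows only logarithmically with `T_max`. -/
theorem pexp_mlmc_sq_le (hU : M.Unichain pol) (hC0 : 1 / 2 ≤ C)
    (hC : M.targetTime pol ≤ ENNReal.ofReal C) {Tmax : ℕ} (hT : 2 ≤ Tmax) (hCf : 0 ≤ Cf)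
    (hf : ∀ z ∈ M.recTrans pol, ‖f z‖ ≤ Cf) {s : S} (hs : s ∈ M.recurrent pol) :
    pexp (M.iterLaw pol Tmax s) (fun b => ‖mlmc Tmax f b.1 b.2‖ ^ 2)
      ≤ 3000 * C ^ 2 * Real.log Tmax * Cf ^ 2 := by
  have hT0 : Tmax ≠ 0 := by omega
  set fb := pexp (M.statTrans pol hU) f
  set J := Nat.log 2 Tmax
  have hQ : ∀ Q ∈ geomHalf.support, pexp (M.rollout pol (mlmcLength Tmax Q) s)
      (fun τ => ‖mlmc Tmax f Q τ‖ ^ 2)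
      ≤ 2 * Cf ^ 2 + if 2 ^ Q ≤ Tmax then 1920 * (Cf * C) ^ 2 * 2 ^ Q else 0 := by
    intro Q hQ0
    have hpt : ∀ τ ∈ (M.rollout pol (mlmcLength Tmax Q) s).support,
        ‖mlmc Tmax f Q τ‖ ^ 2 ≤ 2 * Cf ^ 2 + 2 *
          ‖if 2 ^ Q ≤ Tmax then (2 : ℝ) ^ Q • (levelAvg f τ Q - levelAvg f τ (Q - 1)) else 0‖ ^ 2 := by
      intro τ hτ
      have h0 := norm_levelAvg_le hCf hf (CMDP.recTrans_of_mem_rollout hs hτ).1 0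
      unfold mlmc
      set y := (if 2 ^ Q ≤ Tmax then (2 : ℝ) ^ Q • (levelAvg f τ Q - levelAvg f τ (Q - 1)) else 0)
      have h1 : ‖levelAvg f τ 0 + y‖ ≤ Cf + ‖y‖ := (norm_add_le _ _).trans (by gcongr)
      calc _ ≤ (Cf + ‖y‖) ^ 2 := by gcongr
        _ ≤ _ := by nlinarith [sq_nonneg (Cf - ‖y‖)]
    refine (pexp_mono (M.pbdd_rollout pol _ _ _) (M.pbdd_rollout pol _ _ _) hpt).trans ?_
    rw [pexp_add (M.pbdd_rollout pol _ _ _) (M.pbdd_rollout pol _ _ _), pexp_const, pexp_mul_left]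
    refine add_le_add le_rfl ?_
    split_ifs with h
    · obtain ⟨q, rfl⟩ : ∃ q, Q = q + 1 := by
        refine ⟨Q - 1, (Nat.succ_pred ?_).symm⟩
        rintro rfl
        exact hQ0 geomHalf_zero
      rw [mlmcLength_of_le h, Nat.add_sub_cancel]
      have hpt2 : ∀ τ ∈ (M.rollout pol (2 ^ (q + 1)) s).support,
          ‖(2 : ℝ) ^ (q + 1) • (levelAvg f τ (q + 1) - levelAvg f τ q)‖ ^ 2
          ≤ ((2 : ℝ) ^ (q + 1)) ^ 2 * (2 * ‖levelAvg f τ (q + 1) - fb‖ ^ 2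
            + 2 * ‖levelAvg f τ q - fb‖ ^ 2) := by
        intro τ _
        rw [norm_smul, mul_pow, norm_pow, Real.norm_ofNat]
        gcongr
        have e : levelAvg f τ (q + 1) - levelAvg f τ q
            = (levelAvg f τ (q + 1) - fb) - (levelAvg f τ q - fb) := by abel
        have h1 := norm_sub_le (levelAvg f τ (q + 1) - fb) (levelAvg f τ q - fb)
        rw [e]
        calc _ ≤ (‖levelAvg f τ (q + 1) - fb‖ + ‖levelAvg f τ q - fb‖) ^ 2 := by gcongr
          _ ≤ _ := by
            nlinarith [sq_nonneg (‖levelAvg f τ (q + 1) - fb‖ - ‖levelAvg f τ q - fb‖)]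
      have h1 := pexp_mono (M.pbdd_rollout pol _ _ _) (M.pbdd_rollout pol _ _ _) hpt2
      rw [pexp_mul_left, pexp_add (M.pbdd_rollout pol _ _ _) (M.pbdd_rollout pol _ _ _),
        pexp_mul_left, pexp_mul_left] at h1
      have h2 := pexp_levelAvg_sub_sq_le hU hC0 hC hf (le_refl (2 ^ (q + 1))) hs
      have h3 := pexp_levelAvg_sub_sq_le hU hC0 hC hf
        (Nat.pow_le_pow_right (n := 2) (by norm_num) (Nat.le_succ q)) hs
      have h4 : ((2 : ℝ) ^ (q + 1)) ^ 2 * (2 * (160 * (Cf * C) ^ 2 / 2 ^ (q + 1))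
          + 2 * (160 * (Cf * C) ^ 2 / 2 ^ q)) = 960 * (Cf * C) ^ 2 * 2 ^ (q + 1) := by
        field_simp
        ring
      have h5 : ((2 : ℝ) ^ (q + 1)) ^ 2 * (2 * pexp (M.rollout pol (2 ^ (q + 1)) s)
          (fun τ => ‖levelAvg f τ (q + 1) - fb‖ ^ 2) + 2 * pexp (M.rollout pol (2 ^ (q + 1)) s)
          (fun τ => ‖levelAvg f τ q - fb‖ ^ 2)) ≤ 960 * (Cf * C) ^ 2 * 2 ^ (q + 1) := by
        rw [← h4]; gcongr
      linarith
    · simp [pexp_const]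
  have hpb : PBdd geomHalf fun Q => if 2 ^ Q ≤ Tmax then 1920 * (Cf * C) ^ 2 * (2 : ℝ) ^ Q else 0 := by
    refine ⟨1920 * (Cf * C) ^ 2 * Tmax, fun Q _ => ?_⟩
    dsimp only
    split_ifs with h
    · rw [Real.norm_of_nonneg (by positivity)]
      gcongr
      exact_mod_cast h
    · rw [norm_zero]; positivity
  have hm := pbdd_mlmc hf hCf Tmax hs
  have hmono : pexp (M.iterLaw pol Tmax s) (fun b => ‖mlmc Tmax f b.1 b.2‖ ^ 2)
      ≤ pexp geomHalf fun Q => 2 * Cf ^ 2 +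
        if 2 ^ Q ≤ Tmax then 1920 * (Cf * C) ^ 2 * 2 ^ Q else 0 := by
    rw [CMDP.pexp_iterLaw hm.normSq]
    refine pexp_mono ⟨((1 + 2 * Tmax) * Cf) ^ 2, fun Q _ => norm_pexp_le_of_le fun τ hτ => ?_⟩
      ((PBdd.const _ _).add hpb) hQ
    rw [Real.norm_of_nonneg (by positivity)]
    gcongr
    exact norm_mlmc_le hCf hf (CMDP.recTrans_of_mem_rollout hs hτ).1 _ _
  refine hmono.trans ?_
  rw [pexp_add (PBdd.const _ _) hpb, pexp_const, pexp_geomHalf_ite hT0]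
  have e : ∀ i : ℕ, ((1 : ℝ) / 2) ^ (i + 1) • (1920 * (Cf * C) ^ 2 * (2 : ℝ) ^ (i + 1))
      = 1920 * (Cf * C) ^ 2 := fun i => by
    rw [smul_eq_mul, mul_comm, mul_assoc, ← mul_pow]; norm_num
  simp only [e, Finset.sum_const, Finset.card_range, nsmul_eq_mul]
  have hJ1 : (1 : ℝ) ≤ J := by
    exact_mod_cast Nat.log_pos (by norm_num) hT
  have hJ : (J : ℝ) * Real.log 2 ≤ Real.log Tmax := by
    rw [← Real.log_pow]
    refine Real.log_le_log (by positivity) ?_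
    exact_mod_cast Nat.pow_log_le_self 2 hT0
  have hl2 := Real.log_two_gt_d9
  have hJ3 : 1928 * (J : ℝ) ≤ 3000 * Real.log Tmax := by nlinarith
  have hC4 : 1 ≤ 4 * C ^ 2 := by nlinarith
  calc 2 * Cf ^ 2 + J * (1920 * (Cf * C) ^ 2)
      ≤ 8 * (Cf ^ 2 * C ^ 2) * J + J * (1920 * (Cf * C) ^ 2) := by
        have : 2 * Cf ^ 2 ≤ 8 * (Cf ^ 2 * C ^ 2) := by nlinarith [sq_nonneg Cf]
        have h8 : 0 ≤ 8 * (Cf ^ 2 * C ^ 2) := by positivity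
        nlinarith
    _ = (1928 * J) * (C ^ 2 * Cf ^ 2) := by ring
    _ ≤ (3000 * Real.log Tmax) * (C ^ 2 * Cf ^ 2) := by gcongr
    _ = _ := by ring

end MLMC

/-! ### Stochastic approximation with multi-level estimates -/

section Blocks

variable {S A : Type} [Fintype S] [Fintype A] {M : CMDP S A} {pol : Policy S A} {Tmax : ℕ}

theorem CMDP.blocksLaw_succ (M : CMDP S A) (pol : Policy S A) (Tmax h : ℕ) (s : S) :
    M.blocksLaw pol Tmax (h + 1) s = (M.iterLaw pol Tmax s).bind fun b =>
      (M.blocksLaw pol Tmax h (endState s b.2)).bind fun bs => PMF.pure (b :: bs) := by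
  simp [CMDP.blocksLaw, CMDP.iterLaw, PMF.bind_bind, PMF.pure_bind]

/-- The last iteration, instead of the first one, is split off. -/
theorem CMDP.blocksLaw_succ_last (M : CMDP S A) (pol : Policy S A) (Tmax h : ℕ) (s : S) :
    M.blocksLaw pol Tmax (h + 1) s = (M.blocksLaw pol Tmax h s).bind fun bs =>
      (M.iterLaw pol Tmax (blocksEnd s bs)).bind fun b => PMF.pure (bs ++ [b]) := by
  induction h generalizing s with
  | zero =>
    rw [CMDP.blocksLaw_succ]
    simp [CMDP.blocksLaw, PMF.pure_bind, blocksEnd]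
  | succ h ih =>
    rw [CMDP.blocksLaw_succ, CMDP.blocksLaw_succ]
    simp only [ih, PMF.bind_bind, PMF.pure_bind, List.cons_append]
    rfl

theorem CMDP.mem_blocksLaw {h : ℕ} {s : S} {bs : List (ℕ × List (Transition S A))}
    (hs : s ∈ M.recurrent pol) (hbs : bs ∈ (M.blocksLaw pol Tmax h s).support) :
    (∀ b ∈ bs, ∀ z ∈ b.2, z ∈ M.recTrans pol) ∧ blocksEnd s bs ∈ M.recurrent pol := by
  induction h generalizing s bs with
  | zero =>
    rw [(PMF.mem_support_pure_iff _ _).1 hbs]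
    exact ⟨by simp, hs⟩
  | succ h ih =>
    rw [CMDP.blocksLaw_succ] at hbs
    obtain ⟨b, hb, hbs⟩ := (PMF.mem_support_bind_iff _ _ _).1 hbs
    obtain ⟨bs', hbs', hbs⟩ := (PMF.mem_support_bind_iff _ _ _).1 hbs
    rw [(PMF.mem_support_pure_iff _ _).1 hbs]
    obtain ⟨h1, h2⟩ := CMDP.recTrans_of_mem_rollout hs (CMDP.mem_iterLaw hb)
    obtain ⟨h3, h4⟩ := ih h2 hbs'
    refine ⟨fun c hc => ?_, h4⟩
    rcases List.mem_cons.1 hc with rfl | hc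
    · exact h1
    · exact h3 c hc

theorem CMDP.length_of_mem_blocksLaw {h : ℕ} {s : S} {bs : List (ℕ × List (Transition S A))}
    (hbs : bs ∈ (M.blocksLaw pol Tmax h s).support) : bs.length = h := by
  induction h generalizing s bs with
  | zero => rw [(PMF.mem_support_pure_iff _ _).1 hbs]; rfl
  | succ h ih =>
    rw [CMDP.blocksLaw_succ] at hbs
    obtain ⟨b, hb, hbs⟩ := (PMF.mem_support_bind_iff _ _ _).1 hbs
    obtain ⟨bs', hbs', hbs⟩ := (PMF.mem_support_bind_iff _ _ _).1 hbs
    rw [(PMF.mem_support_pure_iff _ _).1 hbs, List.length_cons, ih hbs']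

theorem CMDP.mem_blocksLaw_append {h : ℕ} {s : S} {bs : List (ℕ × List (Transition S A))}
    {b : ℕ × List (Transition S A)} (hbs : bs ∈ (M.blocksLaw pol Tmax h s).support)
    (hb : b ∈ (M.iterLaw pol Tmax (blocksEnd s bs)).support) :
    bs ++ [b] ∈ (M.blocksLaw pol Tmax (h + 1) s).support := by
  rw [CMDP.blocksLaw_succ_last, PMF.mem_support_bind_iff]
  exact ⟨bs, hbs, (PMF.mem_support_bind_iff _ _ _).2 ⟨b, hb, by simp⟩⟩

theorem CMDP.pexp_blocksLaw_succ {E : Type*} [NormedAddCommGroup E] [NormedSpace ℝ E]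
    [CompleteSpace E] {h : ℕ} {s : S} {F : List (ℕ × List (Transition S A)) → E}
    (hF : PBdd (M.blocksLaw pol Tmax (h + 1) s) F) :
    pexp (M.blocksLaw pol Tmax (h + 1) s) F = pexp (M.blocksLaw pol Tmax h s) fun bs =>
      pexp (M.iterLaw pol Tmax (blocksEnd s bs)) fun b => F (bs ++ [b]) := by
  obtain ⟨C, hC⟩ := hF
  have hF' : PBdd ((M.blocksLaw pol Tmax h s).bind fun bs =>
      (M.iterLaw pol Tmax (blocksEnd s bs)).bind fun b => PMF.pure (bs ++ [b])) F := by
    rw [← CMDP.blocksLaw_succ_last]; exact ⟨C, hC⟩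
  rw [CMDP.blocksLaw_succ_last, pexp_bind hF']
  refine pexp_congr fun bs hbs => ?_
  rw [pexp_bind_pure]
  exact ⟨C, fun b hb => hC _ (CMDP.mem_blocksLaw_append hbs hb)⟩

end Blocks

section SGD

variable {S A : Type} [Fintype S] [Fintype A] {M : CMDP S A} {pol : Policy S A}
  {E : Type} [NormedAddCommGroup E] [InnerProductSpace ℝ E] [CompleteSpace E]

/-- The iterates of stochastic approximation with the multi-level estimates of the direction
field `u`. -/
def sgd (γ : ℝ) (Tmax : ℕ) (u : E → Transition S A → E) (x₀ : E)
    (bs : List (ℕ × List (Transition S A))) : E :=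
  bs.foldl (fun x b => x - γ • mlmc Tmax (u x) b.1 b.2) x₀

theorem sgd_append (γ : ℝ) (Tmax : ℕ) (u : E → Transition S A → E) (x₀ : E)
    (bs : List (ℕ × List (Transition S A))) (b : ℕ × List (Transition S A)) :
    sgd γ Tmax u x₀ (bs ++ [b])
      = sgd γ Tmax u x₀ bs - γ • mlmc Tmax (u (sgd γ Tmax u x₀ bs)) b.1 b.2 := by
  simp [sgd, List.foldl_append]

/-- The direction field `u` has at stationarity the linear mean `x ↦ D (x - xs)`, where `D` is
`κ`-coercive, and grows at most linearly with slope `L`. The radius `r` bounds the distance of the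
root `xs` from the initial point `0` as well as the noise at the root. -/
structure LinearOracle (M : CMDP S A) (pol : Policy S A) (hU : M.Unichain pol)
    (u : E → Transition S A → E) (xs : E) (D : E →L[ℝ] E) (L κ r : ℝ) : Prop where
  bound : ∀ x, ∀ z ∈ M.recTrans pol, ‖u x z‖ ≤ L * (‖x - xs‖ + r)
  mean : ∀ x, pexp (M.statTrans pol hU) (u x) = D (x - xs)
  coercive : ∀ y, κ * ‖y‖ ^ 2 ≤ inner ℝ y (D y)
  norm_le : ∀ y, ‖D y‖ ≤ L * ‖y‖
  pos : 0 < κ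
  le : κ ≤ L
  norm_root : ‖xs‖ ≤ r

/-- The step size and the truncation level are admissible for the linear problem. -/
structure StepCond (C : ℝ) (Tmax : ℕ) (γ L κ : ℝ) : Prop where
  two_le : 2 ≤ Tmax
  nonneg : 0 ≤ γ
  bias : 8 * C / Tmax * L ≤ κ / 16
  noise : γ * (3000 * C ^ 2 * Real.log Tmax) * L ^ 2 ≤ κ / 16

variable {hU : M.Unichain pol} {u : E → Transition S A → E} {xs : E} {D : E →L[ℝ] E}
  {L κ r C γ : ℝ} {Tmax : ℕ}

theorem LinearOracle.radius_nonneg (h : LinearOracle M pol hU u xs D L κ r) : 0 ≤ r :=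
  (norm_nonneg _).trans h.norm_root

theorem LinearOracle.slope_pos (h : LinearOracle M pol hU u xs D L κ r) : 0 < L :=
  h.pos.trans_le h.le

theorem LinearOracle.noise_nonneg (h : LinearOracle M pol hU u xs D L κ r) (x : E) :
    0 ≤ L * (‖x - xs‖ + r) :=
  mul_nonneg h.slope_pos.le (add_nonneg (norm_nonneg _) h.radius_nonneg)

theorem StepCond.mul_sq_le (hγ : StepCond C Tmax γ L κ) (hC : 1 / 2 ≤ C) (hκ : 0 < κ) :
    γ * L ^ 2 ≤ κ := by
  have h2 : (2 : ℝ) ≤ Tmax := by exact_mod_cast hγ.two_le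
  have hl : Real.log 2 ≤ Real.log Tmax := Real.log_le_log (by norm_num) h2
  have := Real.log_two_gt_d9
  have hV : 1 ≤ 3000 * C ^ 2 * Real.log Tmax := by nlinarith
  have h0 : 0 ≤ γ * L ^ 2 := mul_nonneg hγ.nonneg (sq_nonneg _)
  nlinarith [hγ.noise]

theorem StepCond.mul_le_one (hγ : StepCond C Tmax γ L κ) (hC : 1 / 2 ≤ C) (hκ : 0 < κ)
    (hκL : κ ≤ L) : γ * κ ≤ 1 := by
  have h1 := hγ.mul_sq_le hC hκ
  have h2 : γ * κ ^ 2 ≤ γ * L ^ 2 := by gcongr; exact hγ.nonneg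
  by_contra! h
  nlinarith

/-- The drift of the squared distance to the root in one iteration. -/
theorem LinearOracle.pexp_step_sq (h : LinearOracle M pol hU u xs D L κ r)
    (hγ : StepCond C Tmax γ L κ) (hC0 : 1 / 2 ≤ C)
    (hC : M.targetTime pol ≤ ENNReal.ofReal C) (x : E) {s : S} (hs : s ∈ M.recurrent pol) :
    pexp (M.iterLaw pol Tmax s) (fun b => ‖x - γ • mlmc Tmax (u x) b.1 b.2 - xs‖ ^ 2)
      ≤ (1 - γ * κ) * ‖x - xs‖ ^ 2 + γ * κ * r ^ 2 := by
  have hT := hγ.two_le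
  have hγ0 := hγ.nonneg
  have hr := h.radius_nonneg
  have hCf := h.noise_nonneg x
  have hb := pbdd_mlmc (h.bound x) hCf Tmax hs
  have hbias := norm_pexp_mlmc_sub_le hU (by linarith) hC (by omega : Tmax ≠ 0) hCf (h.bound x) hs
  have hsq := pexp_mlmc_sq_le hU hC0 hC hT hCf (h.bound x) hs
  rw [h.mean] at hbias
  set m := fun b : ℕ × List (Transition S A) => mlmc Tmax (u x) b.1 b.2 with hm
  set y := x - xs with hy
  have e : ∀ b, ‖x - γ • m b - xs‖ ^ 2
      = ‖y‖ ^ 2 - (2 * γ) * inner ℝ y (m b) + γ ^ 2 * ‖m b‖ ^ 2 := by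
    intro b
    rw [show x - γ • m b - xs = y - γ • m b by rw [hy]; abel, norm_sub_sq_real, inner_smul_right,
      norm_smul, mul_pow, Real.norm_eq_abs, sq_abs]
    ring
  have hin : pexp (M.iterLaw pol Tmax s) (fun b => inner ℝ y (m b))
      = inner ℝ y (pexp (M.iterLaw pol Tmax s) m) := by
    have := pexp_clm hb (innerSL ℝ y)
    simpa only [innerSL_apply_apply] using this
  have hpi : PBdd (M.iterLaw pol Tmax s) fun b => inner ℝ y (m b) := by
    have := hb.clm (innerSL ℝ y)
    simpa only [innerSL_apply_apply] using this
  change pexp (M.iterLaw pol Tmax s) (fun b => ‖x - γ • m b - xs‖ ^ 2) ≤ _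
  simp only [e]
  rw [pexp_add ((PBdd.const _ _).sub (hpi.const_mul _)) (hb.normSq.const_mul _),
    pexp_sub (PBdd.const _ _) (hpi.const_mul _), pexp_const, pexp_mul_left, pexp_mul_left, hin]
  set w := pexp (M.iterLaw pol Tmax s) m
  have h1 : κ * ‖y‖ ^ 2 - ‖y‖ * (8 * C / Tmax * (L * (‖y‖ + r))) ≤ inner ℝ y w := by
    have e1 : inner ℝ y w = inner ℝ y (D y) + inner ℝ y (w - D y) := by
      rw [← inner_add_right]; congr 1; abel
    have e2 : -(‖y‖ * ‖w - D y‖) ≤ inner ℝ y (w - D y) :=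
      neg_le_of_abs_le (abs_real_inner_le_norm _ _)
    have e3 : ‖y‖ * ‖w - D y‖ ≤ ‖y‖ * (8 * C / Tmax * (L * (‖y‖ + r))) := by gcongr
    have := h.coercive y
    linarith
  have h2 : ‖y‖ * (8 * C / Tmax * (L * (‖y‖ + r))) ≤ κ / 16 * (‖y‖ * (‖y‖ + r)) := by
    calc _ = (8 * C / Tmax * L) * (‖y‖ * (‖y‖ + r)) := by ring
      _ ≤ _ := mul_le_mul_of_nonneg_right hγ.bias
        (mul_nonneg (norm_nonneg _) (add_nonneg (norm_nonneg _) hr))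
  have h3 : γ ^ 2 * pexp (M.iterLaw pol Tmax s) (fun b => ‖m b‖ ^ 2)
      ≤ γ * (κ / 16 * (‖y‖ + r) ^ 2) := by
    calc _ ≤ γ ^ 2 * (3000 * C ^ 2 * Real.log Tmax * (L * (‖y‖ + r)) ^ 2) := by gcongr
      _ = γ * ((γ * (3000 * C ^ 2 * Real.log Tmax) * L ^ 2) * (‖y‖ + r) ^ 2) := by ring
      _ ≤ _ := by
        gcongr
        exact hγ.noise
  have h4 : (2 * γ) * (κ * ‖y‖ ^ 2 - κ / 16 * (‖y‖ * (‖y‖ + r))) ≤ (2 * γ) * inner ℝ y w := by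
    gcongr; linarith
  have h5 : 0 ≤ γ * κ := mul_nonneg hγ0 h.pos.le
  have h6 : ‖y‖ * r ≤ (‖y‖ ^ 2 + r ^ 2) / 2 := by nlinarith [sq_nonneg (‖y‖ - r)]
  have h7 := mul_le_mul_of_nonneg_left h6 h5
  have h8 := mul_nonneg h5 (sq_nonneg ‖y‖)
  have h9 := mul_nonneg h5 (sq_nonneg r)
  nlinarith

/-- One exact step contracts the distance to the root. -/
theorem LinearOracle.norm_sub_smul_le (h : LinearOracle M pol hU u xs D L κ r)
    (hγ : StepCond C Tmax γ L κ) (hC0 : 1 / 2 ≤ C) (y : E) :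
    ‖y - γ • D y‖ ≤ (1 - γ * κ / 2) * ‖y‖ := by
  have h1 := hγ.mul_le_one hC0 h.pos h.le
  have h2 := hγ.mul_sq_le hC0 h.pos
  have h3 := h.coercive y
  have h4 := h.norm_le y
  have hγ0 := hγ.nonneg
  refine le_of_sq_le_sq ?_ (mul_nonneg (by linarith) (norm_nonneg _))
  rw [norm_sub_sq_real, inner_smul_right, norm_smul, Real.norm_of_nonneg hγ0]
  have h5 : (γ * ‖D y‖) ^ 2 ≤ γ * (κ * ‖y‖ ^ 2) := by
    calc (γ * ‖D y‖) ^ 2 ≤ (γ * (L * ‖y‖)) ^ 2 := by gcongr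
      _ = γ * ((γ * L ^ 2) * ‖y‖ ^ 2) := by ring
      _ ≤ _ := by gcongr
  have h6 := mul_le_mul_of_nonneg_left h3 hγ0
  nlinarith [sq_nonneg (γ * κ * ‖y‖)]

theorem LinearOracle.pbdd_sgd (h : LinearOracle M pol hU u xs D L κ r)
    (hγ : 0 ≤ γ) (n : ℕ) {s : S} (hs : s ∈ M.recurrent pol) :
    PBdd (M.blocksLaw pol Tmax n s) fun bs => sgd γ Tmax u 0 bs - xs := by
  induction n with
  | zero =>
    refine ⟨‖xs‖, fun bs hbs => ?_⟩
    rw [(PMF.mem_support_pure_iff _ _).1 hbs]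
    simp [sgd]
  | succ n ih =>
    obtain ⟨B, hB0, hB⟩ := ih.exists_nonneg
    refine ⟨B + γ * ((1 + 2 * Tmax) * (L * (B + r))), fun bs hbs => ?_⟩
    rw [CMDP.blocksLaw_succ_last] at hbs
    obtain ⟨bs', hbs', hbs⟩ := (PMF.mem_support_bind_iff _ _ _).1 hbs
    obtain ⟨b, hb, hbs⟩ := (PMF.mem_support_bind_iff _ _ _).1 hbs
    rw [(PMF.mem_support_pure_iff _ _).1 hbs]
    dsimp only
    rw [sgd_append]
    set x := sgd γ Tmax u 0 bs'
    have h1 := hB bs' hbs'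
    have h2 := norm_mlmc_le (h.noise_nonneg x) (h.bound x) (CMDP.recTrans_of_mem_rollout
      (CMDP.mem_blocksLaw hs hbs').2 (CMDP.mem_iterLaw hb)).1 Tmax b.1
    have h3 := h.slope_pos
    rw [show x - γ • mlmc Tmax (u x) b.1 b.2 - xs = (x - xs) - γ • mlmc Tmax (u x) b.1 b.2 by abel]
    refine (norm_sub_le _ _).trans (add_le_add h1 ?_)
    rw [norm_smul, Real.norm_of_nonneg hγ]
    gcongr
    exact h2.trans (by gcongr)

/-- The mean squared distance to the root never exceeds the squared radius. -/
theorem LinearOracle.pexp_sgd_sq (h : LinearOracle M pol hU u xs D L κ r)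
    (hγ : StepCond C Tmax γ L κ) (hC0 : 1 / 2 ≤ C)
    (hC : M.targetTime pol ≤ ENNReal.ofReal C) (n : ℕ) {s : S} (hs : s ∈ M.recurrent pol) :
    pexp (M.blocksLaw pol Tmax n s) (fun bs => ‖sgd γ Tmax u 0 bs - xs‖ ^ 2) ≤ r ^ 2 := by
  induction n with
  | zero =>
    rw [CMDP.blocksLaw, pexp_pure]
    simp only [sgd, List.foldl_nil, zero_sub, norm_neg]
    have := h.norm_root
    gcongr
  | succ n ih =>
    have hb := h.pbdd_sgd (Tmax := Tmax) hγ.nonneg n hs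
    have hκ := hγ.mul_le_one hC0 h.pos h.le
    rw [CMDP.pexp_blocksLaw_succ (h.pbdd_sgd hγ.nonneg (n + 1) hs).normSq]
    simp only [sgd_append]
    have hub := (hb.normSq.const_mul (1 - γ * κ)).add (PBdd.const _ (γ * κ * r ^ 2))
    have hle : ∀ bs ∈ (M.blocksLaw pol Tmax n s).support,
        pexp (M.iterLaw pol Tmax (blocksEnd s bs)) (fun b => ‖sgd γ Tmax u 0 bs
          - γ • mlmc Tmax (u (sgd γ Tmax u 0 bs)) b.1 b.2 - xs‖ ^ 2)
        ≤ (1 - γ * κ) * ‖sgd γ Tmax u 0 bs - xs‖ ^ 2 + γ * κ * r ^ 2 := fun bs hbs =>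
      h.pexp_step_sq hγ hC0 hC _ (CMDP.mem_blocksLaw hs hbs).2
    refine (pexp_mono (hub.mono fun bs hbs => ?_) hub hle).trans ?_
    · rw [Real.norm_of_nonneg (pexp_nonneg fun _ _ => by positivity)]
      exact (hle bs hbs).trans (le_abs_self _)
    · rw [pexp_add (hb.normSq.const_mul _) (PBdd.const _ _), pexp_mul_left, pexp_const]
      nlinarith

theorem LinearOracle.pexp_sgd_norm (h : LinearOracle M pol hU u xs D L κ r)
    (hγ : StepCond C Tmax γ L κ) (hC0 : 1 / 2 ≤ C)
    (hC : M.targetTime pol ≤ ENNReal.ofReal C) (n : ℕ) {s : S} (hs : s ∈ M.recurrent pol) :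
    pexp (M.blocksLaw pol Tmax n s) (fun bs => ‖sgd γ Tmax u 0 bs - xs‖) ≤ r :=
  le_of_sq_le_sq ((pexp_sq_le (h.pbdd_sgd hγ.nonneg n hs).norm).trans
    (h.pexp_sgd_sq hγ hC0 hC n hs)) h.radius_nonneg

/-- The mean error follows the exact contraction up to the accumulated bias of the estimates. -/
theorem LinearOracle.norm_pexp_sgd_le (h : LinearOracle M pol hU u xs D L κ r)
    (hγ : StepCond C Tmax γ L κ) (hC0 : 1 / 2 ≤ C)
    (hC : M.targetTime pol ≤ ENNReal.ofReal C) (n : ℕ) {s : S} (hs : s ∈ M.recurrent pol) :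
    ‖pexp (M.blocksLaw pol Tmax n s) (fun bs => sgd γ Tmax u 0 bs - xs)‖
      ≤ (1 - γ * κ / 2) ^ n * r + 4 * (8 * C / Tmax * L) * r / κ := by
  have hr := h.radius_nonneg
  have hκ0 := h.pos
  have hL := h.slope_pos
  have hT : (0 : ℝ) < Tmax := by
    have := hγ.two_le
    exact_mod_cast (by omega : 0 < Tmax)
  induction n with
  | zero =>
    rw [CMDP.blocksLaw, pexp_pure]
    simp only [sgd, List.foldl_nil, zero_sub, norm_neg, pow_zero, one_mul]
    exact h.norm_root.trans (le_add_of_nonneg_right (by positivity))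
  | succ n ih =>
    set P := M.blocksLaw pol Tmax n s
    set X := fun bs : List (ℕ × List (Transition S A)) => sgd γ Tmax u 0 bs with hX
    set δ := 8 * C / Tmax * L with hδ
    have hδ0 : 0 ≤ δ := by positivity
    have hb : PBdd P fun bs => X bs - xs := h.pbdd_sgd hγ.nonneg n hs
    have hκ := hγ.mul_le_one hC0 h.pos h.le
    rw [CMDP.pexp_blocksLaw_succ (h.pbdd_sgd hγ.nonneg (n + 1) hs)]
    simp only [sgd_append]
    have hin : ∀ bs ∈ P.support, pexp (M.iterLaw pol Tmax (blocksEnd s bs)) (fun b => X bs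
          - γ • mlmc Tmax (u (X bs)) b.1 b.2 - xs)
        = ((X bs - xs) - γ • D (X bs - xs)) + γ • (D (X bs - xs)
          - pexp (M.iterLaw pol Tmax (blocksEnd s bs)) fun b => mlmc Tmax (u (X bs)) b.1 b.2) := by
      intro bs hbs
      have hm := pbdd_mlmc (h.bound (X bs)) (h.noise_nonneg (X bs)) Tmax
        (CMDP.mem_blocksLaw hs hbs).2
      rw [pexp_sub ((PBdd.const _ _).sub (hm.const_smul _)) (PBdd.const _ _),
        pexp_sub (PBdd.const _ _) (hm.const_smul _), pexp_const, pexp_const, pexp_smul, smul_sub]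
      abel
    have herr : ∀ bs ∈ P.support, ‖γ • (D (X bs - xs)
          - pexp (M.iterLaw pol Tmax (blocksEnd s bs)) fun b => mlmc Tmax (u (X bs)) b.1 b.2)‖
        ≤ (γ * δ) * (‖X bs - xs‖ + r) := by
      intro bs hbs
      have := norm_pexp_mlmc_sub_le hU (by linarith) hC (by have := hγ.two_le; omega : Tmax ≠ 0)
        (h.noise_nonneg (X bs)) (h.bound (X bs)) (CMDP.mem_blocksLaw hs hbs).2
      rw [h.mean, norm_sub_rev] at this
      rw [norm_smul, Real.norm_of_nonneg hγ.nonneg, mul_assoc]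
      refine mul_le_mul_of_nonneg_left (this.trans_eq ?_) hγ.nonneg
      rw [hδ]; ring
    have hub : PBdd P fun bs => (γ * δ) * (‖X bs - xs‖ + r) :=
      (hb.norm.add (PBdd.const _ r)).const_mul _
    have heb := hub.mono fun bs hbs => (herr bs hbs).trans (le_abs_self _)
    rw [pexp_congr hin, pexp_add (hb.sub ((hb.clm D).const_smul γ)) heb,
      pexp_sub hb ((hb.clm D).const_smul γ), pexp_smul, pexp_clm hb]
    have h1 := h.norm_sub_smul_le hγ hC0 (pexp P fun bs => X bs - xs)
    have h2 := norm_pexp_le_pexp hub herr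
    rw [pexp_mul_left, pexp_add hb.norm (PBdd.const _ _), pexp_const] at h2
    have h3 : pexp P (fun bs => ‖X bs - xs‖) ≤ r := h.pexp_sgd_norm hγ hC0 hC n hs
    have h4 : γ * δ * (pexp P (fun bs => ‖X bs - xs‖) + r) ≤ γ * δ * (r + r) := by
      have := mul_nonneg hγ.nonneg hδ0
      gcongr
    have h5 : (1 - γ * κ / 2) * ‖pexp P fun bs => X bs - xs‖
        ≤ (1 - γ * κ / 2) * ((1 - γ * κ / 2) ^ n * r + 4 * δ * r / κ) :=
      mul_le_mul_of_nonneg_left ih (by linarith)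
    have e : (1 - γ * κ / 2) * ((1 - γ * κ / 2) ^ n * r + 4 * δ * r / κ) + γ * δ * (r + r)
        = (1 - γ * κ / 2) ^ (n + 1) * r + 4 * δ * r / κ := by
      field_simp
      ring
    rw [← e]
    refine (norm_add_le _ _).trans ?_
    linarith

theorem one_sub_pow_le_inv_sq {x : ℝ} {H T : ℕ} (hT : 2 ≤ T) (hx1 : x ≤ 1)
    (hx : 2 * Real.log T ≤ x * H) : (1 - x) ^ H ≤ 1 / (T : ℝ) ^ 2 := by
  have hT0 : (0 : ℝ) < T := by exact_mod_cast (by omega : 0 < T)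
  calc (1 - x) ^ H ≤ Real.exp (-x) ^ H := by
        have := Real.add_one_le_exp (-x)
        gcongr
        linarith
    _ = Real.exp (-(x * H)) := by rw [← Real.exp_nat_mul]; ring_nf
    _ ≤ Real.exp (-(2 * Real.log T)) := by gcongr
    _ = 1 / (T : ℝ) ^ 2 := by
      rw [Real.exp_neg, mul_comm, Real.exp_mul, Real.exp_log hT0, one_div]
      norm_num

end SGD

/-! ### The value function -/

section Value

variable {S A : Type} [Fintype S] [Fintype A] {M : CMDP S A} {pol : Policy S A}

theorem CMDP.abs_signal_le (M : CMDP S A) (g : Signal) (s : S) (a : A) : |M.signal g s a| ≤ 1 := by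
  cases g with
  | reward => exact abs_le.2 ⟨(by norm_num : (-1 : ℝ) ≤ 0).trans (M.r_mem s a).1, (M.r_mem s a).2⟩
  | cost => exact abs_le.2 (M.c_mem s a)

theorem sum_prob (pol : Policy S A) (s : S) : ∑ a, prob pol s a = 1 := sum_toReal_pmf _

theorem CMDP.avgReward_eq_pexp (hU : M.Unichain pol) (g : Signal) :
    M.avgReward pol g = pexp (M.statTrans pol hU) fun z => M.signal g z.1 z.2.1 := by
  rw [CMDP.avgReward_eq hU, CMDP.pexp_statTrans]
  refine Finset.sum_congr rfl fun s _ => ?_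
  rw [CMDP.pexp_transLaw, smul_eq_mul]
  congr 1
  refine Finset.sum_congr rfl fun a _ => ?_
  simp only [smul_eq_mul, ← Finset.sum_mul, sum_toReal_pmf, one_mul]

theorem CMDP.abs_avgReward_le (hU : M.Unichain pol) (g : Signal) : |M.avgReward pol g| ≤ 1 := by
  rw [CMDP.avgReward_eq_pexp hU, ← Real.norm_eq_abs]
  exact norm_pexp_le_of_le fun z _ => M.abs_signal_le g z.1 z.2.1

theorem CMDP.exists_isActionValue (hU : M.Unichain pol) (g : Signal) :
    ∃ Q, M.IsActionValue pol g Q := by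
  obtain ⟨h, hP, h0⟩ := CMDP.exists_poisson hU fun s => ∑ a, prob pol s a * M.signal g s a
  have hJ : M.avgReward pol g = ∑ t, M.statDist pol t • ∑ a, prob pol t a * M.signal g t a :=
    CMDP.avgReward_eq hU g
  rw [← hJ] at hP
  set Q : S → A → ℝ := fun s a =>
    M.signal g s a - M.avgReward pol g + ∑ s', (M.P s a s').toReal * h s' with hQ
  have hV : stateValue pol Q = h := by
    funext s
    have h1 : ∑ s', M.stepR pol s s' • h s'
        = ∑ a, prob pol s a * ∑ s', (M.P s a s').toReal * h s' := by
      rw [← M.pexp_transLaw_snd pol s h, CMDP.pexp_transLaw]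
      rfl
    have h2 := hP s
    rw [h1] at h2
    simp only [stateValue, hQ, mul_add, mul_sub, Finset.sum_add_distrib, Finset.sum_sub_distrib]
    rw [← Finset.sum_mul, sum_prob, one_mul]
    linarith
  exact ⟨Q, fun s a => by rw [hV], by rw [hV]; exact h0⟩

theorem CMDP.value_bellman (hU : M.Unichain pol) (g : Signal) (s : S) :
    pexp (M.transLaw pol s) (fun z => M.signal g z.1 z.2.1 - M.avgReward pol g
      + M.value pol g z.2.2 - M.value pol g z.1) = 0 := by
  have hQ := Classical.epsilon_spec (CMDP.exists_isActionValue hU g)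
  set Q := Classical.epsilon (M.IsActionValue pol g)
  have hV : M.value pol g = stateValue pol Q := rfl
  have e : M.value pol g s = ∑ a, prob pol s a * (M.signal g s a - M.avgReward pol g
      + ∑ s', (M.P s a s').toReal * M.value pol g s') := by
    conv_lhs => rw [hV, stateValue]
    exact Finset.sum_congr rfl fun a _ => by rw [hQ.1 s a, hV]
  rw [CMDP.pexp_transLaw]
  simp only [smul_eq_mul, mul_sub, mul_add, Finset.sum_sub_distrib, Finset.sum_add_distrib] at e ⊢
  simp only [← Finset.sum_mul, sum_toReal_pmf, sum_prob, one_mul] at e ⊢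
  linarith

theorem CMDP.value_mean (hU : M.Unichain pol) (g : Signal) :
    ∑ s, M.statDist pol s * M.value pol g s = 0 :=
  (Classical.epsilon_spec (CMDP.exists_isActionValue hU g)).2

theorem CMDP.value_poisson (hU : M.Unichain pol) (g : Signal) (s : S) :
    M.value pol g s - ∑ s', M.stepR pol s s' * M.value pol g s'
      = pexp (M.transLaw pol s) (fun z => M.signal g z.1 z.2.1) - M.avgReward pol g := by
  have h := CMDP.value_bellman hU g s
  rw [pexp_congr (g := fun z => M.signal g z.1 z.2.1 - M.avgReward pol g
      + M.value pol g z.2.2 - M.value pol g s) fun z hz => by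
      rw [CMDP.fst_of_mem_transLaw hz],
    pexp_sub (PBdd.of_finite _ _) (PBdd.of_finite _ _),
    pexp_add (PBdd.of_finite _ _) (PBdd.of_finite _ _),
    pexp_sub (PBdd.of_finite _ _) (PBdd.of_finite _ _), pexp_const, pexp_const,
    CMDP.pexp_transLaw_snd] at h
  simp only [smul_eq_mul] at h
  linarith

theorem CMDP.abs_value_le (hU : M.Unichain pol) (g : Signal) {C : ℝ} (hC0 : 0 ≤ C)
    (hC : M.targetTime pol ≤ ENNReal.ofReal C) {s : S} (hs : s ∈ M.recurrent pol) :
    |M.value pol g s| ≤ 2 * C := by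
  refine CMDP.norm_le_of_poisson hU (h := M.value pol g) (fun t _ => ?_)
    (CMDP.value_mean hU g) hC0 hC hs
  simp only [smul_eq_mul]
  rw [CMDP.value_poisson hU]
  have h1 : ‖pexp (M.transLaw pol t) fun z => M.signal g z.1 z.2.1‖ ≤ 1 :=
    norm_pexp_le_of_le fun z _ => M.abs_signal_le g z.1 z.2.1
  have h2 := CMDP.abs_avgReward_le hU g
  refine (norm_sub_le _ _).trans ?_
  rw [Real.norm_eq_abs (M.avgReward pol g)]
  linarith

/-- The advantage along a transition: the temporal difference of the value function. -/
def CMDP.tdError (M : CMDP S A) (pol : Policy S A) (g : Signal) (z : Transition S A) : ℝ :=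
  M.signal g z.1 z.2.1 - M.avgReward pol g + M.value pol g z.2.2 - M.value pol g z.1

end Value

/-! ### The policy gradient -/

section PolicyGradient

variable {S A : Type} [Fintype S] [Fintype A] {M : CMDP S A} {d : ℕ} {π : Vec d → Policy S A}
  {Θ : Set (Vec d)} {θ : Vec d}

theorem hasFDerivAt_prob (hΘ : IsOpen Θ) (hpos : ∀ θ ∈ Θ, ∀ s a, 0 < prob (π θ) s a)
    (hdiff : ∀ θ ∈ Θ, ∀ s a, DifferentiableAt ℝ (fun θ' => Real.log (prob (π θ') s a)) θ)
    (hθ : θ ∈ Θ) (s : S) (a : A) :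
    HasFDerivAt (fun θ' => prob (π θ') s a)
      (prob (π θ) s a • InnerProductSpace.toDual ℝ (Vec d) (score π θ s a)) θ := by
  have h1 : HasFDerivAt (fun θ' => Real.log (prob (π θ') s a))
      (InnerProductSpace.toDual ℝ (Vec d) (score π θ s a)) θ :=
    (hdiff θ hθ s a).hasGradientAt.hasFDerivAt
  have h2 := h1.exp
  rw [Real.exp_log (hpos θ hθ s a)] at h2
  refine h2.congr_of_eventuallyEq ?_
  filter_upwards [hΘ.mem_nhds hθ] with θ' hθ'
  rw [Real.exp_log (hpos θ' hθ' s a)]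

theorem CMDP.stepR_eq (M : CMDP S A) (pol : Policy S A) (s s' : S) :
    M.stepR pol s s' = ∑ a, prob pol s a * (M.P s a s').toReal := by
  rw [CMDP.stepR, CMDP.step, PMF.bind_apply, tsum_fintype, ENNReal.toReal_sum
    fun a _ => ENNReal.mul_ne_top (PMF.apply_ne_top _ _) (PMF.apply_ne_top _ _)]
  exact Finset.sum_congr rfl fun a _ => ENNReal.toReal_mul

/-- The stationary distribution depends continuously on the policy. -/
theorem continuousAt_statDist (hΘ : IsOpen Θ) (hU : ∀ θ ∈ Θ, M.Unichain (π θ)) (hθ : θ ∈ Θ)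
    (hcont : ∀ s a, ContinuousAt (fun θ' => prob (π θ') s a) θ) (t : S) :
    ContinuousAt (fun θ' => M.statDist (π θ') t) θ := by
  obtain ⟨G, hG, -, -⟩ := CMDP.exists_fundamental (hU θ hθ)
    (CMDP.isStationary_statDist (hU θ hθ))
  have hstep : ∀ s s', Tendsto (fun θ' => M.stepR (π θ') s s' - M.stepR (π θ) s s') (𝓝 θ) (𝓝 0) := by
    intro s s'
    have : ContinuousAt (fun θ' => M.stepR (π θ') s s') θ := by
      simp only [CMDP.stepR_eq]
      exact tendsto_finsetSum _ fun a _ => (hcont s a).mul_const _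
    simpa using this.sub_const (M.stepR (π θ) s s')
  have hb : Tendsto (fun θ' => ∑ s', ∑ s, |M.stepR (π θ') s s' - M.stepR (π θ) s s'| * |G s' t|)
      (𝓝 θ) (𝓝 (∑ s', ∑ s : S, |(0 : ℝ)| * |G s' t|)) :=
    tendsto_finsetSum _ fun s' _ => tendsto_finsetSum _ fun s _ =>
      ((hstep s s').abs).mul_const _
  simp only [abs_zero, zero_mul, Finset.sum_const_zero] at hb
  refine tendsto_iff_norm_sub_tendsto_zero.2 (squeeze_zero' (Eventually.of_forall fun _ =>
    norm_nonneg _) ?_ hb)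
  filter_upwards [hΘ.mem_nhds hθ] with θ' hθ'
  have hd := CMDP.isStationary_statDist (hU θ' hθ')
  rw [hG _ hd.sum_eq t, Real.norm_eq_abs]
  refine (Finset.abs_sum_le_sum_abs _ _).trans (Finset.sum_le_sum fun s' _ => ?_)
  conv_lhs => rw [← hd.eq s', ← Finset.sum_sub_distrib, Finset.sum_mul]
  refine (Finset.abs_sum_le_sum_abs _ _).trans (Finset.sum_le_sum fun s _ => ?_)
  rw [← mul_sub, abs_mul, abs_mul, abs_of_nonneg (hd.nonneg s)]
  have h1 : M.statDist (π θ') s ≤ 1 := by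
    rw [← hd.sum_eq]
    exact Finset.single_le_sum (f := M.statDist (π θ')) (fun i _ => hd.nonneg i) (Finset.mem_univ s)
  gcongr
  exact mul_le_of_le_one_left (abs_nonneg _) h1

/-- The product of a continuous function with a differentiable function that vanishes at the
point. -/
theorem hasFDerivAt_mul_of_eq_zero {F : Type*} [NormedAddCommGroup F] [NormedSpace ℝ F]
    {c k : F → ℝ} {k' : F →L[ℝ] ℝ} {x : F} (hc : ContinuousAt c x) (hk : HasFDerivAt k k' x)
    (h0 : k x = 0) : HasFDerivAt (fun y => c y * k y) (c x • k') x := by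
  rw [hasFDerivAt_iff_isLittleO]
  have h1 : (fun y => (c y - c x) * k y) =o[𝓝 x] fun y => y - x := by
    have a : (fun y => c y - c x) =o[𝓝 x] fun _ => (1 : ℝ) := by
      rw [Asymptotics.isLittleO_one_iff]
      simpa using hc.sub_const (c x)
    have b : k =O[𝓝 x] fun y => ‖y - x‖ := by
      have := hk.isBigO_sub
      simp only [h0, sub_zero] at this
      exact this.norm_right
    have := a.mul_isBigO b
    simp only [one_mul] at this
    exact this.of_norm_right
  have h2 : (fun y => c x * (k y - k x - k' (y - x))) =o[𝓝 x] fun y => y - x :=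
    (hasFDerivAt_iff_isLittleO.1 hk).const_mul_left _
  refine (h1.add h2).congr_left fun y => ?_
  simp only [h0, smul_apply, smul_eq_mul]
  ring

/-- The performance difference identity. -/
theorem CMDP.avgReward_sub {pol pol' : Policy S A} (hU' : M.Unichain pol') (g : Signal) :
    M.avgReward pol' g - M.avgReward pol g = ∑ s, M.statDist pol' s * ∑ a, prob pol' s a *
      ∑ s', (M.P s a s').toReal * M.tdError pol g (s, a, s') := by
  have e : ∑ s, M.statDist pol' s * ∑ a, prob pol' s a *
      ∑ s', (M.P s a s').toReal * M.tdError pol g (s, a, s')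
      = pexp (M.statTrans pol' hU') (M.tdError pol g) := by
    rw [CMDP.pexp_statTrans]
    simp only [CMDP.pexp_transLaw, smul_eq_mul]
  rw [e]
  unfold CMDP.tdError
  rw [pexp_sub (PBdd.of_finite _ _) (PBdd.of_finite _ _),
    pexp_add (PBdd.of_finite _ _) (PBdd.of_finite _ _),
    pexp_sub (PBdd.of_finite _ _) (PBdd.of_finite _ _), pexp_const,
    CMDP.pexp_statTrans_fst hU' (M.value pol g), CMDP.pexp_statTrans_snd hU' (M.value pol g),
    ← CMDP.avgReward_eq_pexp hU']
  ring

/-- The policy gradient theorem. -/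
theorem CMDP.gradient_avgReward (hΘ : IsOpen Θ) (hpos : ∀ θ ∈ Θ, ∀ s a, 0 < prob (π θ) s a)
    (hdiff : ∀ θ ∈ Θ, ∀ s a, DifferentiableAt ℝ (fun θ' => Real.log (prob (π θ') s a)) θ)
    (hU : ∀ θ ∈ Θ, M.Unichain (π θ)) (hθ : θ ∈ Θ) (g : Signal) :
    gradient (fun θ' => M.avgReward (π θ') g) θ
      = pexp (M.statTrans (π θ) (hU θ hθ))
        fun z => M.tdError (π θ) g z • score π θ z.1 z.2.1 := by
  set adv : S → A → ℝ := fun s a =>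
    ∑ s', (M.P s a s').toReal * M.tdError (π θ) g (s, a, s') with hadv
  have hprob := hasFDerivAt_prob hΘ hpos hdiff hθ
  set k : S → Vec d → ℝ := fun s θ' => ∑ a, (prob (π θ') s a - prob (π θ) s a) * adv s a with hk
  have hk0 : ∀ s, k s θ = 0 := fun s => by simp [hk]
  have hkd : ∀ s, HasFDerivAt (k s) (∑ a, adv s a •
      (prob (π θ) s a • InnerProductSpace.toDual ℝ (Vec d) (score π θ s a))) θ := fun s =>
    HasFDerivAt.fun_sum fun a _ => ((hprob s a).sub_const _).mul_const (adv s a)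
  have hbell : ∀ s, ∑ a, prob (π θ) s a * adv s a = 0 := fun s => by
    have := CMDP.value_bellman (hU θ hθ) g s
    rw [CMDP.pexp_transLaw] at this
    exact this
  have hJ : ∀ᶠ θ' in 𝓝 θ, M.avgReward (π θ') g
      = M.avgReward (π θ) g + ∑ s, M.statDist (π θ') s * k s θ' := by
    filter_upwards [hΘ.mem_nhds hθ] with θ' hθ'
    have h1 := CMDP.avgReward_sub (M := M) (pol := π θ) (hU θ' hθ') g
    have h2 : ∀ s, k s θ' = ∑ a, prob (π θ') s a * adv s a := fun s => by
      simp only [hk, sub_mul, Finset.sum_sub_distrib, hbell, sub_zero]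
    simp only [h2]
    linarith
  have hder : HasFDerivAt (fun θ' => M.avgReward (π θ') g)
      (∑ s, M.statDist (π θ) s • ∑ a, adv s a •
        (prob (π θ) s a • InnerProductSpace.toDual ℝ (Vec d) (score π θ s a))) θ := by
    refine HasFDerivAt.congr_of_eventuallyEq ?_ hJ
    refine HasFDerivAt.const_add _ (HasFDerivAt.fun_sum fun s _ => ?_)
    exact hasFDerivAt_mul_of_eq_zero (continuousAt_statDist hΘ hU hθ
      (fun s a => (hprob s a).continuousAt) s) (hkd s) (hk0 s)
  have hgrad : HasGradientAt (fun θ' => M.avgReward (π θ') g)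
      (∑ s, M.statDist (π θ) s • ∑ a, adv s a • (prob (π θ) s a • score π θ s a)) θ := by
    have e : InnerProductSpace.toDual ℝ (Vec d)
        (∑ s, M.statDist (π θ) s • ∑ a, adv s a • (prob (π θ) s a • score π θ s a))
        = ∑ s, M.statDist (π θ) s • ∑ a, adv s a •
          (prob (π θ) s a • InnerProductSpace.toDual ℝ (Vec d) (score π θ s a)) := by
      ext y
      simp
    rw [hasGradientAt_iff_hasFDerivAt, e]
    exact hder
  rw [hgrad.gradient, CMDP.pexp_statTrans]
  refine Finset.sum_congr rfl fun s _ => ?_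
  rw [CMDP.pexp_transLaw]
  congr 1
  refine Finset.sum_congr rfl fun a _ => ?_
  simp only [smul_smul]
  rw [← Finset.sum_smul, smul_smul, mul_comm]

end PolicyGradient

/-! ### Linear problems -/

section Linear

variable {S A : Type} [Fintype S] [Fintype A] {M : CMDP S A} {pol : Policy S A}

theorem map_levelAvg {E E' : Type} [AddCommGroup E] [Module ℝ E] [AddCommGroup E'] [Module ℝ E']
    (T : E →ₗ[ℝ] E') {f : Transition S A → E} {f' : Transition S A → E'}
    {τ : List (Transition S A)} (h : ∀ z ∈ τ, T (f z) = f' z) (j : ℕ) :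
    T (levelAvg f τ j) = levelAvg f' τ j := by
  rw [levelAvg, levelAvg, map_smul, map_list_sum, List.map_map]
  congr 2
  exact List.map_congr_left fun z hz => h z (List.mem_of_mem_take hz)

theorem map_mlmc {E E' : Type} [AddCommGroup E] [Module ℝ E] [AddCommGroup E'] [Module ℝ E']
    (T : E →ₗ[ℝ] E') {f : Transition S A → E} {f' : Transition S A → E'}
    {τ : List (Transition S A)} (h : ∀ z ∈ τ, T (f z) = f' z) (Tmax Q : ℕ) :
    T (mlmc Tmax f Q τ) = mlmc Tmax f' Q τ := by
  unfold mlmc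
  rw [map_add, map_levelAvg T h]
  congr 1
  split_ifs
  · rw [map_smul, map_sub, map_levelAvg T h, map_levelAvg T h]
  · exact map_zero T

/-- A linear map that intertwines two direction fields on the transitions between recurrent states
intertwines the iterates. -/
theorem map_sgd {E E' : Type} [NormedAddCommGroup E] [InnerProductSpace ℝ E]
    [AddCommGroup E'] [Module ℝ E'] (T : E' →ₗ[ℝ] E) {u' : E' → Transition S A → E'}
    {u : E → Transition S A → E} {X : Set (Transition S A)}
    (h : ∀ x, ∀ z ∈ X, T (u' x z) = u (T x) z) (γ : ℝ) (Tmax : ℕ) (x₀ : E')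
    {bs : List (ℕ × List (Transition S A))} (hbs : ∀ b ∈ bs, ∀ z ∈ b.2, z ∈ X) :
    T (bs.foldl (fun x b => x - γ • mlmc Tmax (u' x) b.1 b.2) x₀) = sgd γ Tmax u (T x₀) bs := by
  induction bs generalizing x₀ with
  | nil => rfl
  | cons b bs ih =>
    rw [List.foldl_cons, ih _ fun c hc => hbs c (List.mem_cons_of_mem _ hc), sgd, sgd,
      List.foldl_cons, map_sub, map_smul,
      map_mlmc T fun z hz => h x₀ z (hbs b List.mem_cons_self z hz)]

theorem exists_solution_of_coercive {E : Type*} [NormedAddCommGroup E] [InnerProductSpace ℝ E]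
    [FiniteDimensional ℝ E] (F : E →L[ℝ] E) {κ : ℝ} (hκ : 0 < κ)
    (hF : ∀ y, κ * ‖y‖ ^ 2 ≤ inner ℝ y (F y)) : Function.Surjective F ∧
      ∀ y, κ * ‖y‖ ≤ ‖F y‖ := by
  have hle : ∀ y, κ * ‖y‖ ≤ ‖F y‖ := fun y => by
    have h1 := (hF y).trans (real_inner_le_norm _ _)
    rcases (norm_nonneg y).eq_or_lt with h0 | h0
    · rw [← h0]; simp
    · exact le_of_mul_le_mul_left (by linarith [h1, sq (‖y‖)] : ‖y‖ * (κ * ‖y‖) ≤ ‖y‖ * ‖F y‖) h0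
  refine ⟨LinearMap.injective_iff_surjective (f := F.toLinearMap).1 fun x y hxy => ?_, hle⟩
  have h := hle (x - y)
  have : F (x - y) = 0 := by
    rw [map_sub, sub_eq_zero]; exact hxy
  rw [this, norm_zero] at h
  have h2 : ‖x - y‖ = 0 := le_antisymm (by by_contra! h3; nlinarith) (norm_nonneg _)
  exact sub_eq_zero.1 (norm_eq_zero.1 h2)

theorem LinearOracle.of_linear {E : Type} [NormedAddCommGroup E] [InnerProductSpace ℝ E]
    [CompleteSpace E] (hU : M.Unichain pol) {Λ : Transition S A → E →L[ℝ] E}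
    {b : Transition S A → E} {xs : E} {L κ r : ℝ}
    (hroot : pexp (M.statTrans pol hU) (fun z => Λ z xs - b z) = 0)
    (hΛ : ∀ z ∈ M.recTrans pol, ∀ y, ‖Λ z y‖ ≤ L * ‖y‖)
    (hnoise : ∀ z ∈ M.recTrans pol, ‖Λ z xs - b z‖ ≤ L * r)
    (hcoer : ∀ y, κ * ‖y‖ ^ 2 ≤ pexp (M.statTrans pol hU) fun z => inner ℝ y (Λ z y))
    (hκ : 0 < κ) (hκL : κ ≤ L) (hxs : ‖xs‖ ≤ r) :
    LinearOracle M pol hU (fun x z => Λ z x - b z) xs (pexp (M.statTrans pol hU) Λ) L κ r := by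
  have happ : ∀ y, pexp (M.statTrans pol hU) Λ y = pexp (M.statTrans pol hU) fun z => Λ z y :=
    fun y => (pexp_clm (PBdd.of_finite _ Λ) (ContinuousLinearMap.apply ℝ E y)).symm
  have hsplit : ∀ x z, Λ z x - b z = Λ z (x - xs) + (Λ z xs - b z) := fun x z => by
    rw [map_sub]; abel
  refine ⟨fun x z hz => ?_, fun x => ?_, fun y => ?_, fun y => ?_, hκ, hκL, hxs⟩
  · rw [hsplit, mul_add]
    exact (norm_add_le _ _).trans (add_le_add (hΛ z hz _) (hnoise z hz))
  · simp only [hsplit x]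
    rw [pexp_add (PBdd.of_finite _ _) (PBdd.of_finite _ _), hroot, add_zero, happ]
  · rw [happ]
    have := pexp_clm (PBdd.of_finite (M.statTrans pol hU) fun z => Λ z y) (innerSL ℝ y)
    simp only [innerSL_apply_apply] at this
    rw [← this]
    exact hcoer y
  · rw [happ]
    exact norm_pexp_le_of_le fun z hz => hΛ z (CMDP.recTrans_of_mem_statTrans hU hz) y

end Linear

/-! ### The critic -/

section Critic

variable {S A : Type} [Fintype S] [Fintype A] {M : CMDP S A} {pol : Policy S A} {n : ℕ}
  {φ : S → Vec n}

theorem CMDP.pexp_statTrans_pair (hU : M.Unichain pol) (F : S → S → ℝ) :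
    pexp (M.statTrans pol hU) (fun z => F z.1 z.2.2)
      = ∑ s, M.statDist pol s * ∑ s', M.stepR pol s s' * F s s' := by
  rw [CMDP.pexp_statTrans]
  refine Finset.sum_congr rfl fun s _ => ?_
  rw [pexp_congr (g := fun z => F s z.2.2) fun z hz => by rw [CMDP.fst_of_mem_transLaw hz],
    M.pexp_transLaw_snd pol s (F s)]
  rfl

/-- The Dirichlet form of the stationary chain: for `u` a function of the state,
`E[u(s) (u(s) - u(s'))] = (1/2) E[(u(s) - u(s'))²]`. -/
theorem CMDP.pexp_dirichlet (hU : M.Unichain pol) (u : S → ℝ) :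
    pexp (M.statTrans pol hU) (fun z => u z.1 * (u z.1 - u z.2.2))
      = 1 / 2 * pexp (M.statTrans pol hU) fun z => (u z.1 - u z.2.2) ^ 2 := by
  have h1 := CMDP.pexp_statTrans_fst hU fun s => u s ^ 2
  have h2 := CMDP.pexp_statTrans_snd hU fun s => u s ^ 2
  rw [← h1] at h2
  have e : (fun z : Transition S A => (u z.1 - u z.2.2) ^ 2)
      = fun z => 2 * (u z.1 * (u z.1 - u z.2.2)) + (u z.2.2 ^ 2 - u z.1 ^ 2) := by
    funext z; ring
  rw [e, pexp_add (PBdd.of_finite _ _) (PBdd.of_finite _ _), pexp_mul_left,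
    pexp_sub (PBdd.of_finite _ _) (PBdd.of_finite _ _), h2]
  ring

theorem CMDP.criticMatrix_apply (hU : M.Unichain pol) (φ : S → Vec n) (x : Vec n) :
    M.criticMatrix pol φ x
      = pexp (M.statTrans pol hU) fun z => inner ℝ (φ z.1 - φ z.2.2) x • φ z.1 := by
  rw [CMDP.pexp_statTrans]
  have e : ∀ s, pexp (M.transLaw pol s) (fun z => inner ℝ (φ z.1 - φ z.2.2) x • φ z.1)
      = ∑ s', M.stepR pol s s' • inner ℝ (φ s - φ s') x • φ s := fun s => by
    rw [pexp_congr (g := fun z => inner ℝ (φ s - φ z.2.2) x • φ s) fun z hz => by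
      rw [CMDP.fst_of_mem_transLaw hz],
      M.pexp_transLaw_snd pol s fun s' => inner ℝ (φ s - φ s') x • φ s]
  simp only [e, CMDP.criticMatrix, sum_apply, smul_apply,
    InnerProductSpace.rankOne_apply, Finset.smul_sum, smul_smul, CMDP.stepR, mul_assoc]

theorem CMDP.inner_criticMatrix (hU : M.Unichain pol) (φ : S → Vec n) (y x : Vec n) :
    inner ℝ y (M.criticMatrix pol φ x)
      = pexp (M.statTrans pol hU) fun z => inner ℝ y (φ z.1) * inner ℝ (φ z.1 - φ z.2.2) x := by
  rw [CMDP.criticMatrix_apply hU]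
  have := pexp_clm (PBdd.of_finite (M.statTrans pol hU)
    fun z => inner ℝ (φ z.1 - φ z.2.2) x • φ z.1) (innerSL ℝ y)
  simp only [innerSL_apply_apply, inner_smul_right] at this
  rw [← this]
  exact congrArg _ (funext fun z => mul_comm _ _)

/-- The directions that the critic can identify: the orthogonal complement of the kernel of the
feature matrix. -/
def CMDP.critSubspace (M : CMDP S A) (pol : Policy S A) (φ : S → Vec n) : Submodule ℝ (Vec n) :=
  (LinearMap.ker (M.criticMatrix pol φ).toLinearMap)ᗮ

/-- Along a transition between recurrent states the feature difference is orthogonal to the kernel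
of the feature matrix, because the kernel consists of the vectors whose value estimate is constant
on the recurrent class. -/
theorem CMDP.feature_sub_mem (hU : M.Unichain pol) (φ : S → Vec n) {s t : S}
    (hs : s ∈ M.recurrent pol) (ht : t ∈ M.recurrent pol) :
    φ s - φ t ∈ M.critSubspace pol φ := by
  rw [CMDP.critSubspace, Submodule.mem_orthogonal]
  intro x hx
  have hx0 : M.criticMatrix pol φ x = 0 := hx
  set u : S → ℝ := fun s => inner ℝ x (φ s) with hu
  have h0 : pexp (M.statTrans pol hU) (fun z => (u z.1 - u z.2.2) ^ 2) = 0 := by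
    have h1 := CMDP.inner_criticMatrix hU φ x x
    rw [hx0, inner_zero_right] at h1
    have e : (fun z : Transition S A => inner ℝ x (φ z.1) * inner ℝ (φ z.1 - φ z.2.2) x)
        = fun z => u z.1 * (u z.1 - u z.2.2) := by
      funext z
      rw [real_inner_comm x (φ z.1 - φ z.2.2), inner_sub_right]
    rw [e, CMDP.pexp_dirichlet] at h1
    linarith
  rw [CMDP.pexp_statTrans_pair hU fun s s' => (u s - u s') ^ 2] at h0
  have hd := CMDP.isStationary_statDist hU
  have hstep : ∀ a ∈ M.recurrent pol, ∀ b, M.step pol a b ≠ 0 → u a = u b := by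
    intro a ha b hab
    have hin : ∀ s, 0 ≤ ∑ s', M.stepR pol s s' * (u s - u s') ^ 2 := fun s =>
      Finset.sum_nonneg fun s' _ => mul_nonneg (M.stepR_nonneg _ _ _) (sq_nonneg _)
    have h1 := (Finset.sum_eq_zero_iff_of_nonneg fun s _ => mul_nonneg (hd.nonneg s) (hin s)).1 h0
      a (Finset.mem_univ a)
    have h2 := (mul_eq_zero.1 h1).resolve_left (CMDP.statDist_pos hU ha).ne'
    have h3 := (Finset.sum_eq_zero_iff_of_nonneg fun s' _ =>
      mul_nonneg (M.stepR_nonneg _ _ _) (sq_nonneg _)).1 h2 b (Finset.mem_univ b)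
    have h4 := (mul_eq_zero.1 h3).resolve_left (CMDP.stepR_ne_zero.2 hab)
    linarith [pow_eq_zero_iff (two_ne_zero) |>.1 h4]
  have hreach : u s = u t := by
    have hst := hU s hs t ht
    induction hst with
    | refl => rfl
    | @tail b c hb hbc ih =>
      have hbR := CMDP.recurrent_of_reach hs hb
      rw [ih hbR, hstep b hbR c hbc]
  rw [inner_sub_right]
  exact sub_eq_zero.2 hreach

/-- The state space of the critic: the estimate of the average reward and the identifiable part of
the value weights. -/
abbrev CMDP.CritSpace (M : CMDP S A) (pol : Policy S A) (φ : S → Vec n) : Type :=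
  WithLp 2 (ℝ × M.critSubspace pol φ)

/-- The projection of a critic iterate to its identifiable part. -/
def CMDP.critProj (M : CMDP S A) (pol : Policy S A) (φ : S → Vec n) :
    (ℝ × Vec n) →ₗ[ℝ] M.CritSpace pol φ :=
  (WithLp.prodContinuousLinearEquiv 2 ℝ ℝ (M.critSubspace pol φ)).symm.toLinearEquiv.toLinearMap ∘ₗ
    (LinearMap.id.prodMap (M.critSubspace pol φ).orthogonalProjectionOnto.toLinearMap)

/-- The linear part of the critic direction. -/
def CMDP.critLin (M : CMDP S A) (pol : Policy S A) (φ : S → Vec n) (cγ : ℝ)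
    (z : Transition S A) : M.CritSpace pol φ →L[ℝ] M.CritSpace pol φ :=
  (WithLp.prodContinuousLinearEquiv 2 ℝ ℝ (M.critSubspace pol φ)).symm.toContinuousLinearMap ∘L
    ((cγ • ContinuousLinearMap.fst ℝ ℝ (M.critSubspace pol φ)).prod
      ((ContinuousLinearMap.fst ℝ ℝ (M.critSubspace pol φ) +
        innerSL ℝ (φ z.1 - φ z.2.2) ∘L (M.critSubspace pol φ).subtypeL ∘L
          ContinuousLinearMap.snd ℝ ℝ (M.critSubspace pol φ)).smulRight
        ((M.critSubspace pol φ).orthogonalProjectionOnto (φ z.1)))) ∘L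
    (WithLp.prodContinuousLinearEquiv 2 ℝ ℝ (M.critSubspace pol φ)).toContinuousLinearMap

/-- The inhomogeneous part of the critic direction. -/
def CMDP.critConst (M : CMDP S A) (pol : Policy S A) (g : Signal) (φ : S → Vec n) (cγ : ℝ)
    (z : Transition S A) : M.CritSpace pol φ :=
  WithLp.toLp 2 (cγ * M.signal g z.1 z.2.1,
    M.signal g z.1 z.2.1 • (M.critSubspace pol φ).orthogonalProjectionOnto (φ z.1))

theorem CMDP.critLin_apply (M : CMDP S A) (pol : Policy S A) (φ : S → Vec n) (cγ : ℝ)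
    (z : Transition S A) (y : M.CritSpace pol φ) :
    M.critLin pol φ cγ z y = WithLp.toLp 2 (cγ * y.fst,
      (y.fst + inner ℝ (φ z.1 - φ z.2.2) (y.snd : Vec n)) •
        (M.critSubspace pol φ).orthogonalProjectionOnto (φ z.1)) := rfl

theorem CMDP.critProj_apply (M : CMDP S A) (pol : Policy S A) (φ : S → Vec n) (ξ : ℝ × Vec n) :
    M.critProj pol φ ξ
      = WithLp.toLp 2 (ξ.1, (M.critSubspace pol φ).orthogonalProjectionOnto ξ.2) := rfl

theorem CMDP.inner_feature_sub_proj (hU : M.Unichain pol) (φ : S → Vec n) {s t : S}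
    (hs : s ∈ M.recurrent pol) (ht : t ∈ M.recurrent pol) (ζ : Vec n) :
    inner ℝ (φ s - φ t) ((M.critSubspace pol φ).orthogonalProjectionOnto ζ : Vec n)
      = inner ℝ (φ s - φ t) ζ :=
  Submodule.inner_orthogonalProjectionOnto_eq_of_mem_left
    (⟨φ s - φ t, CMDP.feature_sub_mem hU φ hs ht⟩ : M.critSubspace pol φ) ζ

theorem CMDP.critProj_criticDir (hU : M.Unichain pol) (cγ : ℝ) (g : Signal) (φ : S → Vec n)
    (ξ : ℝ × Vec n) {z : Transition S A} (hz : z ∈ M.recTrans pol) :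
    M.critProj pol φ (M.criticDir cγ g φ ξ z)
      = M.critLin pol φ cγ z (M.critProj pol φ ξ) - M.critConst pol g φ cγ z := by
  rw [CMDP.critLin_apply, CMDP.critProj_apply, CMDP.critProj_apply, CMDP.critConst,
    ← WithLp.toLp_sub, CMDP.criticDir]
  congr 1
  refine Prod.ext rfl ?_
  simp only [map_sub, map_add, map_smul, Prod.snd_sub]
  have := CMDP.inner_feature_sub_proj hU φ hz.1 hz.2 ξ.2
  change _ = (ξ.1 + inner ℝ (φ z.1 - φ z.2.2)
    ((M.critSubspace pol φ).orthogonalProjectionOnto ξ.2 : Vec n)) • _ - _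
  rw [this, add_smul]

/-- After projection the critic estimate is an iterate of stochastic approximation. -/
theorem CMDP.critProj_criticEst {d : ℕ} (hU : M.Unichain pol) (p : Params d) (g : Signal)
    (φ : S → Vec n) {e : EpochSample S A} (he : ∀ b ∈ e.critic, ∀ z ∈ b.2, z ∈ M.recTrans pol) :
    M.critProj pol φ (M.criticEst p g φ e)
      = sgd p.γξ p.Tmax (fun x z => M.critLin pol φ p.cγ z x - M.critConst pol g φ p.cγ z) 0
        e.critic := by
  have := map_sgd (M.critProj pol φ) (u' := M.criticDir p.cγ g φ)
    (u := fun x z => M.critLin pol φ p.cγ z x - M.critConst pol g φ p.cγ z) (fun ξ z hz => CMDP.critProj_criticDir hU p.cγ g φ ξ hz)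
    p.γξ p.Tmax 0 he
  rw [map_zero] at this
  exact this

/-- The fixed point of the critic. -/
structure CMDP.IsCritRoot (M : CMDP S A) (pol : Policy S A) (hU : M.Unichain pol) (g : Signal)
    (φ : S → Vec n) (lam : ℝ) (xs : M.CritSpace pol φ) : Prop where
  fst_eq : xs.fst = M.avgReward pol g
  norm_snd : ‖xs.snd‖ ≤ 2 / lam
  eq : ∀ y ∈ M.critSubspace pol φ,
    pexp (M.statTrans pol hU) (fun z => inner ℝ y (φ z.1) * (M.signal g z.1 z.2.1
      - M.avgReward pol g + inner ℝ (φ z.2.2 - φ z.1) (xs.snd : Vec n))) = 0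

theorem CMDP.exists_critRoot (hU : M.Unichain pol) (g : Signal) (hφ : ∀ s, ‖φ s‖ ≤ 1) {lam : ℝ}
    (hlam : 0 < lam) (hM : ∀ x ∈ M.critSubspace pol φ,
      lam * ‖x‖ ^ 2 ≤ inner ℝ x (M.criticMatrix pol φ x)) :
    ∃ xs, M.IsCritRoot pol hU g φ lam xs := by
  set W := M.critSubspace pol φ with hW
  set F : W →L[ℝ] W := W.orthogonalProjectionOnto ∘L M.criticMatrix pol φ ∘L W.subtypeL with hF
  have hinner : ∀ (y x : W), inner ℝ y (F x) = inner ℝ (y : Vec n) (M.criticMatrix pol φ x) :=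
    fun y x => Submodule.inner_orthogonalProjectionOnto_eq_of_mem_left y _
  obtain ⟨hsurj, hle⟩ := exists_solution_of_coercive F hlam fun y => by
    rw [hinner]; exact hM y y.2
  set b : Vec n := pexp (M.statTrans pol hU)
    fun z => (M.signal g z.1 z.2.1 - M.avgReward pol g) • φ z.1 with hb
  have hbn : ‖b‖ ≤ 2 := norm_pexp_le_of_le fun z _ => by
    rw [norm_smul]
    have h1 := M.abs_signal_le g z.1 z.2.1
    have h2 := CMDP.abs_avgReward_le hU g
    have h3 : ‖M.signal g z.1 z.2.1 - M.avgReward pol g‖ ≤ 2 := by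
      refine (norm_sub_le _ _).trans ?_
      rw [Real.norm_eq_abs, Real.norm_eq_abs]; linarith
    exact (mul_le_of_le_one_right (norm_nonneg _) (hφ z.1)).trans h3
  obtain ⟨ζ, hζ⟩ := hsurj (W.orthogonalProjectionOnto b)
  refine ⟨WithLp.toLp 2 (M.avgReward pol g, ζ), rfl, ?_, fun y hy => ?_⟩
  · have h1 := hle ζ
    rw [hζ] at h1
    have h2 := (h1.trans (Submodule.norm_orthogonalProjectionOnto_apply_le W b)).trans hbn
    change ‖ζ‖ ≤ 2 / lam
    rw [le_div_iff₀ hlam]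
    linarith
  · have h1 : inner ℝ y (M.criticMatrix pol φ ζ) = inner ℝ y b := by
      rw [← hinner ⟨y, hy⟩ ζ, hζ]
      exact Submodule.inner_orthogonalProjectionOnto_eq_of_mem_left ⟨y, hy⟩ b
    have h2 := pexp_clm (PBdd.of_finite (M.statTrans pol hU)
      fun z => (M.signal g z.1 z.2.1 - M.avgReward pol g) • φ z.1) (innerSL ℝ y)
    simp only [innerSL_apply_apply, inner_smul_right] at h2
    rw [← hb, ← h1, CMDP.inner_criticMatrix hU] at h2
    change pexp (M.statTrans pol hU) (fun z => inner ℝ y (φ z.1) * (M.signal g z.1 z.2.1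
      - M.avgReward pol g + inner ℝ (φ z.2.2 - φ z.1) (ζ : Vec n))) = 0
    have e : (fun z : Transition S A => inner ℝ y (φ z.1) * (M.signal g z.1 z.2.1
        - M.avgReward pol g + inner ℝ (φ z.2.2 - φ z.1) (ζ : Vec n)))
        = fun z => (M.signal g z.1 z.2.1 - M.avgReward pol g) * inner ℝ y (φ z.1)
          - inner ℝ y (φ z.1) * inner ℝ (φ z.1 - φ z.2.2) (ζ : Vec n) := by
      funext z
      rw [← neg_sub (φ z.1) (φ z.2.2), inner_neg_left]
      ring
    rw [e, pexp_sub (PBdd.of_finite _ _) (PBdd.of_finite _ _), h2, sub_self]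

theorem WithLp.norm_toLp_le {W : Type*} [NormedAddCommGroup W] (a : ℝ) (w : W) :
    ‖WithLp.toLp 2 (a, w)‖ ≤ |a| + ‖w‖ := by
  refine le_of_sq_le_sq ?_ (by positivity)
  rw [WithLp.prod_norm_sq_eq_of_L2]
  change ‖a‖ ^ 2 + ‖w‖ ^ 2 ≤ _
  rw [Real.norm_eq_abs]
  nlinarith [mul_nonneg (abs_nonneg a) (norm_nonneg w)]

theorem le_cGamma {lam cγ : ℝ} (hlam : 0 < lam) (hlam1 : lam ≤ 1)
    (hc : lam + √(1 / lam ^ 2 - 1) ≤ cγ) : 1 ≤ cγ ∧ 1 ≤ lam * (2 * cγ - lam) := by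
  set w := √(1 / lam ^ 2 - 1) with hw
  have hw0 : 0 ≤ w := Real.sqrt_nonneg _
  have hge : 0 ≤ 1 / lam ^ 2 - 1 := by
    rw [sub_nonneg, le_div_iff₀ (by positivity)]
    nlinarith
  have hsq : (lam * w) ^ 2 = 1 - lam ^ 2 := by
    rw [mul_pow, hw, Real.sq_sqrt hge]
    field_simp
  have hlw0 : 0 ≤ lam * w := by positivity
  have hlw1 : lam * w ≤ 1 := by nlinarith
  have h1 : 1 - lam ^ 2 ≤ lam * w := by nlinarith
  have h2 : lam * (lam + w) ≤ lam * cγ := by gcongr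
  constructor
  · by_contra! h
    nlinarith
  · nlinarith

theorem inner_toLp_smul_proj {W : Submodule ℝ (Vec n)} (y : WithLp 2 (ℝ × W)) (a c : ℝ)
    (v : Vec n) : inner ℝ y (WithLp.toLp 2 (a, c • W.orthogonalProjectionOnto v))
      = y.fst * a + c * inner ℝ (y.snd : Vec n) v := by
  rw [WithLp.prod_inner_apply]
  refine congrArg₂ (· + ·) (mul_comm _ _) ?_
  refine (inner_smul_right (𝕜 := ℝ) y.snd (W.orthogonalProjectionOnto v) c).trans ?_
  rw [← Submodule.inner_orthogonalProjectionOnto_eq_of_mem_left y.snd v]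

theorem CMDP.abs_inner_feature_sub_le (hφ : ∀ s, ‖φ s‖ ≤ 1) (s t : S) (v : Vec n) :
    |inner ℝ (φ s - φ t) v| ≤ 2 * ‖v‖ := by
  refine (abs_real_inner_le_norm _ _).trans ?_
  gcongr
  linarith [norm_sub_le (φ s) (φ t), hφ s, hφ t]

theorem norm_smul_proj_le {W : Submodule ℝ (Vec n)} (c : ℝ) {v : Vec n} (hv : ‖v‖ ≤ 1) :
    ‖c • W.orthogonalProjectionOnto v‖ ≤ |c| := by
  rw [norm_smul, Real.norm_eq_abs]
  exact mul_le_of_le_one_right (abs_nonneg _)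
    ((Submodule.norm_orthogonalProjectionOnto_apply_le W _).trans hv)

theorem CMDP.norm_critLin_le (pol : Policy S A) (hφ : ∀ s, ‖φ s‖ ≤ 1) {cγ : ℝ} (hc1 : 1 ≤ cγ)
    (z : Transition S A) (y : M.CritSpace pol φ) : ‖M.critLin pol φ cγ z y‖ ≤ 4 * cγ * ‖y‖ := by
  rw [CMDP.critLin_apply]
  refine (WithLp.norm_toLp_le _ _).trans ?_
  have h1 : |y.fst| ≤ ‖y‖ := WithLp.norm_fst_le _ y
  have h2 : ‖y.snd‖ ≤ ‖y‖ := WithLp.norm_snd_le _ y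
  have h3 := (norm_smul_proj_le (W := M.critSubspace pol φ)
    (y.fst + inner ℝ (φ z.1 - φ z.2.2) (y.snd : Vec n)) (hφ z.1)).trans (abs_add_le _ _)
  have h4 : |inner ℝ (φ z.1 - φ z.2.2) (y.snd : Vec n)| ≤ 2 * ‖y.snd‖ :=
    CMDP.abs_inner_feature_sub_le hφ _ _ _
  rw [abs_mul, abs_of_nonneg (by linarith : 0 ≤ cγ)]
  have h5 : cγ * |y.fst| ≤ cγ * ‖y‖ := by gcongr
  have h6 : 1 * ‖y‖ ≤ cγ * ‖y‖ := by gcongr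
  linarith

theorem quadratic_nonneg {lam cγ : ℝ} (hlam : 0 < lam) (hc : 1 ≤ lam * (2 * cγ - lam))
    (a b : ℝ) : 0 ≤ (cγ - lam / 2) * a ^ 2 - a * b + lam / 2 * b ^ 2 := by
  have h : 0 ≤ (lam / 2) * ((cγ - lam / 2) * a ^ 2 - a * b + lam / 2 * b ^ 2) := by
    nlinarith [sq_nonneg (lam / 2 * b - a / 2), mul_nonneg (sub_nonneg.2 hc) (sq_nonneg a)]
  exact nonneg_of_mul_nonneg_right h (by positivity)

/-- Coercivity of the mean critic direction: `c_γ` is large enough to absorb the coupling of the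
two components. -/
theorem CMDP.critLin_coercive (hU : M.Unichain pol) (hφ : ∀ s, ‖φ s‖ ≤ 1)
    {lam cγ : ℝ} (hlam : 0 < lam) (hc2 : 1 ≤ lam * (2 * cγ - lam))
    (hM : ∀ x ∈ M.critSubspace pol φ,
      lam * ‖x‖ ^ 2 ≤ inner ℝ x (M.criticMatrix pol φ x)) (y : M.CritSpace pol φ) :
    lam / 2 * ‖y‖ ^ 2
      ≤ pexp (M.statTrans pol hU) fun z => inner ℝ y (M.critLin pol φ cγ z y) := by
  have key : ∀ (a b : ℝ) (v : Vec n), b = ‖v‖ → v ∈ M.critSubspace pol φ →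
      lam / 2 * (a ^ 2 + b ^ 2) ≤ pexp (M.statTrans pol hU) fun z =>
        (cγ * a ^ 2 + a * inner ℝ v (φ z.1)) + inner ℝ v (φ z.1) * inner ℝ (φ z.1 - φ z.2.2) v := by
    intro a b v hb hv
    rw [pexp_add (PBdd.of_finite _ _) (PBdd.of_finite _ _),
      pexp_add (PBdd.of_finite _ _) (PBdd.of_finite _ _), pexp_const, pexp_mul_left,
      ← CMDP.inner_criticMatrix hU]
    have h1 := hM v hv
    have h2 : |pexp (M.statTrans pol hU) fun z => inner ℝ v (φ z.1)| ≤ b := by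
      rw [hb, ← Real.norm_eq_abs]
      refine norm_pexp_le_of_le fun z _ => (norm_inner_le_norm _ _).trans ?_
      exact mul_le_of_le_one_right (norm_nonneg _) (hφ z.1)
    have h3 : -(|a| * b) ≤ a * pexp (M.statTrans pol hU) fun z => inner ℝ v (φ z.1) := by
      refine neg_le_of_abs_le ?_
      rw [abs_mul]; gcongr
    have h4 := quadratic_nonneg hlam hc2 |a| b
    rw [sq_abs] at h4
    rw [← hb] at h1
    linarith
  rw [pexp_congr fun z _ => by rw [CMDP.critLin_apply, inner_toLp_smul_proj]]
  have h := key y.fst ‖y.snd‖ y.snd rfl y.snd.2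
  rw [WithLp.prod_norm_sq_eq_of_L2, Real.norm_eq_abs, sq_abs]
  refine h.trans_eq (pexp_congr fun z _ => ?_)
  ring

theorem CMDP.critLin_sub_critConst {cγ : ℝ} (g : Signal) (xs : M.CritSpace pol φ)
    (z : Transition S A) : M.critLin pol φ cγ z xs - M.critConst pol g φ cγ z
      = WithLp.toLp 2 (cγ * (xs.fst - M.signal g z.1 z.2.1),
        (xs.fst - M.signal g z.1 z.2.1 + inner ℝ (φ z.1 - φ z.2.2) (xs.snd : Vec n)) •
          (M.critSubspace pol φ).orthogonalProjectionOnto (φ z.1)) := by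
  rw [CMDP.critLin_apply, CMDP.critConst, ← WithLp.toLp_sub]
  congr 1
  refine Prod.ext ?_ ?_
  · simp only [Prod.fst_sub]; ring
  · simp only [Prod.snd_sub]
    rw [← sub_smul]; congr 1; ring

theorem CMDP.IsCritRoot.pexp_eq_zero (hU : M.Unichain pol) (g : Signal) {lam : ℝ} (cγ : ℝ)
    {xs : M.CritSpace pol φ} (hxs : M.IsCritRoot pol hU g φ lam xs) :
    pexp (M.statTrans pol hU) (fun z => M.critLin pol φ cγ z xs - M.critConst pol g φ cγ z)
      = 0 := by
  refine ext_inner_left ℝ fun y => ?_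
  rw [inner_zero_right]
  have h1 := pexp_clm (PBdd.of_finite (M.statTrans pol hU)
    fun z => M.critLin pol φ cγ z xs - M.critConst pol g φ cγ z) (innerSL ℝ y)
  simp only [innerSL_apply_apply] at h1
  rw [← h1, pexp_congr (g := fun z => (y.fst * cγ) * (M.avgReward pol g - M.signal g z.1 z.2.1)
      - inner ℝ (y.snd : Vec n) (φ z.1) * (M.signal g z.1 z.2.1
        - M.avgReward pol g + inner ℝ (φ z.2.2 - φ z.1) (xs.snd : Vec n))) fun z _ => by
    rw [CMDP.critLin_sub_critConst, inner_toLp_smul_proj, hxs.fst_eq, ← neg_sub (φ z.1) (φ z.2.2),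
      inner_neg_left]
    ring]
  rw [pexp_sub (PBdd.of_finite _ _) (PBdd.of_finite _ _), hxs.eq _ y.snd.2, pexp_mul_left,
    pexp_sub (PBdd.of_finite _ _) (PBdd.of_finite _ _), pexp_const, ← CMDP.avgReward_eq_pexp hU]
  ring

theorem CMDP.IsCritRoot.norm_residual_le {hU : M.Unichain pol} {g : Signal}
    (hφ : ∀ s, ‖φ s‖ ≤ 1) {lam cγ : ℝ} (hlam : 0 < lam) (hlam1 : lam ≤ 1) (hc1 : 1 ≤ cγ)
    {xs : M.CritSpace pol φ} (hxs : M.IsCritRoot pol hU g φ lam xs) (z : Transition S A) :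
    ‖M.critLin pol φ cγ z xs - M.critConst pol g φ cγ z‖ ≤ 4 * cγ * (3 / lam) := by
  rw [CMDP.critLin_sub_critConst]
  refine (WithLp.norm_toLp_le _ _).trans ?_
  have h1 : |xs.fst - M.signal g z.1 z.2.1| ≤ 2 := by
    refine (abs_sub _ _).trans ?_
    rw [hxs.fst_eq]
    linarith [M.abs_signal_le g z.1 z.2.1, CMDP.abs_avgReward_le hU g]
  have h2 : |inner ℝ (φ z.1 - φ z.2.2) (xs.snd : Vec n)| ≤ 2 * ‖xs.snd‖ :=
    CMDP.abs_inner_feature_sub_le hφ _ _ _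
  have h3 := (norm_smul_proj_le (W := M.critSubspace pol φ)
    (xs.fst - M.signal g z.1 z.2.1 + inner ℝ (φ z.1 - φ z.2.2) (xs.snd : Vec n))
    (hφ z.1)).trans (abs_add_le _ _)
  have h0 := hxs.norm_snd
  rw [abs_mul, abs_of_nonneg (by linarith : 0 ≤ cγ)]
  have h4 : cγ * |xs.fst - M.signal g z.1 z.2.1| ≤ cγ * 2 := by gcongr
  have hl1 : 1 ≤ 1 / lam := by rw [le_div_iff₀ hlam]; linarith
  have h5 : 4 * cγ * (3 / lam) = 12 * cγ * (1 / lam) := by ring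
  have h6 : 2 / lam = 2 * (1 / lam) := by ring
  rw [h5]
  rw [h6] at h0
  nlinarith [mul_nonneg (by linarith : (0:ℝ) ≤ cγ - 1) (by linarith : (0:ℝ) ≤ 1 / lam - 1)]

theorem CMDP.linearOracle_critic (hU : M.Unichain pol) (g : Signal) (hφ : ∀ s, ‖φ s‖ ≤ 1)
    {lam cγ : ℝ} (hlam : 0 < lam) (hlam1 : lam ≤ 1) (hc : lam + √(1 / lam ^ 2 - 1) ≤ cγ)
    (hM : ∀ x ∈ M.critSubspace pol φ,
      lam * ‖x‖ ^ 2 ≤ inner ℝ x (M.criticMatrix pol φ x))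
    {xs : M.CritSpace pol φ} (hxs : M.IsCritRoot pol hU g φ lam xs) :
    LinearOracle M pol hU (fun x z => M.critLin pol φ cγ z x - M.critConst pol g φ cγ z) xs
      (pexp (M.statTrans pol hU) (M.critLin pol φ cγ)) (4 * cγ) (lam / 2) (3 / lam) := by
  obtain ⟨hc1, hc2⟩ := le_cGamma hlam hlam1 hc
  refine LinearOracle.of_linear hU (hxs.pexp_eq_zero hU g cγ)
    (fun z _ => CMDP.norm_critLin_le pol hφ hc1 z)
    (fun z _ => hxs.norm_residual_le hφ hlam hlam1 hc1 z)
    (CMDP.critLin_coercive hU hφ hlam hc2 hM) (by positivity) (by linarith) ?_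
  refine le_trans (b := |xs.fst| + ‖xs.snd‖) (WithLp.norm_toLp_le xs.fst xs.snd) ?_
  have h3 : 3 / lam = 1 / lam + 2 / lam := by ring
  have hl1 : 1 ≤ 1 / lam := by rw [le_div_iff₀ hlam]; linarith
  rw [h3, hxs.fst_eq]
  exact add_le_add ((CMDP.abs_avgReward_le hU g).trans hl1) hxs.norm_snd

/-- The temporal differences of the critic fixed point approximate those of the value function as
well as the best linear approximation does, up to a numerical constant: in the Dirichlet form of
the chain the error does not see the conditioning `λ` of the feature matrix. -/
theorem CMDP.pexp_critRoot_sq_le (hU : M.Unichain pol) (g : Signal) {lam : ℝ}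
    {xs : M.CritSpace pol φ} (hxs : M.IsCritRoot pol hU g φ lam xs) (ζ : Vec n) :
    pexp (M.statTrans pol hU) (fun z => (inner ℝ (φ z.2.2 - φ z.1) (xs.snd : Vec n)
        - (M.value pol g z.2.2 - M.value pol g z.1)) ^ 2)
      ≤ 36 * (1 / 2 * ∑ s, M.statDist pol s * (M.value pol g s - inner ℝ ζ (φ s)) ^ 2) := by
  set V := M.value pol g
  set ν := M.statTrans pol hU
  set W := M.critSubspace pol φ with hW
  set x : W := xs.snd - W.orthogonalProjectionOnto ζ with hx
  set u : S → ℝ := fun s => inner ℝ (x : Vec n) (φ s) with hu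
  set e : S → ℝ := fun s => V s - inner ℝ ζ (φ s) with he
  -- on recurrent transitions the error splits into `u` and `e`
  have hsplit : ∀ z ∈ ν.support, inner ℝ (φ z.2.2 - φ z.1) (xs.snd : Vec n) - (V z.2.2 - V z.1)
      = (u z.2.2 - u z.1) - (e z.2.2 - e z.1) := by
    intro z hz
    have hzR := CMDP.recTrans_of_mem_statTrans hU hz
    have h1 := CMDP.inner_feature_sub_proj hU φ hzR.2 hzR.1 ζ
    have h3 : u z.2.2 - u z.1 = inner ℝ (φ z.2.2 - φ z.1) (xs.snd : Vec n)
        - inner ℝ (φ z.2.2 - φ z.1) ζ := by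
      have h2 : inner ℝ (φ z.2.2 - φ z.1) (x : Vec n) = u z.2.2 - u z.1 := by
        rw [real_inner_comm, inner_sub_right]
      rw [← h2, ← h1, ← inner_sub_right]
      rfl
    have h4 : inner ℝ (φ z.2.2 - φ z.1) ζ = inner ℝ ζ (φ z.2.2) - inner ℝ ζ (φ z.1) := by
      rw [real_inner_comm, inner_sub_right]
    rw [h3, h4]
    simp only [he]
    ring
  have hY : pexp ν (fun z => e z.2.2 ^ 2) = ∑ s, M.statDist pol s * e s ^ 2 :=
    CMDP.pexp_statTrans_snd hU fun s => e s ^ 2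
  have hY' : pexp ν (fun z => e z.1 ^ 2) = ∑ s, M.statDist pol s * e s ^ 2 :=
    CMDP.pexp_statTrans_fst hU fun s => e s ^ 2
  set Y := ∑ s, M.statDist pol s * e s ^ 2
  set X := pexp ν fun z => (u z.2.2 - u z.1) ^ 2 with hX
  have hX0 : 0 ≤ X := pexp_nonneg fun z _ => sq_nonneg _
  -- Galerkin orthogonality
  have horth : pexp ν (fun z => u z.1 * ((u z.2.2 - u z.1) - (e z.2.2 - e z.1))) = 0 := by
    have h1 := hxs.eq x x.2
    have hbell : pexp ν (fun z => u z.1 * (M.signal g z.1 z.2.1 - M.avgReward pol g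
        + V z.2.2 - V z.1)) = 0 := by
      rw [CMDP.pexp_statTrans]
      refine Finset.sum_eq_zero fun s _ => ?_
      have h2 := CMDP.value_bellman hU g s
      rw [pexp_congr (g := fun z => u s * (M.signal g z.1 z.2.1 - M.avgReward pol g
        + V z.2.2 - V z.1)) fun z hz => by rw [CMDP.fst_of_mem_transLaw hz], pexp_mul_left, h2]
      simp
    rw [pexp_congr (g := fun z => inner ℝ (x : Vec n) (φ z.1) * (M.signal g z.1 z.2.1
      - M.avgReward pol g + inner ℝ (φ z.2.2 - φ z.1) (xs.snd : Vec n))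
      - u z.1 * (M.signal g z.1 z.2.1 - M.avgReward pol g + V z.2.2 - V z.1)) fun z hz => by
        rw [← hsplit z hz]; simp only [hu]; ring,
      pexp_sub (PBdd.of_finite _ _) (PBdd.of_finite _ _), h1, hbell, sub_zero]
  have hstat : pexp ν (fun z => u z.2.2 * e z.2.2) = pexp ν fun z => u z.1 * e z.1 := by
    rw [CMDP.pexp_statTrans_fst hU fun s => u s * e s, CMDP.pexp_statTrans_snd hU fun s => u s * e s]
  have hdir : 1 / 2 * X = pexp ν fun z => (u z.2.2 - u z.1) * e z.2.2 := by
    have h1 := CMDP.pexp_dirichlet hU u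
    have h2 : X = pexp ν fun z => (u z.1 - u z.2.2) ^ 2 :=
      pexp_congr fun z _ => by ring
    rw [h2, ← h1]
    have h3 : (fun z : Transition S A => (u z.2.2 - u z.1) * e z.2.2)
        = fun z => u z.1 * (u z.1 - u z.2.2) + (u z.1 * ((u z.2.2 - u z.1) - (e z.2.2 - e z.1)))
          + (u z.2.2 * e z.2.2 - u z.1 * e z.1) := by
      funext z; ring
    rw [h3, pexp_add (PBdd.of_finite _ _) (PBdd.of_finite _ _),
      pexp_add (PBdd.of_finite _ _) (PBdd.of_finite _ _), horth,
      pexp_sub (PBdd.of_finite _ _) (PBdd.of_finite _ _), hstat]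
    ring
  have hXY : X ≤ 4 * Y := by
    have h1 := pexp_mul_sq_le (PBdd.of_finite ν fun z => u z.2.2 - u z.1)
      (PBdd.of_finite ν fun z => e z.2.2)
    rw [← hdir, hY, ← hX] at h1
    by_contra! h
    have : 0 < X := lt_of_le_of_lt (by
      have : 0 ≤ Y := by rw [← hY]; exact pexp_nonneg fun z _ => sq_nonneg _
      linarith) h
    nlinarith
  rw [pexp_congr (g := fun z => ((u z.2.2 - u z.1) - (e z.2.2 - e z.1)) ^ 2) fun z hz => by
    rw [hsplit z hz]]
  have hle : pexp ν (fun z => ((u z.2.2 - u z.1) - (e z.2.2 - e z.1)) ^ 2)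
      ≤ pexp ν fun z => 3 * ((u z.2.2 - u z.1) ^ 2 + e z.2.2 ^ 2 + e z.1 ^ 2) :=
    pexp_mono (PBdd.of_finite _ _) (PBdd.of_finite _ _) fun z _ => by
      nlinarith [sq_nonneg ((u z.2.2 - u z.1) + e z.2.2), sq_nonneg ((u z.2.2 - u z.1) - e z.1),
        sq_nonneg (e z.2.2 + e z.1)]
  rw [pexp_mul_left, pexp_add (PBdd.of_finite _ _) (PBdd.of_finite _ _),
    pexp_add (PBdd.of_finite _ _) (PBdd.of_finite _ _), hY, hY', ← hX] at hle
  linarith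

end Critic

/-! ### The natural policy gradient as a linear problem -/

section NPG

variable {S A : Type} [Fintype S] [Fintype A] {M : CMDP S A} {d n : ℕ}
  {π : Vec d → Policy S A} {θ : Vec d} {φ : S → Vec n}

theorem pexp_apply {α : Type*} {E F : Type*} [NormedAddCommGroup E] [NormedSpace ℝ E]
    [NormedAddCommGroup F] [NormedSpace ℝ F] [CompleteSpace F] {p : PMF α} {f : α → E →L[ℝ] F}
    (hf : PBdd p f) (x : E) : pexp p f x = pexp p fun a => f a x :=
  (pexp_clm hf (ContinuousLinearMap.apply ℝ F x)).symm

/-- The single-sample Fisher matrix `∇ log π_θ(a|s) ⊗ ∇ log π_θ(a|s)`. -/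
def scoreOuter (π : Vec d → Policy S A) (θ : Vec d) (z : Transition S A) : Vec d →L[ℝ] Vec d :=
  InnerProductSpace.rankOne ℝ (score π θ z.1 z.2.1) (score π θ z.1 z.2.1)

theorem scoreOuter_apply (z : Transition S A) (x : Vec d) : scoreOuter π θ z x
    = inner ℝ (score π θ z.1 z.2.1) x • score π θ z.1 z.2.1 := rfl

theorem CMDP.fisher_eq_pexp (hU : M.Unichain (π θ)) :
    M.fisher π θ = pexp (M.statTrans (π θ) hU) (scoreOuter π θ) := by
  rw [CMDP.pexp_statTrans, CMDP.fisher]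
  refine Finset.sum_congr rfl fun s _ => ?_
  rw [CMDP.pexp_transLaw, Finset.smul_sum]
  refine Finset.sum_congr rfl fun a _ => ?_
  change _ = M.statDist (π θ) s • prob (π θ) s a • ∑ s', (M.P s a s').toReal •
    InnerProductSpace.rankOne ℝ (score π θ s a) (score π θ s a)
  rw [mul_smul, ← Finset.sum_smul, sum_toReal_pmf, one_smul]

theorem CMDP.inner_fisher (hU : M.Unichain (π θ)) (y : Vec d) :
    inner ℝ y (M.fisher π θ y)
      = pexp (M.statTrans (π θ) hU) fun z => inner ℝ y (scoreOuter π θ z y) := by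
  rw [CMDP.fisher_eq_pexp hU]
  have h1 := pexp_clm (PBdd.of_finite (M.statTrans (π θ) hU) (scoreOuter π θ))
    (ContinuousLinearMap.apply ℝ (Vec d) y)
  have h2 := pexp_clm (PBdd.of_finite (M.statTrans (π θ) hU) fun z => scoreOuter π θ z y)
    (innerSL ℝ y)
  simp only [innerSL_apply_apply] at h2
  rw [h2]
  exact congrArg _ h1.symm

theorem norm_scoreOuter_le {G₁ : ℝ} (hG : ∀ s a, ‖score π θ s a‖ ≤ G₁) (z : Transition S A)
    (y : Vec d) : ‖scoreOuter π θ z y‖ ≤ G₁ ^ 2 * ‖y‖ := by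
  have h := hG z.1 z.2.1
  rw [scoreOuter_apply, norm_smul]
  calc _ ≤ (‖score π θ z.1 z.2.1‖ * ‖y‖) * ‖score π θ z.1 z.2.1‖ := by
        gcongr; exact norm_inner_le_norm _ _
    _ = ‖score π θ z.1 z.2.1‖ ^ 2 * ‖y‖ := by ring
    _ ≤ _ := by gcongr

theorem CMDP.mu_le_sq [Nontrivial (Vec d)] (hU : M.Unichain (π θ)) {G₁ μ : ℝ}
    (hG : ∀ s a, ‖score π θ s a‖ ≤ G₁)
    (hF : ∀ x : Vec d, μ * ‖x‖ ^ 2 ≤ inner ℝ x (M.fisher π θ x)) : μ ≤ G₁ ^ 2 := by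
  obtain ⟨x, hx⟩ := exists_ne (0 : Vec d)
  have hx0 : 0 < ‖x‖ ^ 2 := by positivity
  have h1 := hF x
  rw [CMDP.inner_fisher hU] at h1
  have h2 : pexp (M.statTrans (π θ) hU) (fun z => inner ℝ x (scoreOuter π θ z x))
      ≤ G₁ ^ 2 * ‖x‖ ^ 2 := pexp_le (PBdd.of_finite _ _) fun z _ => by
    calc _ ≤ ‖x‖ * ‖scoreOuter π θ z x‖ := real_inner_le_norm _ _
      _ ≤ ‖x‖ * (G₁ ^ 2 * ‖x‖) := by gcongr; exact norm_scoreOuter_le hG z x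
      _ = _ := by ring
  exact le_of_mul_le_mul_right (h1.trans h2) hx0

theorem CMDP.fisher_isInvertible {μ : ℝ} (hμ : 0 < μ)
    (hF : ∀ x : Vec d, μ * ‖x‖ ^ 2 ≤ inner ℝ x (M.fisher π θ x)) :
    (M.fisher π θ).IsInvertible := by
  obtain ⟨hsurj, hle⟩ := exists_solution_of_coercive (M.fisher π θ) hμ hF
  have hinj := LinearMap.injective_iff_surjective (f := (M.fisher π θ).toLinearMap).2 hsurj
  exact ⟨(LinearEquiv.ofBijective (M.fisher π θ).toLinearMap ⟨hinj, hsurj⟩).toContinuousLinearEquiv,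
    by ext; rfl⟩

theorem CMDP.norm_fisher_inverse_le {μ : ℝ} (hμ : 0 < μ)
    (hF : ∀ x : Vec d, μ * ‖x‖ ^ 2 ≤ inner ℝ x (M.fisher π θ x)) (v : Vec d) :
    ‖(M.fisher π θ).inverse v‖ ≤ ‖v‖ / μ := by
  have h := (exists_solution_of_coercive (M.fisher π θ) hμ hF).2 ((M.fisher π θ).inverse v)
  rw [(CMDP.fisher_isInvertible hμ hF).self_apply_inverse] at h
  rw [le_div_iff₀ hμ]
  linarith

/-- The advantage estimate that the NPG iterations derive from a critic estimate. -/
def CMDP.critAdv (M : CMDP S A) (pol : Policy S A) (g : Signal) (φ : S → Vec n)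
    (X : M.CritSpace pol φ) (z : Transition S A) : ℝ :=
  M.signal g z.1 z.2.1 - X.fst + inner ℝ (φ z.2.2 - φ z.1) (X.snd : Vec n)

/-- The limit point `F(θ)⁻¹ E[Â ∇ log π_θ(a|s)]` of the NPG iterations for the advantage
estimate `Â`. -/
def CMDP.npgRoot (M : CMDP S A) (π : Vec d → Policy S A) (θ : Vec d) (hU : M.Unichain (π θ))
    (a : Transition S A → ℝ) : Vec d :=
  (M.fisher π θ).inverse (pexp (M.statTrans (π θ) hU) fun z => a z • score π θ z.1 z.2.1)

theorem CMDP.npgEst_eq_sgd (hU : M.Unichain (π θ)) (p : Params d) (g : Signal)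
    {e : EpochSample S A} (he : ∀ b ∈ e.npg, ∀ z ∈ b.2, z ∈ M.recTrans (π θ)) :
    M.npgEst p π θ g φ e = sgd p.γω p.Tmax (fun ω z => scoreOuter π θ z ω
      - M.critAdv (π θ) g φ (M.critProj (π θ) φ (M.criticEst p g φ e)) z
        • score π θ z.1 z.2.1) 0 e.npg := by
  refine map_sgd (LinearMap.id (R := ℝ) (M := Vec d))
    (u' := M.npgDir π θ g φ (M.criticEst p g φ e)) (fun ω z hz => ?_) p.γω p.Tmax 0 he
  have h := CMDP.inner_feature_sub_proj hU φ hz.2 hz.1 (M.criticEst p g φ e).2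
  rw [CMDP.critProj_apply]
  change M.npgDir π θ g φ (M.criticEst p g φ e) ω z = scoreOuter π θ z ω
    - (M.signal g z.1 z.2.1 - (M.criticEst p g φ e).1 + inner ℝ (φ z.2.2 - φ z.1)
      ((M.critSubspace (π θ) φ).orthogonalProjectionOnto (M.criticEst p g φ e).2 : Vec n))
        • score π θ z.1 z.2.1
  rw [h, real_inner_comm]
  rfl

theorem CMDP.abs_critAdv_le (pol : Policy S A) (g : Signal) (hφ : ∀ s, ‖φ s‖ ≤ 1)
    (X : M.CritSpace pol φ) (z : Transition S A) :
    |M.critAdv pol g φ X z| ≤ 1 + 3 * ‖X‖ := by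
  have h1 : |X.fst| ≤ ‖X‖ := WithLp.norm_fst_le _ X
  have h2 : ‖X.snd‖ ≤ ‖X‖ := WithLp.norm_snd_le _ X
  have h3 : |inner ℝ (φ z.2.2 - φ z.1) (X.snd : Vec n)| ≤ 2 * ‖X.snd‖ :=
    CMDP.abs_inner_feature_sub_le hφ _ _ _
  refine (abs_add_le _ _).trans ?_
  linarith [abs_sub (M.signal g z.1 z.2.1) X.fst, M.abs_signal_le g z.1 z.2.1]

theorem CMDP.norm_npgRoot_le (hU : M.Unichain (π θ)) {G₁ μ : ℝ}
    (hG : ∀ s a, ‖score π θ s a‖ ≤ G₁) (hμ : 0 < μ)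
    (hF : ∀ x : Vec d, μ * ‖x‖ ^ 2 ≤ inner ℝ x (M.fisher π θ x)) (a : Transition S A → ℝ) :
    ‖M.npgRoot π θ hU a‖ ≤ G₁ / μ * pexp (M.statTrans (π θ) hU) fun z => |a z| := by
  refine (CMDP.norm_fisher_inverse_le hμ hF _).trans ?_
  rw [div_mul_eq_mul_div, ← pexp_mul_left]
  gcongr
  refine norm_pexp_le_pexp (PBdd.of_finite _ _) fun z _ => ?_
  rw [norm_smul, mul_comm, Real.norm_eq_abs]
  gcongr
  exact hG _ _

theorem CMDP.linearOracle_npg [Nontrivial (Vec d)] (hU : M.Unichain (π θ)) {G₁ μ : ℝ}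
    (hG0 : 0 ≤ G₁) (hG : ∀ s a, ‖score π θ s a‖ ≤ G₁) (hμ : 0 < μ)
    (hF : ∀ x : Vec d, μ * ‖x‖ ^ 2 ≤ inner ℝ x (M.fisher π θ x))
    {a : Transition S A → ℝ} {a₀ : ℝ} (ha : ∀ z, |a z| ≤ a₀) :
    LinearOracle M (π θ) hU (fun ω z => scoreOuter π θ z ω - a z • score π θ z.1 z.2.1)
      (M.npgRoot π θ hU a) (pexp (M.statTrans (π θ) hU) (scoreOuter π θ))
      (G₁ ^ 2) μ (2 * G₁ * a₀ / μ) := by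
  have hμG := CMDP.mu_le_sq hU hG hF
  have hmean : pexp (M.statTrans (π θ) hU) (fun z => |a z|) ≤ a₀ :=
    pexp_le (PBdd.of_finite _ _) fun z _ => ha z
  have ha0 : 0 ≤ a₀ := (pexp_nonneg fun _ _ => abs_nonneg _).trans hmean
  have hroot : ‖M.npgRoot π θ hU a‖ ≤ G₁ * a₀ / μ := by
    refine (CMDP.norm_npgRoot_le hU hG hμ hF a).trans ?_
    rw [div_mul_eq_mul_div]
    gcongr
  have hr0 : 0 ≤ G₁ * a₀ / μ := by positivity
  have h2 : 2 * G₁ * a₀ / μ = G₁ * a₀ / μ + G₁ * a₀ / μ := by ring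
  refine LinearOracle.of_linear hU ?_ (fun z _ => norm_scoreOuter_le hG z) (fun z _ => ?_)
    (fun y => ?_) hμ hμG (by linarith)
  · have h1 := pexp_clm (PBdd.of_finite (M.statTrans (π θ) hU) (scoreOuter π θ))
      (ContinuousLinearMap.apply ℝ (Vec d) (M.npgRoot π θ hU a))
    rw [pexp_sub (PBdd.of_finite _ _) (PBdd.of_finite _ _)]
    refine (congrArg (· - _) h1).trans ?_
    change pexp (M.statTrans (π θ) hU) (scoreOuter π θ) (M.npgRoot π θ hU a) - _ = 0
    rw [← CMDP.fisher_eq_pexp hU, CMDP.npgRoot,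
      (CMDP.fisher_isInvertible hμ hF).self_apply_inverse, sub_self]
  · refine (norm_sub_le _ _).trans ?_
    have h3 := (norm_scoreOuter_le hG z (M.npgRoot π θ hU a)).trans
      (mul_le_mul_of_nonneg_left hroot (sq_nonneg G₁))
    have h4 : ‖a z • score π θ z.1 z.2.1‖ ≤ a₀ * G₁ := by
      rw [norm_smul, Real.norm_eq_abs]
      gcongr
      · exact ha z
      · exact hG _ _
    -- `G₁² / μ ≥ 1`, so that the second summand is of the order of the first
    have h5 : a₀ * G₁ ≤ G₁ ^ 2 * (G₁ * a₀ / μ) := by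
      rw [mul_div_assoc', le_div_iff₀ hμ]
      have : 0 ≤ a₀ * G₁ := by positivity
      nlinarith
    rw [h2]
    linarith
  · rw [← CMDP.inner_fisher hU]
    exact hF y

/-- The dependence of the limit point of the NPG iterations on the critic estimate. -/
def CMDP.npgSlope (M : CMDP S A) (π : Vec d → Policy S A) (θ : Vec d) (hU : M.Unichain (π θ))
    (φ : S → Vec n) : M.CritSpace (π θ) φ →L[ℝ] Vec d :=
  (M.fisher π θ).inverse ∘L pexp (M.statTrans (π θ) hU) fun z =>
    (innerSL ℝ (φ z.2.2 - φ z.1) ∘L (M.critSubspace (π θ) φ).subtypeL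
        ∘L WithLp.sndL 2 ℝ ℝ (M.critSubspace (π θ) φ)
      - WithLp.fstL 2 ℝ ℝ (M.critSubspace (π θ) φ)).smulRight (score π θ z.1 z.2.1)

theorem CMDP.npgSlope_apply (hU : M.Unichain (π θ)) (Y : M.CritSpace (π θ) φ) :
    M.npgSlope π θ hU φ Y = M.npgRoot π θ hU fun z =>
      inner ℝ (φ z.2.2 - φ z.1) (Y.snd : Vec n) - Y.fst := by
  rw [CMDP.npgSlope, ContinuousLinearMap.comp_apply, CMDP.npgRoot]
  congr 1
  exact pexp_apply (PBdd.of_finite _ _) Y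

theorem CMDP.npgRoot_sub (hU : M.Unichain (π θ)) (a b : Transition S A → ℝ) :
    M.npgRoot π θ hU a - M.npgRoot π θ hU b = M.npgRoot π θ hU fun z => a z - b z := by
  rw [CMDP.npgRoot, CMDP.npgRoot, CMDP.npgRoot, ← map_sub,
    ← pexp_sub (PBdd.of_finite _ _) (PBdd.of_finite _ _)]
  simp only [sub_smul]

theorem CMDP.npgRoot_critAdv_sub (hU : M.Unichain (π θ)) (g : Signal)
    (X Y : M.CritSpace (π θ) φ) :
    M.npgRoot π θ hU (M.critAdv (π θ) g φ X) - M.npgRoot π θ hU (M.critAdv (π θ) g φ Y)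
      = M.npgSlope π θ hU φ (X - Y) := by
  rw [CMDP.npgRoot_sub, CMDP.npgSlope_apply]
  congr 1
  funext z
  have e : ((X - Y).snd : Vec n) = (X.snd : Vec n) - (Y.snd : Vec n) := rfl
  have e' : (X - Y).fst = X.fst - Y.fst := rfl
  rw [e, e', inner_sub_right, CMDP.critAdv, CMDP.critAdv]
  ring

theorem CMDP.norm_npgSlope_le (hU : M.Unichain (π θ)) {G₁ μ : ℝ} (hG0 : 0 ≤ G₁)
    (hG : ∀ s a, ‖score π θ s a‖ ≤ G₁) (hμ : 0 < μ)
    (hF : ∀ x : Vec d, μ * ‖x‖ ^ 2 ≤ inner ℝ x (M.fisher π θ x)) (hφ : ∀ s, ‖φ s‖ ≤ 1)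
    (Y : M.CritSpace (π θ) φ) : ‖M.npgSlope π θ hU φ Y‖ ≤ G₁ / μ * (3 * ‖Y‖) := by
  rw [CMDP.npgSlope_apply]
  refine (CMDP.norm_npgRoot_le hU hG hμ hF _).trans ?_
  gcongr
  refine pexp_le (PBdd.of_finite _ _) fun z _ => ?_
  have h1 : |Y.fst| ≤ ‖Y‖ := WithLp.norm_fst_le _ Y
  have h2 : ‖Y.snd‖ ≤ ‖Y‖ := WithLp.norm_snd_le _ Y
  have h3 : |inner ℝ (φ z.2.2 - φ z.1) (Y.snd : Vec n)| ≤ 2 * ‖Y.snd‖ :=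
    CMDP.abs_inner_feature_sub_le hφ _ _ _
  exact (abs_sub _ _).trans (by linarith)

/-- The limit point of the NPG iterations for the fixed point of the critic differs from the
natural gradient direction by the approximation error of the features. -/
theorem CMDP.norm_npgRoot_critRoot_sub_le {Θ : Set (Vec d)} (hΘ : IsOpen Θ)
    (hpos : ∀ θ ∈ Θ, ∀ s a, 0 < prob (π θ) s a)
    (hdiff : ∀ θ ∈ Θ, ∀ s a, DifferentiableAt ℝ (fun θ' => Real.log (prob (π θ') s a)) θ)
    (hU : ∀ θ ∈ Θ, M.Unichain (π θ)) (hθ : θ ∈ Θ) (g : Signal) {G₁ μ : ℝ} (hG0 : 0 ≤ G₁)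
    (hG : ∀ s a, ‖score π θ s a‖ ≤ G₁) (hμ : 0 < μ)
    (hF : ∀ x : Vec d, μ * ‖x‖ ^ 2 ≤ inner ℝ x (M.fisher π θ x)) {lam : ℝ}
    {xs : M.CritSpace (π θ) φ} (hxs : M.IsCritRoot (π θ) (hU θ hθ) g φ lam xs) :
    ‖M.npgRoot π θ (hU θ hθ) (M.critAdv (π θ) g φ xs) - M.npgDirection π g θ‖
      ≤ G₁ / μ * (6 * √(⨅ ζ : Vec n, (1 / 2) *
        ∑ s, M.statDist (π θ) s * (M.value (π θ) g s - inner ℝ ζ (φ s)) ^ 2)) := by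
  have e : M.npgDirection π g θ = M.npgRoot π θ (hU θ hθ) (M.tdError (π θ) g) := by
    rw [CMDP.npgDirection, CMDP.gradient_avgReward hΘ hpos hdiff hU hθ, CMDP.npgRoot]
  rw [e, CMDP.npgRoot_sub]
  refine (CMDP.norm_npgRoot_le _ hG hμ hF _).trans ?_
  gcongr
  have h6 : (6 : ℝ) = √36 := by
    rw [show (36 : ℝ) = 6 ^ 2 by norm_num, Real.sqrt_sq (by norm_num)]
  rw [h6, ← Real.sqrt_mul (by norm_num)]
  refine Real.le_sqrt_of_sq_le ((pexp_sq_le (PBdd.of_finite _ _)).trans ?_)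
  rw [Real.mul_iInf_of_nonneg (by norm_num)]
  refine le_ciInf fun ζ => (le_of_eq (pexp_congr fun z _ => ?_)).trans
    (CMDP.pexp_critRoot_sq_le (hU θ hθ) g hxs ζ)
  rw [sq_abs, CMDP.critAdv, CMDP.tdError, hxs.fst_eq]
  ring

end NPG

/-! ### One epoch after a successful burn-in -/

section Epoch

variable {S A : Type} [Fintype S] [Fintype A] {M : CMDP S A} {d n : ℕ} {p : Params d}
  {π : Vec d → Policy S A} {θ : Vec d} {g : Signal} {φ : S → Vec n} {hU : M.Unichain (π θ)}
  {T : ℕ} {G₁ μ lam C ε : ℝ}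

/-- The conditions on the policy, the features and the step sizes under which one epoch is
analyzed; `ε` bounds the approximation error of the features at the parameter `θ`. -/
structure CMDP.EpochCond (M : CMDP S A) (p : Params d) (π : Vec d → Policy S A) (θ : Vec d)
    (g : Signal) (φ : S → Vec n) (hU : M.Unichain (π θ)) (T : ℕ) (G₁ μ lam C ε : ℝ) : Prop where
  score_nonneg : 0 ≤ G₁
  score_le : ∀ s a, ‖score π θ s a‖ ≤ G₁
  mu_pos : 0 < μ
  fisher : ∀ x : Vec d, μ * ‖x‖ ^ 2 ≤ inner ℝ x (M.fisher π θ x)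
  feature : ∀ s, ‖φ s‖ ≤ 1
  lam_pos : 0 < lam
  lam_le : lam ≤ 1
  cGamma : lam + √(1 / lam ^ 2 - 1) ≤ p.cγ
  critic : ∀ x ∈ M.critSubspace (π θ) φ,
    lam * ‖x‖ ^ 2 ≤ inner ℝ x (M.criticMatrix (π θ) φ x)
  half_le : 1 / 2 ≤ C
  target : M.targetTime (π θ) ≤ ENNReal.ofReal C
  stepCritic : StepCond C p.Tmax p.γξ (4 * p.cγ) (lam / 2)
  stepNpg : StepCond C p.Tmax p.γω (G₁ ^ 2) μ
  powCritic : (1 - p.γξ * (lam / 2) / 2) ^ p.H ≤ 1 / (T : ℝ) ^ 2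
  powNpg : (1 - p.γω * μ / 2) ^ p.H ≤ 1 / (T : ℝ) ^ 2
  err_nonneg : 0 ≤ ε
  approx : ∀ xs, M.IsCritRoot (π θ) hU g φ lam xs →
    ‖M.npgRoot π θ hU (M.critAdv (π θ) g φ xs) - M.npgDirection π g θ‖ ≤ G₁ / μ * (6 * √ε)

/-- The identifiable part of the critic estimate, as a function of the critic samples. -/
def CMDP.critIter (M : CMDP S A) (p : Params d) (pol : Policy S A) (g : Signal) (φ : S → Vec n)
    (cs : List (ℕ × List (Transition S A))) : M.CritSpace pol φ :=
  sgd p.γξ p.Tmax (fun x z => M.critLin pol φ p.cγ z x - M.critConst pol g φ p.cγ z) 0 cs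

/-- The NPG iterate for the critic estimate `X`, as a function of the NPG samples. -/
def CMDP.npgIter (M : CMDP S A) (p : Params d) (π : Vec d → Policy S A) (θ : Vec d) (g : Signal)
    (φ : S → Vec n) (X : M.CritSpace (π θ) φ) (ns : List (ℕ × List (Transition S A))) : Vec d :=
  sgd p.γω p.Tmax (fun ω z => scoreOuter π θ z ω
    - M.critAdv (π θ) g φ X z • score π θ z.1 z.2.1) 0 ns

/-- From a recurrent state on, the NPG estimate is a function of the identifiable part of the critic
estimate. -/
theorem CMDP.npgEst_eq (hU : M.Unichain (π θ)) {s : S} (hs : s ∈ M.recurrent (π θ))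
    {b : List (Transition S A)} {cs ns : List (ℕ × List (Transition S A))}
    (hcs : cs ∈ (M.blocksLaw (π θ) p.Tmax p.H s).support)
    (hns : ns ∈ (M.blocksLaw (π θ) p.Tmax p.H (blocksEnd s cs)).support) :
    M.npgEst p π θ g φ ⟨b, cs, ns⟩ = M.npgIter p π θ g φ (M.critIter p (π θ) g φ cs) ns := by
  obtain ⟨h1, h2⟩ := CMDP.mem_blocksLaw hs hcs
  obtain ⟨h3, -⟩ := CMDP.mem_blocksLaw h2 hns
  rw [CMDP.npgEst_eq_sgd hU p g (e := ⟨b, cs, ns⟩) h3,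
    CMDP.critProj_criticEst hU p g φ (e := ⟨b, cs, ns⟩) h1]
  rfl

variable [Nontrivial (Vec d)]

theorem CMDP.EpochCond.oracleNpg (h : M.EpochCond p π θ g φ hU T G₁ μ lam C ε)
    (X : M.CritSpace (π θ) φ) : LinearOracle M (π θ) hU (fun ω z => scoreOuter π θ z ω
      - M.critAdv (π θ) g φ X z • score π θ z.1 z.2.1) (M.npgRoot π θ hU (M.critAdv (π θ) g φ X))
      (pexp (M.statTrans (π θ) hU) (scoreOuter π θ)) (G₁ ^ 2) μ
      (2 * G₁ * (1 + 3 * ‖X‖) / μ) :=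
  CMDP.linearOracle_npg hU h.score_nonneg h.score_le h.mu_pos h.fisher
    (CMDP.abs_critAdv_le (π θ) g h.feature X)

theorem CMDP.EpochCond.npgIter_sq (h : M.EpochCond p π θ g φ hU T G₁ μ lam C ε)
    (X : M.CritSpace (π θ) φ) {s : S} (hs : s ∈ M.recurrent (π θ)) :
    pexp (M.blocksLaw (π θ) p.Tmax p.H s) (fun ns => ‖M.npgIter p π θ g φ X ns
      - M.npgRoot π θ hU (M.critAdv (π θ) g φ X)‖ ^ 2) ≤ (2 * G₁ * (1 + 3 * ‖X‖) / μ) ^ 2 :=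
  (h.oracleNpg X).pexp_sgd_sq h.stepNpg h.half_le h.target p.H hs

theorem CMDP.EpochCond.npgIter_bias (h : M.EpochCond p π θ g φ hU T G₁ μ lam C ε)
    (X : M.CritSpace (π θ) φ) {s : S} (hs : s ∈ M.recurrent (π θ)) :
    ‖pexp (M.blocksLaw (π θ) p.Tmax p.H s) (fun ns => M.npgIter p π θ g φ X ns
      - M.npgRoot π θ hU (M.critAdv (π θ) g φ X))‖
      ≤ (1 / T ^ 2 + 32 * C * G₁ ^ 2 / (p.Tmax * μ)) * (2 * G₁ * (1 + 3 * ‖X‖) / μ) := by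
  refine ((h.oracleNpg X).norm_pexp_sgd_le h.stepNpg h.half_le h.target p.H hs).trans ?_
  have h1 := mul_le_mul_of_nonneg_right h.powNpg (h.oracleNpg X).radius_nonneg
  have e : 4 * (8 * C / p.Tmax * G₁ ^ 2) * (2 * G₁ * (1 + 3 * ‖X‖) / μ) / μ
      = 32 * C * G₁ ^ 2 / (p.Tmax * μ) * (2 * G₁ * (1 + 3 * ‖X‖) / μ) := by
    rw [mul_div_right_comm]
    congr 1
    rw [div_mul_eq_mul_div, mul_div_assoc', div_div]
    congr 1
    ring
  rw [e, add_mul]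
  linarith

theorem CMDP.EpochCond.pbdd_npgIter (h : M.EpochCond p π θ g φ hU T G₁ μ lam C ε)
    (X : M.CritSpace (π θ) φ) {s : S} (hs : s ∈ M.recurrent (π θ)) :
    PBdd (M.blocksLaw (π θ) p.Tmax p.H s) fun ns => M.npgIter p π θ g φ X ns
      - M.npgRoot π θ hU (M.critAdv (π θ) g φ X) :=
  (h.oracleNpg X).pbdd_sgd h.stepNpg.nonneg p.H hs

variable {xs : M.CritSpace (π θ) φ}

theorem CMDP.EpochCond.oracleCritic (h : M.EpochCond p π θ g φ hU T G₁ μ lam C ε)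
    (hxs : M.IsCritRoot (π θ) hU g φ lam xs) :
    LinearOracle M (π θ) hU
      (fun x z => M.critLin (π θ) φ p.cγ z x - M.critConst (π θ) g φ p.cγ z) xs
      (pexp (M.statTrans (π θ) hU) (M.critLin (π θ) φ p.cγ)) (4 * p.cγ) (lam / 2) (3 / lam) :=
  CMDP.linearOracle_critic hU g h.feature h.lam_pos h.lam_le h.cGamma h.critic hxs

theorem CMDP.EpochCond.critIter_bias (h : M.EpochCond p π θ g φ hU T G₁ μ lam C ε)
    (hxs : M.IsCritRoot (π θ) hU g φ lam xs) {s : S} (hs : s ∈ M.recurrent (π θ)) :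
    ‖pexp (M.blocksLaw (π θ) p.Tmax p.H s) (fun cs => M.critIter p (π θ) g φ cs - xs)‖
      ≤ (1 / T ^ 2 + 256 * C * p.cγ / (p.Tmax * lam)) * (3 / lam) := by
  refine ((h.oracleCritic hxs).norm_pexp_sgd_le h.stepCritic h.half_le h.target p.H hs).trans ?_
  have h1 := mul_le_mul_of_nonneg_right h.powCritic (h.oracleCritic hxs).radius_nonneg
  have e : 4 * (8 * C / p.Tmax * (4 * p.cγ)) * (3 / lam) / (lam / 2)
      = 256 * C * p.cγ / (p.Tmax * lam) * (3 / lam) := by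
    rw [mul_div_right_comm]
    congr 1
    rw [div_mul_eq_mul_div, mul_div_assoc', div_div, ← mul_div_assoc, div_div_eq_mul_div]
    ring
  rw [e, add_mul]
  linarith

theorem CMDP.EpochCond.norm_npgRoot_sub_le (h : M.EpochCond p π θ g φ hU T G₁ μ lam C ε)
    (hxs : M.IsCritRoot (π θ) hU g φ lam xs) (X : M.CritSpace (π θ) φ) :
    ‖M.npgRoot π θ hU (M.critAdv (π θ) g φ X) - M.npgDirection π g θ‖
      ≤ G₁ / μ * (3 * ‖X - xs‖ + 6 * √ε) := by
  have h1 := CMDP.norm_npgSlope_le hU h.score_nonneg h.score_le h.mu_pos h.fisher h.feature (X - xs)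
  rw [← CMDP.npgRoot_critAdv_sub hU g] at h1
  rw [mul_add]
  exact (norm_sub_le_norm_sub_add_norm_sub _ _ _).trans (add_le_add h1 (h.approx xs hxs))

theorem CMDP.EpochCond.norm_critIter_le (h : M.EpochCond p π θ g φ hU T G₁ μ lam C ε)
    (hxs : M.IsCritRoot (π θ) hU g φ lam xs) (X : M.CritSpace (π θ) φ) :
    1 + 3 * ‖X‖ ≤ 10 / lam + 3 * ‖X - xs‖ := by
  have h1 : ‖X‖ ≤ ‖X - xs‖ + 3 / lam :=
    (norm_le_norm_sub_add X xs).trans (add_le_add le_rfl (h.oracleCritic hxs).norm_root)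
  have h2 : 1 ≤ 1 / lam := by rw [le_div_iff₀ h.lam_pos]; linarith [h.lam_le]
  have h3 : 10 / lam = 1 / lam + 3 * (3 / lam) := by ring
  linarith

theorem CMDP.EpochCond.npg_sq_inner (h : M.EpochCond p π θ g φ hU T G₁ μ lam C ε)
    (hxs : M.IsCritRoot (π θ) hU g φ lam xs) (X : M.CritSpace (π θ) φ) {s : S}
    (hs : s ∈ M.recurrent (π θ)) :
    pexp (M.blocksLaw (π θ) p.Tmax p.H s)
      (fun ns => ‖M.npgIter p π θ g φ X ns - M.npgDirection π g θ‖ ^ 2)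
      ≤ (G₁ / μ) ^ 2 * (1600 / lam ^ 2 + 144 * ε) + (G₁ / μ) ^ 2 * 180 * ‖X - xs‖ ^ 2 := by
  have hb := h.pbdd_npgIter X hs
  have hG := h.score_nonneg
  have hμ := h.mu_pos
  set R := M.npgRoot π θ hU (M.critAdv (π θ) g φ X)
  set v := R - M.npgDirection π g θ with hv
  have hub : PBdd (M.blocksLaw (π θ) p.Tmax p.H s) fun ns =>
      2 * ‖M.npgIter p π θ g φ X ns - R‖ ^ 2 + 2 * ‖v‖ ^ 2 :=
    (hb.normSq.const_mul 2).add (PBdd.const _ _)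
  have hle : ∀ ns, ‖M.npgIter p π θ g φ X ns - M.npgDirection π g θ‖ ^ 2
      ≤ 2 * ‖M.npgIter p π θ g φ X ns - R‖ ^ 2 + 2 * ‖v‖ ^ 2 := by
    intro ns
    have h1 : ‖M.npgIter p π θ g φ X ns - M.npgDirection π g θ‖
        ≤ ‖M.npgIter p π θ g φ X ns - R‖ + ‖v‖ := norm_sub_le_norm_sub_add_norm_sub _ _ _
    have h2 := pow_le_pow_left₀ (norm_nonneg _) h1 2
    nlinarith [sq_nonneg (‖M.npgIter p π θ g φ X ns - R‖ - ‖v‖)]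
  have h0 := pexp_mono (hub.mono fun ns _ => by
    rw [Real.norm_of_nonneg (by positivity)]
    exact (hle ns).trans (le_abs_self _)) hub fun ns _ => hle ns
  rw [pexp_add (hb.normSq.const_mul 2) (PBdd.const _ _), pexp_mul_left, pexp_const] at h0
  have h1 := h.npgIter_sq X hs
  have h2 := h.norm_npgRoot_sub_le hxs X
  have h3 := h.norm_critIter_le hxs X
  set t := ‖X - xs‖
  have h4 : (2 * G₁ * (1 + 3 * ‖X‖) / μ) ^ 2 ≤ (G₁ / μ) ^ 2 * (4 * (10 / lam + 3 * t) ^ 2) := by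
    calc _ = (G₁ / μ) ^ 2 * (4 * (1 + 3 * ‖X‖) ^ 2) := by ring
      _ ≤ _ := by gcongr
  have h5 : ‖v‖ ^ 2 ≤ (G₁ / μ) ^ 2 * (3 * t + 6 * √ε) ^ 2 := by
    rw [← mul_pow]
    exact pow_le_pow_left₀ (norm_nonneg _) h2 2
  have h6 : 8 * (10 / lam + 3 * t) ^ 2 + 2 * (3 * t + 6 * √ε) ^ 2
      ≤ 1600 / lam ^ 2 + 144 * ε + 180 * t ^ 2 := by
    have e1 : 1600 / lam ^ 2 = 16 * (10 / lam) ^ 2 := by ring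
    have e2 : √ε ^ 2 = ε := Real.sq_sqrt h.err_nonneg
    rw [e1]
    nlinarith [sq_nonneg (10 / lam - 3 * t), sq_nonneg (3 * t - 6 * √ε)]
  have h7 := mul_le_mul_of_nonneg_left h6 (sq_nonneg (G₁ / μ))
  refine h0.trans ?_
  linarith

/-- The mean squared error of the NPG estimate in an epoch whose burn-in was successful. -/
theorem CMDP.EpochCond.npg_sq (h : M.EpochCond p π θ g φ hU T G₁ μ lam C ε) {s : S}
    (hs : s ∈ M.recurrent (π θ)) (b : List (Transition S A)) :
    pexp (M.blocksLaw (π θ) p.Tmax p.H s) (fun cs =>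
      pexp (M.blocksLaw (π θ) p.Tmax p.H (blocksEnd s cs)) fun ns =>
        ‖M.npgEst p π θ g φ ⟨b, cs, ns⟩ - M.npgDirection π g θ‖ ^ 2)
      ≤ (G₁ / μ) ^ 2 * (3220 / lam ^ 2 + 144 * ε) := by
  obtain ⟨xs, hxs⟩ := CMDP.exists_critRoot hU g h.feature h.lam_pos h.critic
  have hX : PBdd (M.blocksLaw (π θ) p.Tmax p.H s) fun cs => M.critIter p (π θ) g φ cs - xs :=
    (h.oracleCritic hxs).pbdd_sgd h.stepCritic.nonneg p.H hs
  have hX2 : pexp (M.blocksLaw (π θ) p.Tmax p.H s)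
      (fun cs => ‖M.critIter p (π θ) g φ cs - xs‖ ^ 2) ≤ (3 / lam) ^ 2 :=
    (h.oracleCritic hxs).pexp_sgd_sq h.stepCritic h.half_le h.target p.H hs
  have hub := (PBdd.const (M.blocksLaw (π θ) p.Tmax p.H s)
    ((G₁ / μ) ^ 2 * (1600 / lam ^ 2 + 144 * ε))).add (hX.normSq.const_mul ((G₁ / μ) ^ 2 * 180))
  have hle : ∀ cs ∈ (M.blocksLaw (π θ) p.Tmax p.H s).support,
      pexp (M.blocksLaw (π θ) p.Tmax p.H (blocksEnd s cs)) (fun ns =>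
        ‖M.npgEst p π θ g φ ⟨b, cs, ns⟩ - M.npgDirection π g θ‖ ^ 2)
      ≤ (G₁ / μ) ^ 2 * (1600 / lam ^ 2 + 144 * ε)
        + (G₁ / μ) ^ 2 * 180 * ‖M.critIter p (π θ) g φ cs - xs‖ ^ 2 := fun cs hcs =>
    (le_of_eq (pexp_congr fun ns hns => by rw [CMDP.npgEst_eq hU hs hcs hns])).trans
      (h.npg_sq_inner hxs _ (CMDP.mem_blocksLaw hs hcs).2)
  have h0 := pexp_mono (hub.mono fun cs hcs => by
    rw [Real.norm_of_nonneg (pexp_nonneg fun _ _ => by positivity)]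
    exact (hle cs hcs).trans (le_abs_self _)) hub hle
  rw [pexp_add (PBdd.const _ _) (hX.normSq.const_mul _), pexp_const, pexp_mul_left] at h0
  refine h0.trans ?_
  have h1 := mul_le_mul_of_nonneg_left hX2 (by positivity : 0 ≤ (G₁ / μ) ^ 2 * 180)
  have e : (G₁ / μ) ^ 2 * (3220 / lam ^ 2 + 144 * ε)
      = (G₁ / μ) ^ 2 * (1600 / lam ^ 2 + 144 * ε) + (G₁ / μ) ^ 2 * 180 * (3 / lam) ^ 2 := by ring
  linarith

/-- The bias of the NPG estimate in an epoch whose burn-in was successful: only the bias of the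
critic enters, since the root of the inner problem is affine in the critic estimate. -/
theorem CMDP.EpochCond.npg_bias (h : M.EpochCond p π θ g φ hU T G₁ μ lam C ε) {s : S}
    (hs : s ∈ M.recurrent (π θ)) (b : List (Transition S A)) :
    ‖pexp (M.blocksLaw (π θ) p.Tmax p.H s) (fun cs =>
      pexp (M.blocksLaw (π θ) p.Tmax p.H (blocksEnd s cs)) fun ns =>
        M.npgEst p π θ g φ ⟨b, cs, ns⟩ - M.npgDirection π g θ)‖
      ≤ G₁ / μ * (47 / (lam * T ^ 2) + 1216 * C * G₁ ^ 2 / (p.Tmax * μ * lam)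
        + 2304 * C * p.cγ / (p.Tmax * lam ^ 2) + 6 * √ε) := by
  obtain ⟨xs, hxs⟩ := CMDP.exists_critRoot hU g h.feature h.lam_pos h.critic
  have hG := h.score_nonneg
  have hμ := h.mu_pos
  have hlam := h.lam_pos
  have hC : 0 < C := by linarith [h.half_le]
  set P := M.blocksLaw (π θ) p.Tmax p.H s with hP
  set X := fun cs => M.critIter p (π θ) g φ cs with hXdef
  set R := fun cs => M.npgRoot π θ hU (M.critAdv (π θ) g φ (X cs)) with hR
  set v := M.npgRoot π θ hU (M.critAdv (π θ) g φ xs) - M.npgDirection π g θ with hv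
  set q := 1 / (T : ℝ) ^ 2 + 32 * C * G₁ ^ 2 / (p.Tmax * μ) with hq
  have hq0 : 0 ≤ q := by positivity
  set N := fun cs => pexp (M.blocksLaw (π θ) p.Tmax p.H (blocksEnd s cs)) fun ns =>
    M.npgIter p π θ g φ (X cs) ns - R cs with hN
  have hX : PBdd P fun cs => X cs - xs :=
    (h.oracleCritic hxs).pbdd_sgd h.stepCritic.nonneg p.H hs
  have hX1 : pexp P (fun cs => ‖X cs - xs‖) ≤ 3 / lam :=
    (h.oracleCritic hxs).pexp_sgd_norm h.stepCritic h.half_le h.target p.H hs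
  have hsplit : ∀ cs ∈ P.support, pexp (M.blocksLaw (π θ) p.Tmax p.H (blocksEnd s cs)) (fun ns =>
        M.npgEst p π θ g φ ⟨b, cs, ns⟩ - M.npgDirection π g θ)
      = N cs + (M.npgSlope π θ hU φ (X cs - xs) + v) := by
    intro cs hcs
    have hs' := (CMDP.mem_blocksLaw hs hcs).2
    rw [pexp_congr (g := fun ns => (M.npgIter p π θ g φ (X cs) ns - R cs)
      + (M.npgSlope π θ hU φ (X cs - xs) + v)) fun ns hns => by
        rw [CMDP.npgEst_eq hU hs hcs hns, ← CMDP.npgRoot_critAdv_sub hU g]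
        simp only [hv, hR, hXdef]
        abel,
      pexp_add (h.pbdd_npgIter (X cs) hs') (PBdd.const _ _), pexp_const]
  have hNle : ∀ cs ∈ P.support, ‖N cs‖
      ≤ q * (2 * G₁ / μ) * (10 / lam + 3 * ‖X cs - xs‖) := by
    intro cs hcs
    refine (h.npgIter_bias (X cs) (CMDP.mem_blocksLaw hs hcs).2).trans ?_
    calc _ = q * (2 * G₁ / μ) * (1 + 3 * ‖X cs‖) := by ring
      _ ≤ _ := mul_le_mul_of_nonneg_left (h.norm_critIter_le hxs (X cs)) (by positivity)
  have hub : PBdd P fun cs => q * (2 * G₁ / μ) * (10 / lam + 3 * ‖X cs - xs‖) :=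
    ((PBdd.const _ _).add (hX.norm.const_mul 3)).const_mul _
  have hNb : PBdd P N := hub.mono fun cs hcs => (hNle cs hcs).trans (le_abs_self _)
  rw [pexp_congr hsplit, pexp_add hNb ((hX.clm _).add (PBdd.const _ _)),
    pexp_add (hX.clm _) (PBdd.const _ _), pexp_const, pexp_clm hX]
  have h1 := norm_pexp_le_pexp hub hNle
  rw [pexp_mul_left, pexp_add (PBdd.const _ _) (hX.norm.const_mul 3), pexp_const,
    pexp_mul_left] at h1
  have h2 := CMDP.norm_npgSlope_le hU hG h.score_le hμ h.fisher h.feature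
    (pexp P fun cs => X cs - xs)
  have h3 : G₁ / μ * (3 * ‖pexp P fun cs => X cs - xs‖)
      ≤ G₁ / μ * (3 * ((1 / T ^ 2 + 256 * C * p.cγ / (p.Tmax * lam)) * (3 / lam))) := by
    gcongr
    exact h.critIter_bias hxs hs
  have h4 : q * (2 * G₁ / μ) * (10 / lam + 3 * pexp P fun cs => ‖X cs - xs‖)
      ≤ q * (2 * G₁ / μ) * (10 / lam + 3 * (3 / lam)) := by gcongr
  have h5 : ‖v‖ ≤ G₁ / μ * (6 * √ε) := h.approx xs hxs
  have e : G₁ / μ * (47 / (lam * T ^ 2) + 1216 * C * G₁ ^ 2 / (p.Tmax * μ * lam)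
        + 2304 * C * p.cγ / (p.Tmax * lam ^ 2) + 6 * √ε)
      = q * (2 * G₁ / μ) * (10 / lam + 3 * (3 / lam))
        + (G₁ / μ * (3 * ((1 / T ^ 2 + 256 * C * p.cγ / (p.Tmax * lam)) * (3 / lam)))
          + G₁ / μ * (6 * √ε)) := by
    rw [hq]; ring
  rw [e]
  exact (norm_add_le _ _).trans (add_le_add (h1.trans h4)
    ((norm_add_le _ _).trans (add_le_add (h2.trans h3) h5)))

end Epoch

/-! ### Conditioning on the burn-in event -/

section Conditioning

theorem pexp_ite_eq {α E : Type*} [NormedAddCommGroup E] [NormedSpace ℝ E] (p : PMF α) (b : α)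
    [∀ a, Decidable (a = b)] (f : α → E) : pexp p (fun a => if a = b then f a else 0) = (p b).toReal • f b := by
  unfold pexp
  rw [tsum_eq_single b fun a ha => by simp only [if_neg ha, smul_zero]]
  simp only [if_true]

theorem toReal_toOuterMeasure {α : Type*} (p : PMF α) (X : Set α) [∀ a, Decidable (a ∈ X)] :
    (p.toOuterMeasure X).toReal = pexp p fun a => if a ∈ X then (1 : ℝ) else 0 := by
  rw [PMF.toOuterMeasure_apply, ENNReal.tsum_toReal_eq]
  · refine tsum_congr fun a => ?_
    classical rw [Set.indicator_apply]
    dsimp only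
    split_ifs <;> simp
  · intro a
    classical rw [Set.indicator_apply]
    split_ifs
    · exact p.apply_ne_top a
    · exact ENNReal.zero_ne_top

theorem pbdd_ite {α E : Type*} [NormedAddCommGroup E] [NormedSpace ℝ E] {p : PMF α} {P : α → Prop}
    [∀ a, Decidable (P a)] {f : α → E} (hf : PBdd p f) : PBdd p fun a => if P a then f a else 0 :=
  hf.mono fun a _ => by
    split_ifs
    · exact le_rfl
    · rw [norm_zero]; exact norm_nonneg _

theorem pexp_ite_le_one {α : Type*} (p : PMF α) (P : α → Prop)
    [∀ a, Decidable (P a)] :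
    pexp p (fun a => if P a then (1 : ℝ) else 0) ≤ 1 :=
  pexp_le (pbdd_ite (PBdd.const p 1)) fun a _ => by split_ifs <;> norm_num

theorem pexp_ite_smul {α E : Type*} [NormedAddCommGroup E] [NormedSpace ℝ E] [CompleteSpace E]
    (p : PMF α) (P : α → Prop) [∀ a, Decidable (P a)] (v : E) :
    pexp p (fun a => if P a then v else 0)
      = pexp p (fun a => if P a then (1 : ℝ) else 0) • v := by
  have h := pexp_clm (pbdd_ite (P := P) (PBdd.const p (1 : ℝ)))
    (ContinuousLinearMap.toSpanSingleton ℝ v)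
  rw [ContinuousLinearMap.toSpanSingleton_apply] at h
  rw [← h]
  refine pexp_congr fun a _ => ?_
  rw [ContinuousLinearMap.toSpanSingleton_apply]
  split_ifs <;> simp

/-- Expectations under a weight `w` that is close to the indicator `I` of an event: bounds for the
conditional moments given the event carry over. -/
theorem weighted_moments {α E : Type*} [NormedAddCommGroup E] [NormedSpace ℝ E] [CompleteSpace E]
    {L : PMF α} {I w : α → ℝ} {F : α → E} {η B₁ B₂ : ℝ} (hI : ∀ a, I a = 0 ∨ I a = 1)
    (hw0 : ∀ a ∈ L.support, (1 - η) * I a ≤ w a) (hw1 : ∀ a ∈ L.support, w a ≤ I a)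
    (hη0 : 0 ≤ η) (hη : η ≤ 1 / 2) (hF : PBdd L F)
    (h1 : ‖pexp L fun a => I a • F a‖ ≤ pexp L I * B₁)
    (h2 : pexp L (fun a => I a * ‖F a‖ ^ 2) ≤ pexp L I * B₂) (hpos : 0 < pexp L w) :
    (pexp L w)⁻¹ * pexp L (fun a => w a * ‖F a‖ ^ 2) ≤ 2 * B₂ ∧
      ‖(pexp L w)⁻¹ • pexp L fun a => w a • F a‖ ≤ 2 * (B₁ + η * √B₂) := by
  have hI0 : ∀ a, 0 ≤ I a := fun a => by rcases hI a with h | h <;> rw [h]; norm_num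
  have hIb : PBdd L I := ⟨1, fun a _ => by rcases hI a with h | h <;> simp [h]⟩
  have hw00 : ∀ a ∈ L.support, 0 ≤ w a := fun a ha =>
    (mul_nonneg (by linarith) (hI0 a)).trans (hw0 a ha)
  have hwb : PBdd L w := hIb.mono fun a ha => by
    rw [Real.norm_of_nonneg (hw00 a ha), Real.norm_of_nonneg (hI0 a)]
    exact hw1 a ha
  set P := pexp L I with hP
  have hwP : pexp L w ≤ P := pexp_mono hwb hIb hw1
  have hPw : P ≤ 2 * pexp L w := by
    have := pexp_mono (hIb.const_mul (1 - η)) hwb hw0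
    rw [pexp_mul_left] at this
    nlinarith
  have hP0 : 0 < P := hpos.trans_le hwP
  have hsum : pexp L (fun a => I a * ‖F a‖) ≤ P * √B₂ := by
    have hcs := pexp_mul_sq_le hIb (hIb.mul hF.norm)
    have e1 : pexp L (fun a => I a * (I a * ‖F a‖)) = pexp L fun a => I a * ‖F a‖ :=
      pexp_congr fun a _ => by rcases hI a with h | h <;> simp [h]
    have e2 : pexp L (fun a => I a ^ 2) = P :=
      pexp_congr fun a _ => by rcases hI a with h | h <;> simp [h]
    have e3 : pexp L (fun a => (I a * ‖F a‖) ^ 2) = pexp L fun a => I a * ‖F a‖ ^ 2 :=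
      pexp_congr fun a _ => by rcases hI a with h | h <;> simp [h]
    rw [e1, e2, e3] at hcs
    have hB : 0 ≤ B₂ := by
      have : 0 ≤ pexp L fun a => I a * ‖F a‖ ^ 2 :=
        pexp_nonneg fun a _ => mul_nonneg (hI0 a) (sq_nonneg _)
      exact nonneg_of_mul_nonneg_right (this.trans h2) hP0
    refine le_of_sq_le_sq (hcs.trans ?_) (by positivity)
    rw [mul_pow, Real.sq_sqrt hB, sq, mul_assoc]
    gcongr
  constructor
  · rw [inv_mul_le_iff₀ hpos]
    have h3 : pexp L (fun a => w a * ‖F a‖ ^ 2) ≤ pexp L fun a => I a * ‖F a‖ ^ 2 :=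
      pexp_mono (hwb.mul hF.normSq) (hIb.mul hF.normSq) fun a ha =>
        mul_le_mul_of_nonneg_right (hw1 a ha) (sq_nonneg _)
    have hB : 0 ≤ B₂ := by
      have : 0 ≤ pexp L fun a => I a * ‖F a‖ ^ 2 :=
        pexp_nonneg fun a _ => mul_nonneg (hI0 a) (sq_nonneg _)
      exact nonneg_of_mul_nonneg_right (this.trans h2) hP0
    nlinarith
  · rw [norm_smul, norm_inv, Real.norm_of_nonneg hpos.le, inv_mul_le_iff₀ hpos]
    have e : pexp L (fun a => w a • F a)
        = pexp L (fun a => I a • F a) - pexp L fun a => (I a - w a) • F a := by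
      rw [← pexp_sub (hIb.smul hF) ((hIb.sub hwb).smul hF)]
      refine pexp_congr fun a _ => ?_
      rw [← sub_smul, sub_sub_cancel]
    have h3 : ‖pexp L fun a => (I a - w a) • F a‖ ≤ η * (P * √B₂) := by
      refine (norm_pexp_le_pexp ((hIb.mul hF.norm).const_mul η) fun a ha => ?_).trans ?_
      · rw [norm_smul, Real.norm_of_nonneg (by linarith [hw1 a ha]), ← mul_assoc]
        exact mul_le_mul_of_nonneg_right (by linarith [hw0 a ha]) (norm_nonneg _)
      · rw [pexp_mul_left]; gcongr
    rw [e]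
    have h4 := (norm_sub_le (pexp L fun a => I a • F a) (pexp L fun a => (I a - w a) • F a)).trans
      (add_le_add h1 h3)
    have h5 : 0 ≤ B₁ + η * √B₂ := by
      have : 0 ≤ P * B₁ := (norm_nonneg _).trans h1
      have := nonneg_of_mul_nonneg_right this hP0
      positivity
    nlinarith

/-- Integrals against a conditioned discrete law. -/
theorem integral_cond_pmf {Ω E : Type*} [MeasurableSpace Ω] (hΩ : ∀ X : Set Ω, MeasurableSet X)
    [NormedAddCommGroup E] [NormedSpace ℝ E] [CompleteSpace E] [SecondCountableTopology E]
    (p : PMF Ω) (X : Set Ω) [∀ ω, Decidable (ω ∈ X)] {F : Ω → E} (hF : PBdd p F) :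
    ∫ ω, F ω ∂(cond p.toMeasure X) = (pexp p fun ω => if ω ∈ X then (1 : ℝ) else 0)⁻¹ •
      pexp p fun ω => if ω ∈ X then F ω else 0 := by
  have : MeasurableSingletonClass Ω := ⟨fun _ => hΩ _⟩
  borelize E
  have hmeas : ∀ G : Ω → E, AEStronglyMeasurable G p.toMeasure := fun G =>
    (show Measurable G from fun _ _ => hΩ _).aestronglyMeasurable
  have hint : Integrable (fun ω => if ω ∈ X then F ω else 0) p.toMeasure := by
    obtain ⟨C, hC⟩ := pbdd_ite (P := (· ∈ X)) hF
    refine Integrable.of_bound (hmeas _) C ?_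
    rw [← PMF.restrict_toMeasure_support]
    exact ae_restrict_of_forall_mem (hΩ _) hC
  rw [ProbabilityTheory.cond, integral_smul_measure, ← integral_indicator (hΩ X),
    PMF.toMeasure_apply_eq_toOuterMeasure_apply _ (hΩ X), ENNReal.toReal_inv,
    toReal_toOuterMeasure]
  congr 1
  refine (PMF.integral_eq_tsum p (X.indicator F) ?_).trans (pexp_congr fun ω _ => ?_)
  · exact hint.congr (Eventually.of_forall fun ω => by classical rw [Set.indicator_apply])
  · classical rw [Set.indicator_apply]

end Conditioning

/-! ### The law of a run given its history -/

section Runs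

open scoped Classical

variable {S A : Type} [Fintype S] [Fintype A] {M : CMDP S A} {d : ℕ} {m : Signal → ℕ}
  {p : Params d} {π : Vec d → Policy S A} {φ : (g : Signal) → S → Vec (m g)}
  {V : Type} [NormedAddCommGroup V] [NormedSpace ℝ V] [CompleteSpace V]

theorem Run.measurableSet (X : Set (Run S A)) : MeasurableSet X := MeasurableSpace.measurableSet_top

/-- The burn-in of an epoch that starts in the state `x` of the algorithm is successful. -/
def CMDP.BurnedIn (M : CMDP S A) (π : Vec d → Policy S A) (x : AlgState S d)
    (e : EpochSample S A) : Prop :=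
  Visits (M.recurrent (π x.θ)) x.s e.burnIn

/-- The burn-ins of all epochs of a run from the state `x` are successful. -/
def CMDP.AllBurnedIn (M : CMDP S A) (p : Params d) (π : Vec d → Policy S A)
    (φ : (g : Signal) → S → Vec (m g)) : AlgState S d → List (EpochSample S A) → Prop
  | _, [] => True
  | x, e :: es => M.BurnedIn π x e ∧ M.AllBurnedIn p π φ (M.update p π φ x e) es

/-- The probability that the burn-ins of `n` epochs from the state `x` are successful. -/
def CMDP.burnInProb (M : CMDP S A) (p : Params d) (π : Vec d → Policy S A)
    (φ : (g : Signal) → S → Vec (m g)) (n : ℕ) (x : AlgState S d) : ℝ :=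
  pexp (M.epochsLaw p π φ n x) fun es => if M.AllBurnedIn p π φ x es then (1 : ℝ) else 0

/-- The probability of the history `hes` from the state `x`, and `0` if one of its burn-ins is not
successful. -/
def CMDP.histMass (M : CMDP S A) (p : Params d) (π : Vec d → Policy S A)
    (φ : (g : Signal) → S → Vec (m g)) : AlgState S d → List (EpochSample S A) → ℝ
  | _, [] => 1
  | x, e :: es => if M.BurnedIn π x e then
      (M.epochLaw p (π x.θ) x.s e).toReal * M.histMass p π φ (M.update p π φ x e) es else 0

/-- All parameters that occur in `n` epochs from the state `x` belong to `Θ`. -/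
def CMDP.StaysIn (M : CMDP S A) (p : Params d) (π : Vec d → Policy S A)
    (φ : (g : Signal) → S → Vec (m g)) (Θ : Set (Vec d)) : ℕ → AlgState S d → Prop
  | 0, _ => True
  | n + 1, x => x.θ ∈ Θ ∧ ∀ e ∈ (M.epochLaw p (π x.θ) x.s).support,
      M.StaysIn p π φ Θ n (M.update p π φ x e)

theorem CMDP.mem_epochsLaw_succ {n : ℕ} {x : AlgState S d} {es : List (EpochSample S A)} :
    es ∈ (M.epochsLaw p π φ (n + 1) x).support ↔ ∃ e ∈ (M.epochLaw p (π x.θ) x.s).support,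
      ∃ es' ∈ (M.epochsLaw p π φ n (M.update p π φ x e)).support, es = e :: es' := by
  rw [CMDP.epochsLaw]
  simp only [PMF.mem_support_bind_iff, PMF.mem_support_pure_iff]

theorem CMDP.length_of_mem_epochsLaw {n : ℕ} {x : AlgState S d} {es : List (EpochSample S A)}
    (h : es ∈ (M.epochsLaw p π φ n x).support) : es.length = n := by
  induction n generalizing x es with
  | zero => rw [(PMF.mem_support_pure_iff _ _).1 h]; rfl
  | succ n ih =>
    obtain ⟨e, -, es', hes', rfl⟩ := CMDP.mem_epochsLaw_succ.1 h
    rw [List.length_cons, ih hes']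

theorem CMDP.length_of_mem_epochLaw {pol : Policy S A} {s : S} {e : EpochSample S A}
    (h : e ∈ (M.epochLaw p pol s).support) : e.critic.length = p.H ∧ e.npg.length = p.H := by
  obtain ⟨b, -, h⟩ := (PMF.mem_support_bind_iff _ _ _).1 h
  obtain ⟨cs, hcs, h⟩ := (PMF.mem_support_bind_iff _ _ _).1 h
  obtain ⟨ns, hns, h⟩ := (PMF.mem_support_bind_iff _ _ _).1 h
  rw [(PMF.mem_support_pure_iff _ _).1 h]
  exact ⟨CMDP.length_of_mem_blocksLaw hcs, CMDP.length_of_mem_blocksLaw hns⟩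

theorem CMDP.length_getD_of_mem_epochsLaw {n k : ℕ} (hk : k < n) {x : AlgState S d}
    {es : List (EpochSample S A)} (h : es ∈ (M.epochsLaw p π φ n x).support) :
    (es.getD k ⟨[], [], []⟩).critic.length = p.H
      ∧ (es.getD k ⟨[], [], []⟩).npg.length = p.H := by
  induction n generalizing x es k with
  | zero => exact absurd hk (Nat.not_lt_zero _)
  | succ n ih =>
    obtain ⟨e, he, es', hes', rfl⟩ := CMDP.mem_epochsLaw_succ.1 h
    cases k with
    | zero => exact CMDP.length_of_mem_epochLaw he
    | succ k => exact ih (Nat.lt_of_succ_lt_succ hk) hes'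

theorem CMDP.mem_runLaw {ω : Run S A} : ω ∈ (M.runLaw p π φ).support ↔
    ω.init ∈ M.ρ.support ∧ ω.epochs ∈ (M.epochsLaw p π φ p.K (p.start ω.init)).support := by
  rw [CMDP.runLaw]
  simp only [PMF.mem_support_bind_iff, PMF.mem_support_pure_iff]
  constructor
  · rintro ⟨s, hs, es, hes, rfl⟩
    exact ⟨hs, hes⟩
  · rintro ⟨h1, h2⟩
    exact ⟨_, h1, _, h2, rfl⟩

/-! #### Admissible parameters -/

theorem CMDP.staysIn_of_forall {Θ : Set (Vec d)} {n : ℕ} {x : AlgState S d}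
    (h : ∀ es ∈ (M.epochsLaw p π φ n x).support, ∀ k < n,
      ((es.take k).foldl (M.update p π φ) x).θ ∈ Θ) : M.StaysIn p π φ Θ n x := by
  induction n generalizing x with
  | zero => trivial
  | succ n ih =>
    constructor
    · obtain ⟨es, hes⟩ := (M.epochsLaw p π φ (n + 1) x).support_nonempty
      exact h es hes 0 (Nat.succ_pos _)
    · intro e he
      refine ih fun es hes k hk => ?_
      exact h (e :: es) (CMDP.mem_epochsLaw_succ.2 ⟨e, he, es, hes, rfl⟩) (k + 1) (by omega)

theorem CMDP.StaysIn.foldl {Θ : Set (Vec d)} {k n : ℕ} {x : AlgState S d}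
    (h : M.StaysIn p π φ Θ (k + n) x) {es : List (EpochSample S A)}
    (hes : es ∈ (M.epochsLaw p π φ (k + n) x).support) :
    M.StaysIn p π φ Θ n ((es.take k).foldl (M.update p π φ) x) := by
  induction k generalizing x es with
  | zero => simpa using h
  | succ k ih =>
    rw [Nat.succ_add] at h hes
    obtain ⟨e, he, es', hes', rfl⟩ := CMDP.mem_epochsLaw_succ.1 hes
    exact ih (h.2 e he) hes'

theorem CMDP.allBurnedIn_iff {x : AlgState S d} {es : List (EpochSample S A)} :
    M.AllBurnedIn p π φ x es ↔ ∀ k < es.length,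
      M.BurnedIn π ((es.take k).foldl (M.update p π φ) x) (es.getD k ⟨[], [], []⟩) := by
  induction es generalizing x with
  | nil => simp [CMDP.AllBurnedIn]
  | cons e es ih =>
    rw [List.length_cons, Nat.forall_lt_succ_left, CMDP.AllBurnedIn, ih]
    rfl

/-! #### Expectations over epochs -/

theorem CMDP.pexp_epochsLaw_succ (n : ℕ) (x : AlgState S d) {F : List (EpochSample S A) → V}
    {C : ℝ} (hF : ∀ es, ‖F es‖ ≤ C) :
    pexp (M.epochsLaw p π φ (n + 1) x) F = pexp (M.epochLaw p (π x.θ) x.s) fun e =>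
      pexp (M.epochsLaw p π φ n (M.update p π φ x e)) fun es => F (e :: es) := by
  rw [CMDP.epochsLaw, pexp_bind ⟨C, fun es _ => hF es⟩]
  exact pexp_congr fun e _ => pexp_bind_pure _ _ ⟨C, fun es _ => hF _⟩

theorem CMDP.pexp_epochLaw (pol : Policy S A) (s : S) {F : EpochSample S A → V}
    (hF : PBdd (M.epochLaw p pol s) F) :
    pexp (M.epochLaw p pol s) F = pexp (M.rollout pol p.B s) fun b =>
      pexp (M.blocksLaw pol p.Tmax p.H (endState s b)) fun cs =>
        pexp (M.blocksLaw pol p.Tmax p.H (blocksEnd (endState s b) cs)) fun ns =>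
          F ⟨b, cs, ns⟩ := by
  rw [CMDP.epochLaw, pexp_bind hF]
  refine pexp_congr fun b hb => ?_
  have h1 := hF.bind_right hb
  rw [pexp_bind h1]
  refine pexp_congr fun cs hcs => ?_
  have h2 := h1.bind_right hcs
  rw [pexp_bind h2]
  exact pexp_congr fun ns _ => pexp_pure _ _

theorem CMDP.pexp_burnedIn_head (n : ℕ) (x : AlgState S d) {F : EpochSample S A → V} {C : ℝ}
    (hF : ∀ e, ‖F e‖ ≤ C) :
    pexp (M.epochsLaw p π φ (n + 1) x)
      (fun es => if M.AllBurnedIn p π φ x es then F (es.getD 0 ⟨[], [], []⟩) else 0)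
      = pexp (M.epochLaw p (π x.θ) x.s) fun e =>
        (if M.BurnedIn π x e then M.burnInProb p π φ n (M.update p π φ x e) else 0) • F e := by
  have hC : 0 ≤ C := (norm_nonneg _).trans (hF ⟨[], [], []⟩)
  rw [CMDP.pexp_epochsLaw_succ n x (C := C) fun es => by
    split_ifs
    · exact hF _
    · rwa [norm_zero]]
  refine pexp_congr fun e _ => ?_
  by_cases hb : M.BurnedIn π x e
  · simp only [CMDP.AllBurnedIn, hb, true_and, if_true, List.getD_cons_zero, CMDP.burnInProb]
    exact pexp_ite_smul _ _ _
  · simp only [CMDP.AllBurnedIn, hb, false_and, if_false, zero_smul, pexp_const]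

theorem CMDP.pexp_burnedIn_history (hes : List (EpochSample S A)) (n : ℕ) (x : AlgState S d)
    {F : EpochSample S A → V} {C : ℝ} (hF : ∀ e, ‖F e‖ ≤ C) :
    pexp (M.epochsLaw p π φ (hes.length + (n + 1)) x)
      (fun es => if M.AllBurnedIn p π φ x es ∧ es.take hes.length = hes
        then F (es.getD hes.length ⟨[], [], []⟩) else 0)
      = M.histMass p π φ x hes • pexp (M.epochLaw p
          (π (hes.foldl (M.update p π φ) x).θ) (hes.foldl (M.update p π φ) x).s) fun e =>
        (if M.BurnedIn π (hes.foldl (M.update p π φ) x) e then M.burnInProb p π φ n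
          (M.update p π φ (hes.foldl (M.update p π φ) x) e) else 0) • F e := by
  have hC : 0 ≤ C := (norm_nonneg _).trans (hF ⟨[], [], []⟩)
  induction hes generalizing x with
  | nil =>
    simp only [List.length_nil, zero_add, List.take_zero, and_true, CMDP.histMass, one_smul,
      List.foldl_nil]
    exact CMDP.pexp_burnedIn_head n x hF
  | cons e₀ hes ih =>
    rw [List.length_cons, show hes.length + 1 + (n + 1) = hes.length + (n + 1) + 1 by omega,
      CMDP.pexp_epochsLaw_succ _ x (C := C) fun es => by
        split_ifs
        · exact hF _
        · rwa [norm_zero]]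
    rw [pexp_congr (g := fun e => if e = e₀ then (if M.BurnedIn π x e then
        pexp (M.epochsLaw p π φ (hes.length + (n + 1)) (M.update p π φ x e))
          (fun es => if M.AllBurnedIn p π φ (M.update p π φ x e) es ∧ es.take hes.length = hes
        then F (es.getD hes.length ⟨[], [], []⟩) else 0) else 0) else 0), pexp_ite_eq, ih,
      CMDP.histMass, List.foldl_cons]
    · split_ifs
      · rw [smul_smul]
      · rw [smul_zero, zero_smul]
    · intro e _
      by_cases he : e = e₀
      · by_cases hb : M.BurnedIn π x e
        · subst he
          simp [CMDP.AllBurnedIn, hb]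
        · simp [CMDP.AllBurnedIn, hb, pexp_const]
      · simp [he, pexp_const]

/-! #### The probability of successful burn-ins -/

theorem CMDP.burnInProb_nonneg (n : ℕ) (x : AlgState S d) : 0 ≤ M.burnInProb p π φ n x :=
  pexp_nonneg fun es _ => by split_ifs <;> norm_num

theorem CMDP.burnInProb_le_one (n : ℕ) (x : AlgState S d) : M.burnInProb p π φ n x ≤ 1 :=
  pexp_ite_le_one _ _

theorem CMDP.one_sub_le_burnInProb {Θ : Set (Vec d)} {δ : ℝ} (hδ : 0 ≤ δ)
    (h : ∀ θ ∈ Θ, ∀ s, M.noVisit (π θ) (M.recurrent (π θ)) p.B s ≤ ENNReal.ofReal δ) {n : ℕ}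
    {x : AlgState S d} (hx : M.StaysIn p π φ Θ n x) : 1 - n * δ ≤ M.burnInProb p π φ n x := by
  induction n generalizing x with
  | zero =>
    rw [CMDP.burnInProb, CMDP.epochsLaw, pexp_pure]
    simp [CMDP.AllBurnedIn]
  | succ n ih =>
    have h1 := CMDP.pexp_burnedIn_head (M := M) (p := p) (π := π) (φ := φ) n x
      (F := fun _ => (1 : ℝ)) (C := 1) (by simp)
    simp only [smul_eq_mul, mul_one] at h1
    have h2 : pexp (M.epochLaw p (π x.θ) x.s) (fun e => if ¬ M.BurnedIn π x e then (1 : ℝ) else 0)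
        ≤ δ := by
      rw [CMDP.pexp_epochLaw _ _ (pbdd_ite (PBdd.const _ (1 : ℝ)))]
      have h3 := h x.θ hx.1 x.s
      rw [CMDP.noVisit] at h3
      have h4 := ENNReal.toReal_mono ENNReal.ofReal_ne_top h3
      rw [ENNReal.toReal_ofReal hδ, toReal_toOuterMeasure] at h4
      refine (pexp_congr fun b _ => ?_).trans_le h4
      by_cases hv : Visits (M.recurrent (π x.θ)) x.s b
      · simp [CMDP.BurnedIn, hv, pexp_const]
      · simp [CMDP.BurnedIn, hv, pexp_const]
    change _ ≤ pexp _ _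
    rw [h1]
    have hb1 : PBdd (M.epochLaw p (π x.θ) x.s)
        fun e => if ¬ M.BurnedIn π x e then (1 : ℝ) else 0 := pbdd_ite (PBdd.const _ (1 : ℝ))
    have h5 : pexp (M.epochLaw p (π x.θ) x.s) (fun e => (1 - n * δ)
        - if ¬ M.BurnedIn π x e then (1 : ℝ) else 0) ≤ pexp (M.epochLaw p (π x.θ) x.s) fun e =>
          if M.BurnedIn π x e then M.burnInProb p π φ n (M.update p π φ x e) else 0 := by
      refine pexp_mono ((PBdd.const _ _).sub hb1) (pbdd_ite ⟨1, fun e _ => ?_⟩) fun e he => ?_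
      · rw [Real.norm_of_nonneg (CMDP.burnInProb_nonneg _ _)]
        exact CMDP.burnInProb_le_one _ _
      · by_cases hb : M.BurnedIn π x e
        · simpa [hb] using ih (hx.2 e he)
        · simp only [hb, not_false_eq_true, if_true, if_false]
          have : 0 ≤ n * δ := by positivity
          linarith
    rw [pexp_sub (PBdd.const _ _) hb1, pexp_const] at h5
    push_cast
    linarith

/-! #### Conditional expectations -/

/-- Every conditional expectation of a function of epoch `k` is an average over the law of one
epoch, weighted by the success of the burn-in and by the probability that the later burn-ins are
successful. -/
theorem CMDP.integral_condLaw [SecondCountableTopology V] {k : ℕ} (hk : k < p.K) {h : Run S A}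
    (hh : (M.runLaw p π φ).toMeasure (M.burnInEvent p π φ ∩ {ω | ω.before k = h}) ≠ 0)
    {F : EpochSample S A → V} {C : ℝ}
    (hF : ∀ e, e.critic.length = p.H → e.npg.length = p.H → ‖F e‖ ≤ C) :
    let x := M.stateAfter p π φ h
    let w : EpochSample S A → ℝ := fun e => if M.BurnedIn π x e then
      M.burnInProb p π φ (p.K - (k + 1)) (M.update p π φ x e) else 0
    0 < pexp (M.epochLaw p (π x.θ) x.s) w ∧
      ∫ ω, F (ω.epoch k) ∂(M.condLaw p π φ k h) = (pexp (M.epochLaw p (π x.θ) x.s) w)⁻¹ •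
        pexp (M.epochLaw p (π x.θ) x.s) fun e => w e • F e := by
  intro x w
  set E := M.burnInEvent p π φ ∩ {ω | ω.before k = h} with hE
  -- a run of positive probability in the event
  obtain ⟨ω₀, hω₀, hω₀E⟩ : ∃ ω ∈ (M.runLaw p π φ).support, ω ∈ E := by
    rw [Ne, PMF.toMeasure_apply_eq_zero_iff _ (Run.measurableSet _), Set.not_disjoint_iff] at hh
    exact hh
  have hlen : h.epochs.length = k := by
    have h1 : ω₀.epochs.length = p.K := CMDP.length_of_mem_epochsLaw (CMDP.mem_runLaw.1 hω₀).2
    have h2 : ω₀.before k = h := hω₀E.2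
    rw [← h2, Run.before, List.length_take, h1]
    omega
  have hK : p.K = h.epochs.length + (p.K - (k + 1) + 1) := by omega
  have hmem : ∀ s, ∀ es ∈ (M.epochsLaw p π φ p.K (p.start s)).support,
      ((⟨s, es⟩ : Run S A) ∈ E ↔ s = h.init ∧
        (M.AllBurnedIn p π φ (p.start s) es ∧ es.take h.epochs.length = h.epochs)) := by
    intro s es hes
    have h1 : (⟨s, es⟩ : Run S A) ∈ M.burnInEvent p π φ ↔
        M.AllBurnedIn p π φ (p.start s) es := by
      rw [CMDP.allBurnedIn_iff, CMDP.length_of_mem_epochsLaw hes]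
      rfl
    have h2 : (⟨s, es⟩ : Run S A).before k = h ↔ s = h.init ∧ es.take k = h.epochs := by
      rw [Run.before]
      exact ⟨fun h => by rw [← h]; exact ⟨rfl, rfl⟩, fun ⟨h1, h2⟩ => by rw [h1, h2]⟩
    rw [hE, Set.mem_inter_iff, h1, hlen]
    change _ ∧ (⟨s, es⟩ : Run S A).before k = h ↔ _
    rw [h2]
    tauto
  set c := (M.ρ h.init).toReal * M.histMass p π φ (p.start h.init) h.epochs with hc
  have key : ∀ {W : Type} [NormedAddCommGroup W] [NormedSpace ℝ W] [CompleteSpace W]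
      (G : EpochSample S A → W) (D : ℝ), (∀ e, ‖G e‖ ≤ D) →
      pexp (M.runLaw p π φ) (fun ω => if ω ∈ E then G (ω.epoch k) else 0)
        = c • pexp (M.epochLaw p (π x.θ) x.s) fun e => w e • G e := by
    intro W _ _ _ G D hG
    have hD : 0 ≤ D := (norm_nonneg _).trans (hG ⟨[], [], []⟩)
    have hb : ∀ ω : Run S A, ‖if ω ∈ E then G (ω.epoch k) else 0‖ ≤ D := fun ω => by
      split_ifs
      · exact hG _
      · rwa [norm_zero]
    rw [CMDP.runLaw, pexp_bind ⟨D, fun ω _ => hb ω⟩]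
    rw [pexp_congr (g := fun s => if s = h.init then
      pexp (M.epochsLaw p π φ (h.epochs.length + (p.K - (k + 1) + 1)) (p.start s))
        (fun es => if M.AllBurnedIn p π φ (p.start s) es ∧ es.take h.epochs.length = h.epochs
          then G (es.getD h.epochs.length ⟨[], [], []⟩) else 0) else 0), pexp_ite_eq,
      CMDP.pexp_burnedIn_history h.epochs _ _ hG, smul_smul]
    · rfl
    · intro s _
      rw [pexp_bind_pure _ (fun es => (⟨s, es⟩ : Run S A)) (f := fun ω => if ω ∈ E then
        G (ω.epoch k) else 0) ⟨D, fun es _ => hb _⟩, ← hK]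
      split_ifs with hs
      · refine pexp_congr fun es hes => ?_
        have h3 := hmem s es hes
        simp only [hs, true_and, hlen] at h3
        simp only [Run.epoch, hs, hlen]
        exact if_congr h3 rfl rfl
      · rw [pexp_congr (g := fun _ => 0) fun es hes => by
          rw [if_neg]; rw [hmem s es hes]; tauto, pexp_const]
  have hmass := key (fun _ => (1 : ℝ)) 1 (by simp)
  simp only [smul_eq_mul, mul_one] at hmass
  have hw0 : 0 ≤ pexp (M.epochLaw p (π x.θ) x.s) w := pexp_nonneg fun e _ => by
    simp only [w]
    split_ifs
    · exact CMDP.burnInProb_nonneg _ _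
    · exact le_rfl
  have hpos : pexp (M.runLaw p π φ) (fun ω => if ω ∈ E then (1 : ℝ) else 0) ≠ 0 := by
    rw [← toReal_toOuterMeasure, ← PMF.toMeasure_apply_eq_toOuterMeasure_apply _ (Run.measurableSet _)]
    exact (ENNReal.toReal_pos hh (measure_ne_top _ _)).ne'
  rw [hmass] at hpos
  refine ⟨hw0.lt_of_ne' (right_ne_zero_of_mul hpos), ?_⟩
  -- `F` is only evaluated on samples with the right number of iterations
  set F' : EpochSample S A → V := fun e =>
    if e.critic.length = p.H ∧ e.npg.length = p.H then F e else 0 with hF'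
  have hF'b : ∀ e, ‖F' e‖ ≤ max C 0 := fun e => by
    simp only [hF']
    split_ifs with h1
    · exact (hF e h1.1 h1.2).trans (le_max_left _ _)
    · rw [norm_zero]; exact le_max_right _ _
  have hlenω : ∀ ω ∈ (M.runLaw p π φ).support,
      (ω.epoch k).critic.length = p.H ∧ (ω.epoch k).npg.length = p.H := fun ω hω =>
    CMDP.length_getD_of_mem_epochsLaw hk (CMDP.mem_runLaw.1 hω).2
  have h1 := key F' _ hF'b
  rw [pexp_congr (g := fun ω => if ω ∈ E then F (ω.epoch k) else 0) fun ω hω => by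
      simp only [hF', if_pos (hlenω ω hω)],
    pexp_congr (p := M.epochLaw p (π x.θ) x.s) (g := fun e => w e • F e) fun e he => by
      simp only [hF', if_pos (CMDP.length_of_mem_epochLaw he)]] at h1
  rw [CMDP.condLaw, integral_cond_pmf Run.measurableSet _ _
    ⟨C, fun ω hω => hF _ (hlenω ω hω).1 (hlenω ω hω).2⟩]
  change (pexp (M.runLaw p π φ) fun ω => if ω ∈ E then (1 : ℝ) else 0)⁻¹ •
    pexp (M.runLaw p π φ) (fun ω => if ω ∈ E then F (ω.epoch k) else 0) = _
  rw [h1, hmass, smul_smul, mul_inv]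
  congr 1
  have := left_ne_zero_of_mul hpos
  field_simp

end Runs

/-! ### Boundedness of the estimates -/

section Bounded

variable {S A : Type} [Fintype S] [Fintype A] {M : CMDP S A} {d n : ℕ} {p : Params d}
  {π : Vec d → Policy S A} {θ : Vec d} {g : Signal} {φ : S → Vec n}

theorem exists_norm_foldl_le {E : Type} [NormedAddCommGroup E] [NormedSpace ℝ E] {a b : ℝ}
    (ha : 0 ≤ a) (hb : 0 ≤ b) (γ : ℝ) (Tmax k : ℕ) {R : ℝ} (hR : 0 ≤ R) :
    ∃ D, 0 ≤ D ∧ ∀ u : E → Transition S A → E, (∀ x z, ‖u x z‖ ≤ a * ‖x‖ + b) →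
      ∀ x₀, ‖x₀‖ ≤ R → ∀ bs : List (ℕ × List (Transition S A)), bs.length = k →
        ‖bs.foldl (fun x c => x - γ • mlmc Tmax (u x) c.1 c.2) x₀‖ ≤ D := by
  induction k generalizing R with
  | zero =>
    refine ⟨R, hR, fun u _ x₀ hx₀ bs hbs => ?_⟩
    rw [List.length_eq_zero_iff.1 hbs]
    exact hx₀
  | succ k ih =>
    obtain ⟨D, hD, h⟩ := ih (R := R + |γ| * ((1 + 2 * Tmax) * (a * R + b))) (by positivity)
    refine ⟨D, hD, fun u hu x₀ hx₀ bs hbs => ?_⟩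
    obtain ⟨c, bs', rfl⟩ := List.exists_of_length_succ bs hbs
    refine h u hu _ ?_ bs' (by simpa using hbs)
    have h1 := norm_mlmc_le (X := Set.univ) (by positivity : 0 ≤ a * ‖x₀‖ + b)
      (fun z _ => hu x₀ z) (fun z _ => Set.mem_univ z) (τ := c.2) Tmax c.1
    refine (norm_sub_le _ _).trans (add_le_add hx₀ ?_)
    rw [norm_smul, Real.norm_eq_abs]
    gcongr
    exact h1.trans (by gcongr)

theorem CMDP.norm_criticDir_le (M : CMDP S A) (cγ : ℝ) (g : Signal) (hφ : ∀ s, ‖φ s‖ ≤ 1)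
    (ξ : ℝ × Vec n) (z : Transition S A) :
    ‖M.criticDir cγ g φ ξ z‖ ≤ (|cγ| + 3) * ‖ξ‖ + (|cγ| + 1) := by
  have h1 : ‖ξ.1‖ ≤ ‖ξ‖ := norm_fst_le ξ
  have h2 : ‖ξ.2‖ ≤ ‖ξ‖ := norm_snd_le ξ
  have h3 := M.abs_signal_le g z.1 z.2.1
  have h4 : |inner ℝ (φ z.1 - φ z.2.2) ξ.2| ≤ 2 * ‖ξ.2‖ := CMDP.abs_inner_feature_sub_le hφ _ _ _
  rw [Real.norm_eq_abs] at h1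
  refine norm_prod_le_iff.2 ⟨?_, ?_⟩
  · change |cγ * ξ.1 - cγ * M.signal g z.1 z.2.1| ≤ _
    rw [← mul_sub, abs_mul]
    have h5 : |ξ.1 - M.signal g z.1 z.2.1| ≤ ‖ξ‖ + 1 := (abs_sub _ _).trans (add_le_add h1 h3)
    have h6 : |cγ| * |ξ.1 - M.signal g z.1 z.2.1| ≤ |cγ| * (‖ξ‖ + 1) := by gcongr
    linarith [norm_nonneg ξ]
  · change ‖ξ.1 • φ z.1 + inner ℝ (φ z.1 - φ z.2.2) ξ.2 • φ z.1
      - M.signal g z.1 z.2.1 • φ z.1‖ ≤ _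
    rw [← add_smul, ← sub_smul, norm_smul, Real.norm_eq_abs]
    refine (mul_le_of_le_one_right (abs_nonneg _) (hφ _)).trans ?_
    have h5 := (abs_sub (ξ.1 + inner ℝ (φ z.1 - φ z.2.2) ξ.2) (M.signal g z.1 z.2.1)).trans
      (add_le_add (abs_add_le _ _) le_rfl)
    have h6 : 0 ≤ |cγ| * ‖ξ‖ := by positivity
    have h7 := abs_nonneg cγ
    linarith

theorem CMDP.norm_npgDir_le {G₁ : ℝ} (hG : ∀ s a, ‖score π θ s a‖ ≤ G₁)
    (g : Signal) (hφ : ∀ s, ‖φ s‖ ≤ 1) (ξ : ℝ × Vec n) (ω : Vec d) (z : Transition S A) :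
    ‖M.npgDir π θ g φ ξ ω z‖ ≤ G₁ ^ 2 * ‖ω‖ + (1 + 3 * ‖ξ‖) * G₁ := by
  have h1 : |ξ.1| ≤ ‖ξ‖ := norm_fst_le ξ
  have h2 : ‖ξ.2‖ ≤ ‖ξ‖ := norm_snd_le ξ
  have h3 := M.abs_signal_le g z.1 z.2.1
  have h4 : |inner ℝ ξ.2 (φ z.2.2 - φ z.1)| ≤ 2 * ‖ξ.2‖ := by
    rw [real_inner_comm]; exact CMDP.abs_inner_feature_sub_le hφ _ _ _
  refine (norm_sub_le _ _).trans (add_le_add (norm_scoreOuter_le hG z ω) ?_)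
  rw [norm_smul, Real.norm_eq_abs]
  refine mul_le_mul ((abs_add_le _ _).trans ?_) (hG _ _) (norm_nonneg _) (by positivity)
  linarith [abs_sub (M.signal g z.1 z.2.1) ξ.1]

theorem CMDP.exists_norm_npgEst_le {G₁ : ℝ} (hG0 : 0 ≤ G₁) (hG : ∀ s a, ‖score π θ s a‖ ≤ G₁)
    (g : Signal) (hφ : ∀ s, ‖φ s‖ ≤ 1) : ∃ D, ∀ e : EpochSample S A,
      e.critic.length = p.H → e.npg.length = p.H → ‖M.npgEst p π θ g φ e‖ ≤ D := by
  obtain ⟨D₁, hD₁, h1⟩ := exists_norm_foldl_le (S := S) (A := A) (E := ℝ × Vec n)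
    (by positivity : 0 ≤ |p.cγ| + 3) (by positivity : 0 ≤ |p.cγ| + 1) p.γξ p.Tmax p.H le_rfl
  obtain ⟨D₂, hD₂, h2⟩ := exists_norm_foldl_le (S := S) (A := A) (E := Vec d)
    (sq_nonneg G₁) (by positivity : 0 ≤ (1 + 3 * D₁) * G₁) p.γω p.Tmax p.H le_rfl
  refine ⟨D₂, fun e he1 he2 => ?_⟩
  have h3 : ‖M.criticEst p g φ e‖ ≤ D₁ :=
    h1 _ (M.norm_criticDir_le p.cγ g hφ) 0 (by simp) e.critic he1
  refine h2 (M.npgDir π θ g φ (M.criticEst p g φ e)) (fun ω z => ?_) 0 (by simp) e.npg he2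
  refine (CMDP.norm_npgDir_le hG g hφ _ ω z).trans ?_
  gcongr

end Bounded

/-! ### Conditional moments of the NPG estimate -/

section Conditional

open scoped Classical

variable {S A : Type} [Fintype S] [Fintype A] {M : CMDP S A} {d : ℕ} {m : Signal → ℕ}
  {p : Params d} {π : Vec d → Policy S A} {φ : (g : Signal) → S → Vec (m g)}

/-- Bounds that hold for every successful burn-in carry over to the law of the epoch. -/
theorem CMDP.norm_pexp_burnedIn_le {V : Type} [NormedAddCommGroup V] [NormedSpace ℝ V]
    [CompleteSpace V] (x : AlgState S d) {F : EpochSample S A → V}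
    (hF : PBdd (M.epochLaw p (π x.θ) x.s) F) {B : ℝ}
    (h : ∀ b, endState x.s b ∈ M.recurrent (π x.θ) →
      ‖pexp (M.blocksLaw (π x.θ) p.Tmax p.H (endState x.s b)) fun cs =>
        pexp (M.blocksLaw (π x.θ) p.Tmax p.H (blocksEnd (endState x.s b) cs)) fun ns =>
          F ⟨b, cs, ns⟩‖ ≤ B) :
    ‖pexp (M.epochLaw p (π x.θ) x.s) fun e => (if M.BurnedIn π x e then (1 : ℝ) else 0) • F e‖
      ≤ pexp (M.epochLaw p (π x.θ) x.s) (fun e => if M.BurnedIn π x e then (1 : ℝ) else 0) * B := by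
  have hI : PBdd (M.epochLaw p (π x.θ) x.s) fun e => if M.BurnedIn π x e then (1 : ℝ) else 0 :=
    pbdd_ite (PBdd.const _ (1 : ℝ))
  rw [CMDP.pexp_epochLaw _ _ (hI.smul hF), CMDP.pexp_epochLaw _ _ hI, mul_comm, ← pexp_mul_left]
  refine norm_pexp_le_pexp (M.pbdd_rollout _ _ _ _) fun b hb => ?_
  by_cases hv : Visits (M.recurrent (π x.θ)) x.s b
  · have h1 : ∀ cs ns, M.BurnedIn π x ⟨b, cs, ns⟩ := fun _ _ => hv
    simp only [h1, if_true, one_smul, pexp_const, mul_one]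
    exact h b (CMDP.endState_of_visits hb hv)
  · have h1 : ∀ cs ns, ¬ M.BurnedIn π x ⟨b, cs, ns⟩ := fun _ _ => hv
    simp only [h1, if_false, zero_smul, pexp_const, mul_zero, norm_zero, le_refl]

theorem CMDP.condLaw_npgEst [Nontrivial (Vec d)] {k : ℕ} (hk : k < p.K) {h : Run S A}
    (hh : (M.runLaw p π φ).toMeasure (M.burnInEvent p π φ ∩ {ω | ω.before k = h}) ≠ 0)
    {g : Signal} {x : AlgState S d} (hx : x = M.stateAfter p π φ h) {hU : M.Unichain (π x.θ)}
    {T : ℕ} {G₁ μ lam C ε η : ℝ} (hc : M.EpochCond p π x.θ g (φ g) hU T G₁ μ lam C ε)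
    (hη0 : 0 ≤ η) (hη : η ≤ 1 / 2) (hprob : ∀ e ∈ (M.epochLaw p (π x.θ) x.s).support,
      1 - η ≤ M.burnInProb p π φ (p.K - (k + 1)) (M.update p π φ x e)) :
    MemLp (fun ω : Run S A => M.npgEst p π x.θ g (φ g) (ω.epoch k)) 2 (M.condLaw p π φ k h) ∧
    (∫ ω, ‖M.npgEst p π x.θ g (φ g) (ω.epoch k) - M.npgDirection π g x.θ‖ ^ 2
      ∂(M.condLaw p π φ k h)) ≤ 2 * ((G₁ / μ) ^ 2 * (3220 / lam ^ 2 + 144 * ε)) ∧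
    ‖∫ ω, M.npgEst p π x.θ g (φ g) (ω.epoch k) ∂(M.condLaw p π φ k h)
      - M.npgDirection π g x.θ‖ ≤ 2 * (G₁ / μ * (47 / (lam * T ^ 2)
        + 1216 * C * G₁ ^ 2 / (p.Tmax * μ * lam) + 2304 * C * p.cγ / (p.Tmax * lam ^ 2) + 6 * √ε)
        + η * √((G₁ / μ) ^ 2 * (3220 / lam ^ 2 + 144 * ε))) := by
  obtain ⟨D, hD⟩ := CMDP.exists_norm_npgEst_le (M := M) (p := p) hc.score_nonneg hc.score_le g
    hc.feature
  have hlen : ∀ᵐ ω ∂(M.condLaw p π φ k h), (ω.epoch k).critic.length = p.H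
      ∧ (ω.epoch k).npg.length = p.H := by
    refine (cond_absolutelyContinuous).ae_le ?_
    rw [← PMF.restrict_toMeasure_support]
    exact ae_restrict_of_forall_mem (Run.measurableSet _) fun ω hω =>
      CMDP.length_getD_of_mem_epochsLaw hk (CMDP.mem_runLaw.1 hω).2
  have : IsProbabilityMeasure (M.condLaw p π φ k h) := cond_isProbabilityMeasure hh
  have hLp : MemLp (fun ω : Run S A => M.npgEst p π x.θ g (φ g) (ω.epoch k)) 2
      (M.condLaw p π φ k h) :=
    MemLp.of_bound (show Measurable _ from fun _ _ => Run.measurableSet _).aestronglyMeasurable D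
      (hlen.mono fun ω hω => hD _ hω.1 hω.2)
  set ws := M.npgDirection π g x.θ with hws
  set F : EpochSample S A → Vec d := fun e => M.npgEst p π x.θ g (φ g) e - ws with hF
  have hFb : ∀ e, e.critic.length = p.H → e.npg.length = p.H → ‖F e‖ ≤ D + ‖ws‖ := fun e h1 h2 =>
    (norm_sub_le _ _).trans (add_le_add (hD e h1 h2) le_rfl)
  have hFL : PBdd (M.epochLaw p (π x.θ) x.s) F := ⟨D + ‖ws‖, fun e he =>
    hFb e (CMDP.length_of_mem_epochLaw he).1 (CMDP.length_of_mem_epochLaw he).2⟩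
  obtain ⟨hpos, hint1⟩ := CMDP.integral_condLaw hk hh hFb
  obtain ⟨-, hint2⟩ := CMDP.integral_condLaw (V := ℝ) hk hh (F := fun e => ‖F e‖ ^ 2)
    (C := (D + ‖ws‖) ^ 2) fun e h1 h2 => by
      rw [Real.norm_of_nonneg (by positivity)]
      exact pow_le_pow_left₀ (norm_nonneg _) (hFb e h1 h2) 2
  rw [← hx] at hpos hint1 hint2
  have hb1 := CMDP.norm_pexp_burnedIn_le x hFL fun b hb => hc.npg_bias hb b
  have hb2 := CMDP.norm_pexp_burnedIn_le x hFL.normSq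
    (B := (G₁ / μ) ^ 2 * (3220 / lam ^ 2 + 144 * ε)) fun b hb => by
      rw [Real.norm_of_nonneg (pexp_nonneg fun _ _ => pexp_nonneg fun _ _ => by positivity)]
      exact hc.npg_sq hb b
  have hw := weighted_moments (L := M.epochLaw p (π x.θ) x.s) (F := F)
    (I := fun e => if M.BurnedIn π x e then (1 : ℝ) else 0)
    (w := fun e => if M.BurnedIn π x e then
      M.burnInProb p π φ (p.K - (k + 1)) (M.update p π φ x e) else 0)
    (fun e => by split_ifs <;> simp)
    (fun e he => by
      split_ifs
      · simpa using hprob e he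
      · simp)
    (fun e he => by
      split_ifs
      · exact CMDP.burnInProb_le_one _ _
      · exact le_rfl) hη0 hη hFL hb1 ((le_abs_self _).trans hb2) hpos
  refine ⟨hLp, ?_, ?_⟩
  · rw [hint2]
    exact hw.1
  · have e : ∫ ω, M.npgEst p π x.θ g (φ g) (ω.epoch k) ∂(M.condLaw p π φ k h) - ws
        = ∫ ω, F (ω.epoch k) ∂(M.condLaw p π φ k h) := by
      rw [hF, integral_sub (hLp.integrable (by norm_num)) (integrable_const _), integral_const,
        probReal_univ, one_smul]
    rw [e, hint1]
    exact hw.2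

end Conditional

/-! ### The constants -/

section Constants

theorem one_le_ratio {G₁ μ : ℝ} (hμ : 0 < μ) (hμG : μ ≤ G₁ ^ 2) : 1 ≤ G₁ ^ 2 / μ := by
  rwa [le_div_iff₀ hμ, one_mul]

theorem stepCond_critic {C cγ lam γ : ℝ} {Tmax : ℕ} (hC : 1 / 2 ≤ C) (hcγ : 1 ≤ cγ)
    (hlam : 0 < lam) (hlam1 : lam ≤ 1) (hγ : 0 ≤ γ)
    (hT : 2000000 * cγ ^ 2 * C ^ 2 / lam ≤ Tmax)
    (hstep : 2000000 * cγ ^ 2 * C ^ 2 * Real.log Tmax * γ ≤ lam) :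
    StepCond C Tmax γ (4 * cγ) (lam / 2) := by
  have h1 : 2000000 * cγ ^ 2 * C ^ 2 ≤ Tmax * lam := by rwa [div_le_iff₀ hlam] at hT
  have hCc : 1 / 2 ≤ cγ * C := by nlinarith
  have h2 : 1000000 * (cγ * C) ≤ Tmax * lam := by nlinarith
  have hT0 : (500000 : ℝ) ≤ Tmax := by
    have : (0 : ℝ) ≤ Tmax := Nat.cast_nonneg _
    nlinarith
  refine ⟨?_, hγ, ?_, ?_⟩
  · have : (2 : ℝ) ≤ Tmax := by linarith
    exact_mod_cast this
  · rw [div_mul_eq_mul_div, div_le_iff₀ (by linarith)]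
    nlinarith
  · have h3 : 0 ≤ cγ ^ 2 * C ^ 2 * Real.log Tmax * γ := by
      have := Real.log_nonneg (by linarith : (1 : ℝ) ≤ Tmax)
      positivity
    nlinarith

theorem stepCond_npg {C G₁ μ γ : ℝ} {Tmax : ℕ} (hC : 1 / 2 ≤ C) (hμ : 0 < μ)
    (hμG : μ ≤ G₁ ^ 2) (hγ : 0 ≤ γ) (hT : 2000000 * G₁ ^ 4 * C ^ 2 / μ ^ 2 ≤ Tmax)
    (hstep : 2000000 * G₁ ^ 4 * C ^ 2 * Real.log Tmax * γ ≤ μ) :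
    StepCond C Tmax γ (G₁ ^ 2) μ := by
  have hρ := one_le_ratio hμ hμG
  have e : 2000000 * G₁ ^ 4 * C ^ 2 / μ ^ 2 = 2000000 * (G₁ ^ 2 / μ) ^ 2 * C ^ 2 := by ring
  rw [e] at hT
  have hCρ : 1 / 2 ≤ G₁ ^ 2 / μ * C := by nlinarith
  have h2 : 1000000 * (G₁ ^ 2 / μ * C) ≤ Tmax := by nlinarith
  have hT0 : (500000 : ℝ) ≤ Tmax := by linarith
  refine ⟨?_, hγ, ?_, ?_⟩
  · have : (2 : ℝ) ≤ Tmax := by linarith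
    exact_mod_cast this
  · rw [div_mul_eq_mul_div, div_le_iff₀ (by linarith)]
    have h3 : 1000000 * (G₁ ^ 2 * C) ≤ μ * Tmax := by
      have e2 : 1000000 * (G₁ ^ 2 * C) = μ * (1000000 * (G₁ ^ 2 / μ * C)) := by field_simp
      rw [e2]
      gcongr
    have h4 : 0 ≤ G₁ ^ 2 * C := by positivity
    linarith
  · have h3 : 0 ≤ G₁ ^ 4 * C ^ 2 * Real.log Tmax * γ := by
      have := Real.log_nonneg (by linarith : (1 : ℝ) ≤ Tmax)
      positivity
    have e2 : γ * (3000 * C ^ 2 * Real.log Tmax) * (G₁ ^ 2) ^ 2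
        = 3000 * (G₁ ^ 4 * C ^ 2 * Real.log Tmax * γ) := by ring
    rw [e2]
    linarith

theorem second_moment_const {G₁ μ lam C D cγ ε Y : ℝ} (hμ : 0 < μ) (hμG : μ ≤ G₁ ^ 2)
    (hlam : 0 < lam) (hlam1 : lam ≤ 1) (hC : 1 / 2 ≤ C) (hCD : C ≤ D) (hcγ : 1 ≤ cγ) (hε : 0 ≤ ε)
    (hY : 0 ≤ Y) :
    2 * ((G₁ / μ) ^ 2 * (3220 / lam ^ 2 + 144 * ε)) ≤ 10 ^ 10 * (Y
      + G₁ ^ 6 * C ^ 2 * cγ ^ 4 * D ^ 2 / (μ ^ 4 * lam ^ 4) + G₁ ^ 2 * ε / μ ^ 2) := by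
  have hρ := one_le_ratio hμ hμG
  have hi : 1 ≤ 1 / lam := by rw [le_div_iff₀ hlam]; linarith
  have hD : 1 / 2 ≤ D := hC.trans hCD
  have e1 : G₁ ^ 6 * C ^ 2 * cγ ^ 4 * D ^ 2 / (μ ^ 4 * lam ^ 4)
      = (G₁ / μ) ^ 2 * (1 / lam) ^ 2 * ((1 / 16) * ((G₁ ^ 2 / μ) ^ 2 * (2 * C) ^ 2 * cγ ^ 4
        * (2 * D) ^ 2 * (1 / lam) ^ 2)) := by
    field_simp
    ring
  have e2 : G₁ ^ 2 * ε / μ ^ 2 = (G₁ / μ) ^ 2 * ε := by ring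
  have h1 : 1 ≤ (G₁ ^ 2 / μ) ^ 2 * (2 * C) ^ 2 * cγ ^ 4 * (2 * D) ^ 2 * (1 / lam) ^ 2 := by
    have a1 := one_le_pow₀ hρ (n := 2)
    have a2 := one_le_pow₀ (by linarith : 1 ≤ 2 * C) (n := 2)
    have a3 := one_le_pow₀ hcγ (n := 4)
    have a4 := one_le_pow₀ (by linarith : 1 ≤ 2 * D) (n := 2)
    have a5 := one_le_pow₀ hi (n := 2)
    exact one_le_mul_of_one_le_of_one_le (one_le_mul_of_one_le_of_one_le
      (one_le_mul_of_one_le_of_one_le (one_le_mul_of_one_le_of_one_le a1 a2) a3) a4) a5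
  have h2 : (G₁ / μ) ^ 2 * (1 / lam) ^ 2 * (1 / 16)
      ≤ G₁ ^ 6 * C ^ 2 * cγ ^ 4 * D ^ 2 / (μ ^ 4 * lam ^ 4) := by
    rw [e1]
    have : 0 ≤ (G₁ / μ) ^ 2 * (1 / lam) ^ 2 := by positivity
    nlinarith
  have h3 : 0 ≤ (G₁ / μ) ^ 2 * (1 / lam) ^ 2 := by positivity
  have h4 : 0 ≤ (G₁ / μ) ^ 2 * ε := by positivity
  have e3 : 2 * ((G₁ / μ) ^ 2 * (3220 / lam ^ 2 + 144 * ε))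
      = 6440 * ((G₁ / μ) ^ 2 * (1 / lam) ^ 2) + 288 * ((G₁ / μ) ^ 2 * ε) := by ring
  rw [e2, e3]
  linarith

/-- The bias bound in normalized variables: `i = 1/λ`, `τ = 1/T`, `N = 1/T_max`, `ρ = G₁²/μ`. -/
theorem bias_const_aux {i τ N ρ C D cγ s η : ℝ} (hi : 1 ≤ i) (hτ0 : 0 ≤ τ) (hτ : τ ≤ 1 / 2)
    (hN0 : 0 ≤ N) (hN : N ≤ 1) (hρ : 1 ≤ ρ) (hC : 1 / 2 ≤ C) (hCD : C ≤ D) (hcγ : 1 ≤ cγ)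
    (hs : 0 ≤ s) (hη0 : 0 ≤ η) (hη : η ≤ 2 * τ) :
    (2 * (47 * i * τ ^ 2 + 1216 * C * N * ρ * i + 2304 * C * cγ * N * i ^ 2 + 6 * s
      + η * √(3220 * i ^ 2 + 144 * s ^ 2))) ^ 2 ≤ 10 ^ 10 * (cγ ^ 2 * C ^ 4 * i ^ 2 * τ ^ 2
        + ρ ^ 4 * C ^ 4 * cγ ^ 2 * D ^ 2 * N * i ^ 4 + s ^ 2) := by
  have hC0 : 0 ≤ C := by linarith
  have hD : 1 ≤ 2 * D := by linarith
  have hsqrt : √(3220 * i ^ 2 + 144 * s ^ 2) ≤ 57 * i + 12 * s := by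
    refine Real.sqrt_le_iff.2 ⟨by positivity, ?_⟩
    nlinarith [mul_nonneg (by linarith : 0 ≤ i) hs, sq_nonneg i]
  set t₁ := cγ ^ 2 * C ^ 4 * i ^ 2 * τ ^ 2 with ht₁
  set t₂ := ρ ^ 4 * C ^ 4 * cγ ^ 2 * D ^ 2 * N * i ^ 4 with ht₂
  set P := i * τ with hP
  set Q := C * N * ρ * i with hQ
  set R := C * cγ * N * i ^ 2 with hR
  have hP2 : P ^ 2 ≤ 16 * t₁ := by
    have h1 : 1 ≤ cγ ^ 2 * (2 * C) ^ 4 := one_le_mul_of_one_le_of_one_le (one_le_pow₀ hcγ)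
      (one_le_pow₀ (by linarith))
    calc P ^ 2 = i ^ 2 * τ ^ 2 * 1 := by rw [hP]; ring
      _ ≤ i ^ 2 * τ ^ 2 * (cγ ^ 2 * (2 * C) ^ 4) := by gcongr
      _ = 16 * t₁ := by rw [ht₁]; ring
  have hN2 : N ^ 2 ≤ N := by nlinarith
  have hQ2 : Q ^ 2 ≤ 16 * t₂ := by
    have h1 : 1 ≤ (2 * C) ^ 2 * (2 * D) ^ 2 * cγ ^ 2 * ρ ^ 2 * i ^ 2 :=
      one_le_mul_of_one_le_of_one_le (one_le_mul_of_one_le_of_one_le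
        (one_le_mul_of_one_le_of_one_le (one_le_mul_of_one_le_of_one_le
          (one_le_pow₀ (by linarith)) (one_le_pow₀ hD)) (one_le_pow₀ hcγ)) (one_le_pow₀ hρ))
        (one_le_pow₀ hi)
    calc Q ^ 2 = C ^ 2 * ρ ^ 2 * i ^ 2 * N ^ 2 * 1 := by rw [hQ]; ring
      _ ≤ C ^ 2 * ρ ^ 2 * i ^ 2 * N * ((2 * C) ^ 2 * (2 * D) ^ 2 * cγ ^ 2 * ρ ^ 2 * i ^ 2) := by
        gcongr
      _ = 16 * t₂ := by rw [ht₂]; ring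
  have hR2 : R ^ 2 ≤ 16 * t₂ := by
    have h1 : 1 ≤ (2 * C) ^ 2 * (2 * D) ^ 2 * ρ ^ 4 :=
      one_le_mul_of_one_le_of_one_le (one_le_mul_of_one_le_of_one_le
        (one_le_pow₀ (by linarith)) (one_le_pow₀ hD)) (one_le_pow₀ hρ)
    calc R ^ 2 = C ^ 2 * cγ ^ 2 * i ^ 4 * N ^ 2 * 1 := by rw [hR]; ring
      _ ≤ C ^ 2 * cγ ^ 2 * i ^ 4 * N * ((2 * C) ^ 2 * (2 * D) ^ 2 * ρ ^ 4) := by gcongr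
      _ = 16 * t₂ := by rw [ht₂]; ring
  have hi0 : 0 ≤ i := by linarith
  have hP0 : 0 ≤ P := mul_nonneg hi0 hτ0
  have hsum : 47 * i * τ ^ 2 + 1216 * C * N * ρ * i + 2304 * C * cγ * N * i ^ 2 + 6 * s
      + η * √(3220 * i ^ 2 + 144 * s ^ 2) ≤ 138 * P + 1216 * Q + 2304 * R + 18 * s := by
    have h1 : η * √(3220 * i ^ 2 + 144 * s ^ 2) ≤ 2 * τ * (57 * i + 12 * s) := by gcongr
    have h2 : P * τ ≤ P * (1 / 2) := by gcongr
    have h3 : s * τ ≤ s * (1 / 2) := by gcongr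
    have e1 : 47 * i * τ ^ 2 = 47 * (P * τ) := by rw [hP]; ring
    have e2 : 2 * τ * (57 * i + 12 * s) = 114 * P + 24 * (s * τ) := by rw [hP]; ring
    have e3 : 1216 * C * N * ρ * i = 1216 * Q := by rw [hQ]; ring
    have e4 : 2304 * C * cγ * N * i ^ 2 = 2304 * R := by rw [hR]; ring
    rw [e1, e3, e4]
    linarith
  have h0 : 0 ≤ 47 * i * τ ^ 2 + 1216 * C * N * ρ * i + 2304 * C * cγ * N * i ^ 2 + 6 * s
      + η * √(3220 * i ^ 2 + 144 * s ^ 2) := by positivity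
  have h4 := pow_le_pow_left₀ h0 hsum 2
  have h5 : (138 * P + 1216 * Q + 2304 * R + 18 * s) ^ 2
      ≤ 4 * ((138 * P) ^ 2 + (1216 * Q) ^ 2 + (2304 * R) ^ 2 + (18 * s) ^ 2) := by
    generalize 138 * P = a, 1216 * Q = b, 2304 * R = c, 18 * s = e
    nlinarith [sq_nonneg (a - b), sq_nonneg (a - c), sq_nonneg (a - e), sq_nonneg (b - c),
      sq_nonneg (b - e), sq_nonneg (c - e)]
  have h6 : 0 ≤ t₁ := by positivity
  have h7 : 0 ≤ t₂ := by positivity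
  have h8 := sq_nonneg s
  rw [mul_pow]
  simp only [mul_pow] at h5
  linarith

theorem bias_const {G₁ μ lam C D cγ ε η b : ℝ} {T Tmax : ℕ} (hT : 2 ≤ T) (hTmax : 2 ≤ Tmax)
    (hG : 0 ≤ G₁) (hμ : 0 < μ) (hμG : μ ≤ G₁ ^ 2) (hlam : 0 < lam) (hlam1 : lam ≤ 1)
    (hC : 1 / 2 ≤ C) (hCD : C ≤ D) (hcγ : 1 ≤ cγ) (hε : 0 ≤ ε) (hη0 : 0 ≤ η) (hη : η ≤ 2 / T)
    (hb0 : 0 ≤ b) (hb : b ≤ 2 * (G₁ / μ * (47 / (lam * T ^ 2)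
        + 1216 * C * G₁ ^ 2 / (Tmax * μ * lam) + 2304 * C * cγ / (Tmax * lam ^ 2) + 6 * √ε)
        + η * √((G₁ / μ) ^ 2 * (3220 / lam ^ 2 + 144 * ε)))) :
    b ^ 2 ≤ 10 ^ 10 * (G₁ ^ 2 * cγ ^ 2 * C ^ 4 / (μ ^ 2 * lam ^ 2 * T ^ 2)
      + G₁ ^ 10 * C ^ 4 * cγ ^ 2 * D ^ 2 / (μ ^ 6 * Tmax * lam ^ 4) + G₁ ^ 2 * ε / μ ^ 2) := by
  have hT' : (2 : ℝ) ≤ T := by exact_mod_cast hT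
  have hTm' : (2 : ℝ) ≤ Tmax := by exact_mod_cast hTmax
  have h := bias_const_aux (i := 1 / lam) (τ := 1 / T) (N := 1 / Tmax) (ρ := G₁ ^ 2 / μ) (C := C)
    (D := D) (cγ := cγ) (s := √ε) (η := η) (by rw [le_div_iff₀ hlam]; linarith) (by positivity)
    (by rw [div_le_div_iff₀ (by linarith) (by norm_num)]; linarith) (by positivity)
    (by rw [div_le_one (by linarith)]; linarith) (one_le_ratio hμ hμG) hC hCD hcγ
    (Real.sqrt_nonneg _) hη0 (by rw [mul_one_div]; exact hη)
  rw [Real.sq_sqrt hε] at h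
  have e : √((G₁ / μ) ^ 2 * (3220 / lam ^ 2 + 144 * ε))
      = G₁ / μ * √(3220 * (1 / lam) ^ 2 + 144 * ε) := by
    rw [Real.sqrt_mul (sq_nonneg _), Real.sqrt_sq (by positivity)]
    congr 2
    ring
  rw [e] at hb
  set r := √(3220 * (1 / lam) ^ 2 + 144 * ε)
  have hb' : b ≤ G₁ / μ * (2 * (47 * (1 / lam) * (1 / T) ^ 2
      + 1216 * C * (1 / Tmax) * (G₁ ^ 2 / μ) * (1 / lam)
      + 2304 * C * cγ * (1 / Tmax) * (1 / lam) ^ 2 + 6 * √ε + η * r)) := by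
    refine hb.trans (le_of_eq ?_)
    ring
  have h1 := pow_le_pow_left₀ hb0 hb' 2
  rw [mul_pow] at h1
  refine (h1.trans (mul_le_mul_of_nonneg_left h (sq_nonneg _))).trans (le_of_eq ?_)
  field_simp

end Constants

/-! ### The assumptions on the policy class -/

section Assumptions

variable {S A : Type} [Fintype S] [Fintype A] {M : CMDP S A} {d n : ℕ} {m : Signal → ℕ}
  {π : Vec d → Policy S A} {Θ : Set (Vec d)}

theorem CMDP.targetTime_le_Ctar (hC : M.Ctar π Θ ≠ ⊤) {θ : Vec d} (hθ : θ ∈ Θ) :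
    M.targetTime (π θ) ≤ ENNReal.ofReal (M.Ctar π Θ).toReal := by
  rw [ENNReal.ofReal_toReal hC]
  exact le_iSup₂ (f := fun θ (_ : θ ∈ Θ) => M.targetTime (π θ)) θ hθ

theorem CMDP.half_le_Ctar (hU : ∀ θ ∈ Θ, M.Unichain (π θ)) (hC : M.Ctar π Θ ≠ ⊤)
    (hpos : 0 < (M.Ctar π Θ).toReal) : 1 / 2 ≤ (M.Ctar π Θ).toReal := by
  obtain ⟨θ, hθ, h0⟩ : ∃ θ ∈ Θ, M.targetTime (π θ) ≠ 0 := by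
    by_contra! h
    have : M.Ctar π Θ = 0 := by
      simp only [CMDP.Ctar, ENNReal.iSup_eq_zero]
      exact h
    rw [this] at hpos
    simp at hpos
  have h1 := (CMDP.half_le_of_targetTime (hU θ hθ) h0).trans (CMDP.targetTime_le_Ctar hC hθ)
  exact (ENNReal.ofReal_le_ofReal_iff hpos.le).1 h1

theorem CMDP.meanHit_le_Chit (hC : M.Chit π Θ ≠ ⊤) {θ : Vec d} (hθ : θ ∈ Θ) (s : S) :
    M.meanHit (π θ) (M.recurrent (π θ)) s ≤ ENNReal.ofReal (M.Chit π Θ).toReal := by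
  rw [ENNReal.ofReal_toReal hC]
  exact (le_iSup (fun s => M.meanHit (π θ) (M.recurrent (π θ)) s) s).trans
    (le_iSup₂ (f := fun θ (_ : θ ∈ Θ) => M.hitTime (π θ)) θ hθ)

theorem CMDP.criticLoss_nonneg (hU : M.Unichain (π θ)) (g : Signal) (φ : S → Vec n) (ζ : Vec n) :
    0 ≤ (1 / 2) * ∑ s, M.statDist (π θ) s * (M.value (π θ) g s - inner ℝ ζ (φ s)) ^ 2 :=
  mul_nonneg (by norm_num) (Finset.sum_nonneg fun s _ =>
    mul_nonneg ((CMDP.isStationary_statDist hU).nonneg s) (sq_nonneg _))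

theorem CMDP.iInf_criticLoss_le (hU : ∀ θ ∈ Θ, M.Unichain (π θ)) (hC : M.Ctar π Θ ≠ ⊤)
    (g : Signal) (φ : S → Vec n) {θ : Vec d} (hθ : θ ∈ Θ) :
    (⨅ ζ : Vec n, (1 / 2) *
      ∑ s, M.statDist (π θ) s * (M.value (π θ) g s - inner ℝ ζ (φ s)) ^ 2)
      ≤ M.criticError π Θ g φ := by
  refine le_ciSup (f := fun θ : Θ => ⨅ ζ : Vec n, (1 / 2) *
    ∑ s, M.statDist (π θ) s * (M.value (π θ) g s - inner ℝ ζ (φ s)) ^ 2)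
    ⟨1 / 2 * (2 * (M.Ctar π Θ).toReal) ^ 2, ?_⟩ ⟨θ, hθ⟩
  rintro _ ⟨⟨θ', hθ'⟩, rfl⟩
  have hd := CMDP.isStationary_statDist (hU θ' hθ')
  -- the weights `ζ = 0` have a loss of at most half the squared bound of the value function
  refine (ciInf_le ⟨0, ?_⟩ (0 : Vec n)).trans ?_
  · rintro _ ⟨ζ, rfl⟩
    exact CMDP.criticLoss_nonneg (hU θ' hθ') g φ ζ
  · gcongr
    calc _ ≤ ∑ s, M.statDist (π θ') s * (2 * (M.Ctar π Θ).toReal) ^ 2 := by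
          refine Finset.sum_le_sum fun s _ => ?_
          by_cases h0 : M.statDist (π θ') s = 0
          · simp [h0]
          · have h1 := CMDP.abs_value_le (hU θ' hθ') g ENNReal.toReal_nonneg
              (CMDP.targetTime_le_Ctar hC hθ') (CMDP.recurrent_of_statDist_ne_zero (hU θ' hθ') h0)
            rw [inner_zero_left, sub_zero]
            refine mul_le_mul_of_nonneg_left ?_ (hd.nonneg s)
            exact sq_le_sq.2 (h1.trans (le_abs_self _))
      _ = _ := by rw [← Finset.sum_mul, hd.sum_eq, one_mul]

theorem CMDP.criticError_nonneg (hU : ∀ θ ∈ Θ, M.Unichain (π θ)) (g : Signal) (φ : S → Vec n) :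
    0 ≤ M.criticError π Θ g φ :=
  Real.iSup_nonneg fun θ => Real.iInf_nonneg fun ζ =>
    CMDP.criticLoss_nonneg (hU θ θ.2) g φ ζ

theorem CMDP.criticError_le_epsApp (g : Signal) (φ : (g : Signal) → S → Vec (m g)) :
    M.criticError π Θ g (φ g) ≤ M.epsApp π Θ φ := by
  cases g
  · exact le_max_left _ _
  · exact le_max_right _ _

end Assumptions

section Parameters

variable {S A : Type} [Fintype S] [Fintype A] {M : CMDP S A} {d : ℕ} {m : Signal → ℕ}
  {p : Params d} {π : Vec d → Policy S A} {φ : (g : Signal) → S → Vec (m g)} {Θ : Set (Vec d)}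

/-- The parameters that occur from a history of positive probability on are admissible. -/
theorem CMDP.staysIn_stateAfter
    (h : ∀ ω ∈ (M.runLaw p π φ).support, ∀ k < p.K, (M.stateAfter p π φ (ω.before k)).θ ∈ Θ)
    {ω : Run S A} (hω : ω ∈ (M.runLaw p π φ).support) {k : ℕ} (hk : k < p.K) :
    M.StaysIn p π φ Θ (p.K - (k + 1) + 1) (M.stateAfter p π φ (ω.before k)) := by
  obtain ⟨h1, h2⟩ := CMDP.mem_runLaw.1 hω
  have h3 : M.StaysIn p π φ Θ p.K (p.start ω.init) := CMDP.staysIn_of_forall fun es hes j hj =>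
    h ⟨ω.init, es⟩ (CMDP.mem_runLaw.2 ⟨h1, hes⟩) j hj
  have e : p.K = k + (p.K - (k + 1) + 1) := by omega
  rw [e] at h2 h3
  exact h3.foldl h2

end Parameters

end UnichainCMDP

end

open UnichainCMDP in
theorem mainTheorem3 :
    ∃ (c₀ c₁ : ℝ) (q : ℕ), 0 < c₀ ∧ 0 < c₁ ∧
      ∀ (S A : Type) [Fintype S] [Fintype A] (d : ℕ) (m : Signal → ℕ)
        (M : CMDP S A) (π : Vec d → Policy S A) (Θ : Set (Vec d))
        (φ : (g : Signal) → S → Vec (m g)) (p : Params d) (T : ℕ)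
        (G₁ μ lam Chit Ctar C : ℝ) (lamG : Signal → ℝ),
        -- policy class: smooth, positive, unichain, bounded score, non-degenerate Fisher matrix
        IsOpen Θ →
        (∀ θ ∈ Θ, ∀ s a, 0 < prob (π θ) s a) →
        (∀ θ ∈ Θ, ∀ s a, DifferentiableAt ℝ (fun θ' => Real.log (prob (π θ') s a)) θ) →
        (∀ θ ∈ Θ, M.Unichain (π θ)) →
        (∀ θ ∈ Θ, ∀ s a, ‖score π θ s a‖ ≤ G₁) →
        0 < μ →
        (∀ θ ∈ Θ, ∀ x : Vec d, μ * ‖x‖ ^ 2 ≤ inner ℝ x (M.fisher π θ x)) →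
        -- hitting and target times
        M.Chit π Θ ≠ ⊤ → Chit = (M.Chit π Θ).toReal →
        M.Ctar π Θ ≠ ⊤ → Ctar = (M.Ctar π Θ).toReal → 0 < Ctar →
        C = Chit + Ctar →
        -- critic features
        (∀ g s, ‖φ g s‖ ≤ 1) →
        (∀ g, 0 < lamG g) →
        (∀ g, ∀ θ ∈ Θ, ∀ x ∈ (LinearMap.ker (M.criticMatrix (π θ) (φ g)).toLinearMap)ᗮ,
          lamG g * ‖x‖ ^ 2 ≤ inner ℝ x (M.criticMatrix (π θ) (φ g) x)) →
        lam = min (lamG .reward) (lamG .cost) → lam ≤ 1 →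
        -- inputs of the algorithm
        2 ≤ T → 0 < p.δ → 1 ≤ p.H → p.K ≤ T →
        4 * Chit * Real.logb 2 T ≤ p.B →
        lam + √(1 / lam ^ 2 - 1) ≤ p.cγ →
        p.γξ = 8 * Real.log T / (lam * p.H) →
        p.γω = 8 * Real.log T / (μ * p.H) →
        c₀ * p.cγ ^ 2 * Ctar ^ 2 / lam ≤ p.Tmax →
        c₀ * G₁ ^ 4 * Ctar ^ 2 / μ ^ 2 ≤ p.Tmax →
        c₀ * p.cγ ^ 2 * Ctar ^ 2 * Real.log p.Tmax * p.γξ ≤ lam →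
        c₀ * G₁ ^ 4 * Ctar ^ 2 * Real.log p.Tmax * p.γω ≤ μ →
        (∀ ω ∈ (M.runLaw p π φ).support, ∀ k < p.K,
          (M.stateAfter p π φ (ω.before k)).θ ∈ Θ) →
        -- conclusion, for every epoch, every history of positive probability, and both signals
        ∀ k < p.K, ∀ h : Run S A,
          (M.runLaw p π φ).toMeasure (M.burnInEvent p π φ ∩ {ω | ω.before k = h}) ≠ 0 →
          ∀ g : Signal,
            let θ := (M.stateAfter p π φ h).θ
            let est : Run S A → Vec d := fun ω => M.npgEst p π θ g (φ g) (ω.epoch k)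
            MeasureTheory.MemLp est 2 (M.condLaw p π φ k h) ∧
            (∫ ω, ‖est ω - M.npgDirection π g θ‖ ^ 2 ∂(M.condLaw p π φ k h)
              ≤ c₁ * (G₁ ^ 2 * C ^ 2 * p.cγ ^ 2 / (μ ^ 2 * T ^ 2 * lam ^ 2)
                + G₁ ^ 6 * Ctar ^ 2 * p.cγ ^ 4 * C ^ 2 / (μ ^ 4 * lam ^ 4)
                + G₁ ^ 2 * M.epsApp π Θ φ / μ ^ 2)) ∧
            ‖∫ ω, est ω ∂(M.condLaw p π φ k h) - M.npgDirection π g θ‖ ^ 2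
              ≤ c₁ * (1 + Real.log T) ^ q *
                (G₁ ^ 2 * p.cγ ^ 2 * Ctar ^ 4 / (μ ^ 2 * lam ^ 2 * T ^ 2)
                + G₁ ^ 10 * Ctar ^ 4 * p.cγ ^ 2 * C ^ 2 / (μ ^ 6 * p.Tmax * lam ^ 4)
                + G₁ ^ 2 * M.epsApp π Θ φ / μ ^ 2) := by
  refine ⟨2000000, 10 ^ 10, 0, by norm_num, by norm_num, ?_⟩
  intro S A _ _ d m M π Θ φ p T G₁ μ lam Chit Ctar C lamG hΘ hpos hdiff hU hG hμ hF hChit hChit'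
    hCtar hCtar' hCtar0 hC hφ hlamG hcrit hlam hlam1 hT hδ hH hKT hB hcγ hγξ hγω hTm1 hTm2 hst1
    hst2 hsupp k hk h hh g θ est
  have hT' : (2 : ℝ) ≤ T := by exact_mod_cast hT
  have hlogT : 0 ≤ Real.log T := Real.log_nonneg (by linarith)
  have hH' : (1 : ℝ) ≤ p.H := by exact_mod_cast hH
  have hlam0 : 0 < lam := by rw [hlam]; exact lt_min (hlamG _) (hlamG _)
  have hlamg : lam ≤ lamG g := by
    rw [hlam]
    cases g
    · exact min_le_left _ _
    · exact min_le_right _ _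
  obtain ⟨ω₀, hω₀, hω₀E⟩ : ∃ ω ∈ (M.runLaw p π φ).support,
      ω ∈ M.burnInEvent p π φ ∩ {ω | ω.before k = h} := by
    rw [Ne, PMF.toMeasure_apply_eq_zero_iff _ (Run.measurableSet _), Set.not_disjoint_iff] at hh
    exact hh
  have hbefore : ω₀.before k = h := hω₀E.2
  have hsafe := CMDP.staysIn_stateAfter hsupp hω₀ hk
  rw [hbefore] at hsafe
  have hθ : θ ∈ Θ := hsafe.1
  have hG0 : 0 ≤ G₁ := by
    obtain ⟨a, -⟩ := (π θ ω₀.init).support_nonempty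
    exact (norm_nonneg _).trans (hG θ hθ ω₀.init a)
  have hε0 : 0 ≤ M.epsApp π Θ φ := (CMDP.criticError_nonneg hU g (φ g)).trans
    (CMDP.criticError_le_epsApp g φ)
  have hCtarH : 1 / 2 ≤ Ctar := by
    rw [hCtar'] at hCtar0 ⊢
    exact CMDP.half_le_Ctar hU hCtar hCtar0
  have hChit0 : 0 ≤ Chit := by rw [hChit']; exact ENNReal.toReal_nonneg
  have hCD : Ctar ≤ C := by rw [hC]; linarith
  obtain ⟨hcγ1, -⟩ := le_cGamma hlam0 hlam1 hcγ
  -- in dimension `0` there is nothing to estimate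
  rcases subsingleton_or_nontrivial (Vec d) with hd | hd
  · have h0 : ∀ v : Vec d, ‖v‖ = 0 := fun v => by rw [Subsingleton.elim v 0, norm_zero]
    refine ⟨?_, ?_, ?_⟩
    · rw [show est = fun _ => 0 from funext fun _ => Subsingleton.elim _ _]
      exact MemLp.zero'
    · simp only [h0]
      rw [zero_pow two_ne_zero, integral_zero]
      positivity
    · rw [h0, zero_pow two_ne_zero]
      positivity
  have hμG := CMDP.mu_le_sq (hU θ hθ) (hG θ hθ) (hF θ hθ)
  have hγξ0 : 0 ≤ p.γξ := by rw [hγξ]; positivity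
  have hγω0 : 0 ≤ p.γω := by rw [hγω]; positivity
  have hs1 := stepCond_critic hCtarH hcγ1 hlam0 hlam1 hγξ0 hTm1 hst1
  have hs2 := stepCond_npg hCtarH hμ hμG hγω0 hTm2 hst2
  have hp1 : (1 - p.γξ * (lam / 2) / 2) ^ p.H ≤ 1 / (T : ℝ) ^ 2 := by
    have h1 := hs1.mul_le_one hCtarH (by linarith) (by linarith)
    refine one_sub_pow_le_inv_sq hT (by linarith) (le_of_eq ?_)
    rw [hγξ]
    field_simp
    ring
  have hp2 : (1 - p.γω * μ / 2) ^ p.H ≤ 1 / (T : ℝ) ^ 2 := by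
    have h1 := hs2.mul_le_one hCtarH hμ hμG
    refine one_sub_pow_le_inv_sq hT (by linarith) ?_
    have e : p.γω * μ / 2 * p.H = 4 * Real.log T := by
      rw [hγω]
      field_simp
      ring
    rw [e]
    linarith
  have hcond : M.EpochCond p π θ g (φ g) (hU θ hθ) T G₁ μ lam Ctar (M.epsApp π Θ φ) := by
    refine ⟨hG0, hG θ hθ, hμ, hF θ hθ, hφ g, hlam0, hlam1, hcγ, fun x hx => ?_, hCtarH, ?_, hs1,
      hs2, hp1, hp2, hε0, fun xs hxs => ?_⟩
    · exact (mul_le_mul_of_nonneg_right hlamg (sq_nonneg _)).trans (hcrit g θ hθ x hx)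
    · rw [hCtar']
      exact CMDP.targetTime_le_Ctar hCtar hθ
    · refine (CMDP.norm_npgRoot_critRoot_sub_le hΘ hpos hdiff hU hθ g hG0 (hG θ hθ) hμ (hF θ hθ)
        hxs).trans ?_
      gcongr
      exact (CMDP.iInf_criticLoss_le hU hCtar g (φ g) hθ).trans
        (CMDP.criticError_le_epsApp g φ)
  -- at most `T - 1` epochs follow, each with a burn-in that fails with probability at most `2 / T²`
  have hprob : ∀ e ∈ (M.epochLaw p (π θ) (M.stateAfter p π φ h).s).support,
      1 - ((T : ℝ) - 1) * (2 / T ^ 2) ≤ M.burnInProb p π φ (p.K - (k + 1))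
        (M.update p π φ (M.stateAfter p π φ h) e) := by
    intro e he
    refine le_trans ?_ (CMDP.one_sub_le_burnInProb (δ := 2 / (T : ℝ) ^ 2) (by positivity)
      (fun θ' hθ' s => M.noVisit_burnIn (π θ') hChit0 (fun s => ?_) hT hB s) (hsafe.2 e he))
    · have h1 : ((p.K - (k + 1) : ℕ) : ℝ) ≤ T - 1 := by
        have h2 : p.K - (k + 1) + 1 ≤ T := by omega
        have h3 : ((p.K - (k + 1) : ℕ) : ℝ) + 1 ≤ T := by exact_mod_cast h2
        linarith
      have h4 : ((p.K - (k + 1) : ℕ) : ℝ) * (2 / T ^ 2) ≤ (T - 1) * (2 / T ^ 2) := by gcongr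
      linarith
    · rw [hChit']
      exact CMDP.meanHit_le_Chit hChit hθ' s
  have hη0 : 0 ≤ ((T : ℝ) - 1) * (2 / T ^ 2) := mul_nonneg (by linarith) (by positivity)
  have hη : ((T : ℝ) - 1) * (2 / T ^ 2) ≤ 1 / 2 := by
    rw [mul_div_assoc', div_le_div_iff₀ (by positivity) (by norm_num)]
    nlinarith [sq_nonneg ((T : ℝ) - 2)]
  have hη' : ((T : ℝ) - 1) * (2 / T ^ 2) ≤ 2 / T := by
    rw [mul_div_assoc', div_le_div_iff₀ (by positivity) (by linarith)]
    nlinarith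
  obtain ⟨h1, h2, h3⟩ := CMDP.condLaw_npgEst hk hh (x := M.stateAfter p π φ h) rfl hcond hη0 hη
    hprob
  refine ⟨h1, h2.trans ?_, ?_⟩
  · exact second_moment_const hμ hμG hlam0 hlam1 hCtarH hCD hcγ1 hε0 (by positivity)
  · rw [pow_zero, mul_one]
    exact bias_const hT hs1.two_le hG0 hμ hμG hlam0 hlam1 hCtarH hCD hcγ1 hε0 hη0 hη'
      (norm_nonneg _) h3
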